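/- Setting. For $n\ge 2$ and $\boldsymbol\theta\in\mathbb R^n$ let $\boldsymbol X\sim N(\boldsymbol\theta,\boldsymbol I_n)$ under $P_{\boldsymbol\theta}$. Let $\Phi$ be the standard normal distribution function, $s_\lambda(x)=\mathrm{sgn}(x)(|x|-\lambda)_+$, $h_\lambda(x)=xI\{|x|>\lambda\}$, $R(0,\lambda)=E\,s_\lambda(Z)^2$ with $Z\sim N(0,1)$, $\log_+x=1\vee\log x$, and $$\eta_{G_n}=\eta_{G_n}(\boldsymbol\theta)=\inf_{\lambda\ge0}E_{\boldsymbol\theta}\|s_\lambda(\boldsymbol X)-\boldsymbol\theta\|^2/n$$ the optimal soft threshold risk. Let $0<\alpha_2\le\alpha_1<1$, $\xi_{j,k}=-\Phi^{-1}(\alpha_jk/(2n))$, $N(t)=\#\{i:|X_i|\ge t\}$, $$\hat\xi_1=\min\{\xi_{1,k}:1\le k\le n,\ N(\xi_{1,k})\ge k\},\qquad \hat\xi_2=\max\{\xi_{2,k}:1\le k\le n,\ N(\xi_{2,k+1})<k+1\},$$ with $\hat\xi_1=\xi_{1,1}$ if no $k$ satisfies $N(\xi_{1,k})\ge k$. Let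 $\hat\lambda=\hat\lambda_n$ be a measurable function of $\boldsymbol X$ with $$\sqrt{1+\delta_{1,n}}\,g_{1,n}(\hat\xi_1)\le\hat\lambda\le\sqrt{1+\delta_{2,n}}\,\hat\xi_2,\qquad 0\le\delta_{1,n}\le\delta_{2,n}\to0,$$ where, for a constant $M_0$ and some $0<c_{1,n}\le2$, $|c_{2,n}|\le M_0$ with $c_{2,n}\le0$ if $c_{1,n}=2$, the function $g_{1,n}$ is differentiable on $(0,\infty)$ and satisfies for all $x>0$ $$0\le g_{1,n}(x)\le x,\quad 0\le g_{1,n}'(x)\le M_0,\quad R(0,g_{1,n}(x))\le\min\Big\{4\Phi(-x),\frac{M_0\Phi(-x)}{(x^{c_{1,n}}+2)(1\vee\log x)^{c_{2,n}}}\Big\}.$$ Let $t_\lambda(x)$, $\lambda\ge0$, be functions with $s_\lambda(x)\le t_\lambda(x)\le h_\lambda(x)$ for $x\ge0$, $h_\lambda(x)\le t_\lambda(x)\le s_\lambda(x)$ for $x<0$, $0\le t_\lambda(y)-t_\lambda(x)\le\kappa_0(y-x)$ for $x<y$, and $|t_\lambda(x)-t_{\lambda'}(x)|\le\kappa_1|\lambda-\lambda'|$,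 with constants $\kappa_0\in[1,2)$ and $\kappa_1<\infty$. Define $$L_{2,n}=(\log n)^{-3/2}\Big(\frac{\delta_{1,n}(\log n)^{(5-c_{1,n})/2}}{(\log_+\log n)^{c_{2,n}}}+\frac{(\log n)^{(3-c_{1,n})/2}}{(\log_+\log n)^{c_{2,n}-1}}\Big)^{1+\delta_{1,n}},\qquad \tau^*_{2,n}=\frac{L_{2,n}}{n^{1+\delta_{1,n}}}.$$ (i) Let $0<\alpha_2'<\alpha_2\le\alpha_1<\alpha_1'<1$, $0<\beta_0\le1/2$ and $A>0$ be constants such that $\delta_{1,n}\le A$ for all $n\ge 2$ and $1+\delta_{2,n}\le A$ for all $2\le n<n_*$, where $n_*=\min\{m\ge2:1+m^{\beta_0-1/2}/2\le1/\alpha_1'\}$ ($n_*=\infty$ if there is no such $m$). Then there is a constant $M^*$ depending on $\alpha_1',\alpha_2',\beta_0,A,M_0$ only such that for all $n\ge2$, all $\boldsymbol\theta\in\mathbb R^n$ and all $\eta_n\ge\eta_{G_n}$, $$\sqrt{E_{\boldsymbol\theta}\|t_{\hat\lambda}(\boldsymbol X)-\boldsymbol\theta\|^2/n}\le\sqrt{\eta_{G_n}}+M^*\sqrt{\tau_{1,n}\eta_{G_n}+\tau^*_{2,n}},$$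 where, with $L_{1,n}=e\vee\log(1/\eta_n)$, $$\tau_{1,n}=\max\Big(\delta_{2,n},\frac{\log(e\vee\log n)}{1\vee\log n},\frac{(\log L_{1,n})^{-c_{2,n}}}{L_{1,n}^{c_{1,n}/2}},\frac{\sqrt{\log L_{1,n}}}{\sqrt{L_{1,n}}}\Big).$$ (ii) Consequently, for all sequences $M_n\to\infty$ and $\eta_n\to0$, the level $\hat\lambda$ is adaptive ratio optimal for soft thresholding on the classes $\Theta_n^*=\{\boldsymbol\theta\in\mathbb R^n:M_nL_{2,n}/n^{1+\delta_{1,n}}\le\eta_{G_n}\le\eta_n\}$, that is, $$\sup_{\boldsymbol\theta\in\Theta_n^*}\frac{E_{\boldsymbol\theta}\|s_{\hat\lambda}(\boldsymbol X)-\boldsymbol\theta\|^2}{\inf_{\lambda\ge0}E_{\boldsymbol\theta}\|s_\lambda(\boldsymbol X)-\boldsymbol\theta\|^2}\le1+o(1).$$ -/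

import Mathlib

open MeasureTheory ProbabilityTheory Filter Topology
open scoped ENNReal

noncomputable section

namespace FDRThreshold

/-- The standard normal distribution function `Φ`. -/
def Phi (t : ℝ) : ℝ := cdf (gaussianReal 0 1) t

/-- The standard normal quantile function `Φ⁻¹` (the inverse of `Phi` on `(0, 1)`). -/
def PhiInv (p : ℝ) : ℝ := sInf {t : ℝ | p ≤ Phi t}

/-- The law `P_θ` of `X = (X_1, …, X_n)`: independent coordinates `X_i ∼ N(θ_i, 1)`. -/
def normalMeans {n : ℕ} (θ : Fin n → ℝ) : Measure (Fin n → ℝ) :=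
  Measure.pi fun i => gaussianReal (θ i) 1

/-- The squared Euclidean loss `‖v - θ‖²`. -/
def sqLoss {n : ℕ} (θ v : Fin n → ℝ) : ℝ := ∑ i, (v i - θ i) ^ 2

/-- The mean squared error `E_θ ‖T(X) - θ‖²` of an estimator `T`. -/
def mse {n : ℕ} (θ : Fin n → ℝ) (T : (Fin n → ℝ) → Fin n → ℝ) : ℝ :=
  ∫ x, sqLoss θ (T x) ∂(normalMeans θ)

/-- The soft threshold function `s_l(x) = sgn(x) (|x| - l)_+`. -/
def soft (l x : ℝ) : ℝ := Real.sign x * max (|x| - l) 0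

open Classical in
/-- The hard threshold function `h_l(x) = x I{|x| > l}`. -/
def hard (l x : ℝ) : ℝ := if l < |x| then x else 0

/-- The estimator `t_{l(X)}(X)`, applied coordinate by coordinate, where `t l` is the threshold
function with level `l` and the level `l(X)` may depend on the data. -/
def thresholdEst {n : ℕ} (t : ℝ → ℝ → ℝ) (l : (Fin n → ℝ) → ℝ) (x : Fin n → ℝ) : Fin n → ℝ :=
  fun i => t (l x) (x i)

/-- `inf_{l ≥ 0} E_θ ‖s_l(X) - θ‖²`, the optimal soft threshold risk. -/
def minSoftRisk {n : ℕ} (θ : Fin n → ℝ) : ℝ :=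
  ⨅ l : Set.Ici (0 : ℝ), mse θ (thresholdEst soft fun _ => (l : ℝ))

/-- `η_{G_n} = inf_{l ≥ 0} E_θ ‖s_l(X) - θ‖² / n`. -/
def etaOpt {n : ℕ} (θ : Fin n → ℝ) : ℝ := minSoftRisk θ / n

/-- `R(μ, l) = E (s_l(Z + μ) - μ)²` with `Z ∼ N(0, 1)`. -/
def softRisk (μ l : ℝ) : ℝ := ∫ z, (soft l (z + μ) - μ) ^ 2 ∂(gaussianReal 0 1)

/-- Candidate threshold levels `ξ_k = -Φ⁻¹(α k / (2 n))`. -/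
def xi (α : ℝ) (n k : ℕ) : ℝ := -PhiInv (α * k / (2 * n))

open Classical in
/-- `N(t) = #{i : |x_i| ≥ t}`. -/
def countAbove {n : ℕ} (x : Fin n → ℝ) (t : ℝ) : ℕ :=
  (Finset.univ.filter fun i => t ≤ |x i|).card

open Classical in
/-- The step-up (Benjamini-Hochberg) level `min {ξ_k : 1 ≤ k ≤ n, N(ξ_k) ≥ k}`; if no `k`
qualifies (nothing is rejected), it is the largest candidate level `ξ_1`. -/
def xiHat1 (α : ℝ) {n : ℕ} (x : Fin n → ℝ) : ℝ :=
  if ∃ k : ℕ, 1 ≤ k ∧ k ≤ n ∧ k ≤ countAbove x (xi α n k) then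
    sInf {y : ℝ | ∃ k : ℕ, 1 ≤ k ∧ k ≤ n ∧ k ≤ countAbove x (xi α n k) ∧ y = xi α n k}
  else xi α n 1

/-- The step-down level `max {ξ_k : 1 ≤ k ≤ n, N(ξ_{k+1}) < k + 1}`
(the index `k = n` always qualifies). -/
def xiHat2 (α : ℝ) {n : ℕ} (x : Fin n → ℝ) : ℝ :=
  sSup {y : ℝ | ∃ k : ℕ, 1 ≤ k ∧ k ≤ n ∧ countAbove x (xi α n (k + 1)) < k + 1 ∧ y = xi α n k}

/-- The conditions on a family `t_l(x)`, `l ≥ 0`, of smooth threshold functions: `t_l` lies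
between the soft and the hard threshold function, is nondecreasing and `κ₀`-Lipschitz in `x`,
and is `κ₁`-Lipschitz in the level. -/
structure IsSmoothThreshold (κ₀ κ₁ : ℝ) (t : ℝ → ℝ → ℝ) : Prop where
  between_nonneg : ∀ l x : ℝ, 0 ≤ l → 0 ≤ x → soft l x ≤ t l x ∧ t l x ≤ hard l x
  between_neg : ∀ l x : ℝ, 0 ≤ l → x < 0 → hard l x ≤ t l x ∧ t l x ≤ soft l x
  smooth_x : ∀ l x y : ℝ, 0 ≤ l → x < y → 0 ≤ t l y - t l x ∧ t l y - t l x ≤ κ₀ * (y - x)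
  smooth_level : ∀ l l' x : ℝ, 0 ≤ l → 0 ≤ l' → |t l x - t l' x| ≤ κ₁ * |l - l'|

/-- The conditions on a function `g` that lowers the step-up level, with constants `M₀`, `c₁`,
`c₂`. -/
structure LevelCond (M₀ c₁ c₂ : ℝ) (g : ℝ → ℝ) : Prop where
  nonneg : ∀ x : ℝ, 0 < x → 0 ≤ g x
  le_self : ∀ x : ℝ, 0 < x → g x ≤ x
  differentiable : ∀ x : ℝ, 0 < x → DifferentiableAt ℝ g x
  deriv_nonneg : ∀ x : ℝ, 0 < x → 0 ≤ deriv g x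
  deriv_le : ∀ x : ℝ, 0 < x → deriv g x ≤ M₀
  risk_le : ∀ x : ℝ, 0 < x → softRisk 0 (g x) ≤
    min (4 * Phi (-x)) (M₀ * Phi (-x) / ((x ^ c₁ + 2) * (max 1 (Real.log x)) ^ c₂))
  c₁_pos : 0 < c₁
  c₁_le : c₁ ≤ 2
  abs_c₂_le : |c₂| ≤ M₀
  c₂_nonpos : c₁ = 2 → c₂ ≤ 0

/-- A sequence of (measurable) data-driven generalized FDR threshold levels `lam n`, `n ≥ 2`,
with `√(1 + δ₁) g(ξ̂₁) ≤ lam ≤ √(1 + δ₂) ξ̂₂` and `0 ≤ δ₁ ≤ δ₂ → 0`. -/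
structure IsFDRLevel (α₁ α₂ M₀ : ℝ) (δ₁ δ₂ c₁ c₂ : ℕ → ℝ) (g : ℕ → ℝ → ℝ)
    (lam : (n : ℕ) → (Fin n → ℝ) → ℝ) : Prop where
  δ₁_nonneg : ∀ n, 2 ≤ n → 0 ≤ δ₁ n
  δ₁_le : ∀ n, 2 ≤ n → δ₁ n ≤ δ₂ n
  δ₂_tendsto : Tendsto δ₂ atTop (𝓝 0)
  level : ∀ n, 2 ≤ n → LevelCond M₀ (c₁ n) (c₂ n) (g n)
  measurable : ∀ n, 2 ≤ n → Measurable (lam n)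
  lower : ∀ n, 2 ≤ n → ∀ x : Fin n → ℝ, √(1 + δ₁ n) * g n (xiHat1 α₁ x) ≤ lam n x
  upper : ∀ n, 2 ≤ n → ∀ x : Fin n → ℝ, lam n x ≤ √(1 + δ₂ n) * xiHat2 α₂ x

/-- `log_+ x = max(1, log x)`. -/
def logPlus (x : ℝ) : ℝ := max 1 (Real.log x)

/-- `L_{2,n}` (for `n ≥ 2`). -/
def L2 (δ₁ c₁ c₂ : ℝ) (n : ℕ) : ℝ :=
  (Real.log n) ^ (-(3 / 2) : ℝ) *
    (δ₁ * (Real.log n) ^ ((5 - c₁) / 2) / (logPlus (Real.log n)) ^ c₂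
      + (Real.log n) ^ ((3 - c₁) / 2) / (logPlus (Real.log n)) ^ (c₂ - 1)) ^ (1 + δ₁)

/-- `τ*_{2,n} = L_{2,n} / n^{1 + δ₁}`. -/
def tau2 (δ₁ c₁ c₂ : ℝ) (n : ℕ) : ℝ := L2 δ₁ c₁ c₂ n / (n : ℝ) ^ (1 + δ₁)

/-- `L_{1,n} = e ∨ log(1/η)`. -/
def L1 (η : ℝ) : ℝ := max (Real.exp 1) (Real.log (1 / η))

/-- `τ_{1,n}`. -/
def tau1 (δ₂ c₁ c₂ η : ℝ) (n : ℕ) : ℝ :=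
  max (max δ₂ (Real.log (max (Real.exp 1) (Real.log n)) / max 1 (Real.log n)))
    (max ((Real.log (L1 η)) ^ (-c₂) / (L1 η) ^ (c₁ / 2)) (√(Real.log (L1 η)) / √(L1 η)))

/-- `n < n_*`, where `n_* = min {m ≥ 2 : 1 + m^{β₀ - 1/2} / 2 ≤ 1 / α₁'}`
(with `n_* = ∞` if there is no such `m`). -/
def BelowNStar (α₁' β₀ : ℝ) (n : ℕ) : Prop :=
  ∀ m : ℕ, 2 ≤ m → 1 + (m : ℝ) ^ (β₀ - 1 / 2) / 2 ≤ 1 / α₁' → n < m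

/-- Adaptive ratio optimality of the levels `lam n` for soft thresholding on the classes `Θ n`:
`sup_{θ ∈ Θ_n} E_θ ‖s_lam(X) - θ‖² / inf_{l ≥ 0} E_θ ‖s_l(X) - θ‖² ≤ 1 + o(1)`. -/
def AdaptiveRatioOptimal (lam : (n : ℕ) → (Fin n → ℝ) → ℝ) (Θ : (n : ℕ) → Set (Fin n → ℝ)) :
    Prop :=
  ∃ o : ℕ → ℝ≥0∞, Tendsto o atTop (𝓝 0) ∧ ∀ n,
    ⨆ θ ∈ Θ n, ENNReal.ofReal (mse θ (thresholdEst soft (lam n))) /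
      ENNReal.ofReal (minSoftRisk θ) ≤ 1 + o n

/-- The class `{θ ∈ ℝⁿ : M_n L_{2,n} / n^{1 + δ₁} ≤ η_{G_n} ≤ η_n}`. -/
def riskClass (δ₁ c₁ c₂ M η : ℕ → ℝ) (n : ℕ) : Set (Fin n → ℝ) :=
  {θ | M n * L2 (δ₁ n) (c₁ n) (c₂ n) n / (n : ℝ) ^ (1 + δ₁ n) ≤ etaOpt θ ∧ etaOpt θ ≤ η n}

end FDRThreshold

end

open FDRThreshold

open MeasureTheory ProbabilityTheory Filter Topology
open scoped ENNReal

noncomputable section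

namespace FDRThreshold

/-! ### Gaussian tails and the null risk of soft thresholding -/

/-! Fix a level `l ≥ 0`. On each coordinate the error of `t_λ̂` can exceed that of `s_l` in two
ways. If the estimate is farther from zero, the excess is controlled by `upLoss` at the lower bound
`a = √(1+δ₁) g(ξ̂₁)` of `λ̂`. If it is closer to zero, the excess is controlled by `downLoss` at `l`
and also by `(b - l)₊²`, with `b = √(1+δ₂) ξ̂₂`. This is `IsSmoothThreshold.sq_excess_loss_le`, a
pointwise statement in which the randomness of `λ̂` enters only through `a` and `b`. By Young's
inequality, optimized in `sqrt_le_sqrt_add_sqrt`, the root risk exceeds that of `s_l` by at most the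
root of the expected excess. Everything is measured against `S`, the sum of the `refRisk`, where
`refRisk θ l = min(θ², l²) + R(0,l)` is at most four times the soft risk. The goal is an excess of
order `(δ₂ + 1/log(8n/S) + 1/log n) S + n τ*`, logarithms being truncated below at 1.

Level too low. The variable `ξ̂₁` takes one of the values `ξ_k`, and for `k > 1` the value `ξ_k`
forces at least `k` exceedances of `ξ_k`. Beyond a cutoff `K` the expected number of exceedances is
at most `βk` with `β < 1`, so a leave-one-out Chernoff bound gives a factor `exp(-ck)`, which beats
the polynomial growth in `k` of the null risk at the lowered level. For `k ≤ K` monotonicity reduces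
to level `K` (`exists_majorant_upLoss`). The cutoff comes from a dichotomy (`exists_cutoff`). If
some `ξ_j` has too many expected exceedances, the surplus over the null count must be paid for by
actual means or by `n R(0,l)`, so `j (1+ξ_j)² ≲ S` for the last such `j`
(`exists_level_le_sum_refRisk`), and the total null risk, of order `j`, is absorbed by `S /
log(8n/S)`. If there is no such `j`, the cutoff is 1 and the null risk there is `τ*` up to a
constant (`exists_softRisk_level_le_tau2`).

Level too high. For means with `|θ_i| ≤ l + 1` the loss is already a fraction `1/(1+l)²` of the
reference risk (`exists_integral_downLoss_le`). The `m` remaining means cost at most `m (b - l)₊²`.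
A value `ξ̂₂ = ξ_k` far above `l` means that fewer than `k + 1` observations exceed `ξ_{k+1}`
although each far mean does so with non-negligible probability. Either this is exponentially
unlikely or `m (ξ_k - l)²` is small deterministically (`exists_majorant_xiHat2`).

Since `R(0,l) ≤ S/n`, necessarily `(1+l)² ≳ log(8n/S)`, which turns `1/(1+l)²` into the logarithmic
rate. Letting `l` approach the infimum gives `exists_sqrt_mse_le`. Ratio optimality follows because
`τ* ≤ η_{G_n}/M_n` on the class, so that all error terms are `o(1)` relative to the optimal risk. -/

/-- The standard normal density. -/
def nd (x : ℝ) : ℝ := gaussianPDFReal 0 1 x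

lemma nd_eq (x : ℝ) : nd x = (√(2 * Real.pi))⁻¹ * Real.exp (-x ^ 2 / 2) := by
  simp [nd, gaussianPDFReal]

lemma nd_pos (x : ℝ) : 0 < nd x := gaussianPDFReal_pos _ _ _ one_ne_zero

lemma nd_add (x u : ℝ) : nd (x + u) = nd x * Real.exp (-(x * u) - u ^ 2 / 2) := by
  rw [nd_eq, nd_eq, mul_assoc, ← Real.exp_add]
  congr 2
  ring

lemma nd_le_exp (x : ℝ) : nd x ≤ Real.exp (-x ^ 2 / 2) := by
  rw [nd_eq]
  refine mul_le_of_le_one_left (Real.exp_pos _).le (inv_le_one_of_one_le₀ ?_)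
  rw [Real.one_le_sqrt]
  linarith [Real.pi_gt_three]

lemma exp_le_nd (x : ℝ) : Real.exp (-x ^ 2 / 2) ≤ 3 * nd x := by
  rw [nd_eq, ← mul_assoc]
  refine le_mul_of_one_le_left (Real.exp_pos _).le ?_
  rw [← div_eq_mul_inv, one_le_div (by positivity)]
  exact Real.sqrt_le_iff.2 ⟨by norm_num, by linarith [Real.pi_lt_four]⟩

lemma integral_stdGaussian (f : ℝ → ℝ) :
    ∫ z, f z ∂(gaussianReal 0 1) = ∫ z, nd z * f z := by
  rw [integral_gaussianReal_eq_integral_smul one_ne_zero]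
  rfl

lemma integral_stdGaussian_sub (f : ℝ → ℝ) (x : ℝ) :
    ∫ z, f (z - x) ∂(gaussianReal 0 1)
      = nd x * ∫ u, Real.exp (-(x * u) - u ^ 2 / 2) * f u := by
  rw [integral_stdGaussian, ← integral_add_left_eq_self _ x, ← integral_const_mul]
  congr 1
  ext u
  rw [nd_add]
  simp [mul_assoc]

lemma integral_stdGaussian_neg (f : ℝ → ℝ) :
    ∫ z, f (-z) ∂(gaussianReal 0 1) = ∫ z, f z ∂(gaussianReal 0 1) := by
  rw [integral_stdGaussian, integral_stdGaussian, ← integral_neg_eq_self]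
  congr 1
  ext u
  simp [nd_eq]

lemma integral_gaussian_shift (θ : ℝ) (f : ℝ → ℝ) :
    ∫ y, f y ∂(gaussianReal θ 1) = ∫ z, f (z + θ) ∂(gaussianReal 0 1) := by
  have h := gaussianReal_map_add_const (μ := 0) (v := 1) θ
  rw [zero_add] at h
  rw [← h, MeasurableEmbedding.integral_map (measurableEmbedding_addRight θ)]

/-- The truncated moment integral governing Gaussian tails. -/
def tailMoment (k : ℕ) (x : ℝ) : ℝ :=
  ∫ u in Set.Ioi (0 : ℝ), u ^ k * Real.exp (-(x * u) - u ^ 2 / 2)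

lemma integrableOn_pow_mul_exp_neg (k : ℕ) {r : ℝ} (hr : 0 < r) :
    IntegrableOn (fun u : ℝ => u ^ k * Real.exp (-(r * u))) (Set.Ioi 0) := by
  have := integrableOn_rpow_mul_exp_neg_mul_rpow (p := 1) (s := k) (b := r)
    (by have := k.cast_nonneg (α := ℝ); linarith) one_pos hr
  refine this.congr_fun (fun u _ => ?_) measurableSet_Ioi
  simp

lemma integral_pow_mul_exp_neg (k : ℕ) {r : ℝ} (hr : 0 < r) :
    ∫ u in Set.Ioi (0 : ℝ), u ^ k * Real.exp (-(r * u)) = k.factorial / r ^ (k + 1) := by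
  have := Real.integral_rpow_mul_exp_neg_mul_Ioi (a := k + 1) (r := r) (by positivity) hr
  rw [Real.Gamma_nat_eq_factorial] at this
  simp only [add_sub_cancel_right, Real.rpow_natCast] at this
  rw [this, ← Nat.cast_add_one, Real.rpow_natCast]
  simp [div_eq_mul_inv, mul_comm]

/-- Completing the square, `u - u²/2 ≤ 1/2`, trades the Gaussian factor for one more exponential
rate. The tail bounds then carry `1 + x` instead of `x` and stay finite at `x = 0`. -/
lemma tail_exponent_le (x u : ℝ) :
    Real.exp (-(x * u) - u ^ 2 / 2) ≤ Real.exp (1 / 2) * Real.exp (-((1 + x) * u)) := by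
  rw [← Real.exp_add]
  apply Real.exp_le_exp.2
  nlinarith [sq_nonneg (u - 1)]

lemma integrableOn_tailMoment (k : ℕ) {x : ℝ} (hx : 0 ≤ x) :
    IntegrableOn (fun u : ℝ => u ^ k * Real.exp (-(x * u) - u ^ 2 / 2)) (Set.Ioi 0) := by
  have h := (integrableOn_pow_mul_exp_neg k (r := 1 + x) (by linarith)).const_mul
    (Real.exp (1 / 2))
  refine Integrable.mono' h (by fun_prop) ?_
  refine (ae_restrict_iff' measurableSet_Ioi).2 (ae_of_all _ fun u hu => ?_)
  have hu : (0 : ℝ) < u := hu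
  rw [Real.norm_of_nonneg (by positivity)]
  have := mul_le_mul_of_nonneg_left (tail_exponent_le x u) (pow_nonneg hu.le k)
  linarith

lemma tailMoment_le (k : ℕ) {x : ℝ} (hx : 0 ≤ x) :
    tailMoment k x ≤ Real.exp (1 / 2) * k.factorial / (1 + x) ^ (k + 1) := by
  have h := (integrableOn_pow_mul_exp_neg k (r := 1 + x) (by linarith)).const_mul
    (Real.exp (1 / 2))
  have h2 : tailMoment k x ≤
      ∫ u in Set.Ioi (0 : ℝ), Real.exp (1 / 2) * (u ^ k * Real.exp (-((1 + x) * u))) := by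
    refine setIntegral_mono_on (integrableOn_tailMoment k hx) h measurableSet_Ioi ?_
    intro u hu
    have := mul_le_mul_of_nonneg_left (tail_exponent_le x u) (pow_nonneg (le_of_lt hu) k)
    linarith
  rw [integral_const_mul, integral_pow_mul_exp_neg k (by linarith)] at h2
  rwa [mul_div_assoc]

/-- Only `1/(2(1+x)) < u ≤ 1/(1+x)` is kept. There `xu ≤ 1` and `u ≤ 1`, so the exponent is at least
`-3/2`, and the length of the interval supplies the last power of `2(1+x)`. -/
lemma le_tailMoment (k : ℕ) {x : ℝ} (hx : 0 ≤ x) :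
    Real.exp (-(3 / 2)) / (2 * (1 + x)) ^ (k + 1) ≤ tailMoment k x := by
  have hx1 : 0 < 1 + x := by linarith
  set s := Set.Ioc (1 / (2 * (1 + x))) (1 / (1 + x)) with hs
  have hsub : s ⊆ Set.Ioi 0 := fun u hu => lt_of_le_of_lt (by positivity) hu.1
  have hint := integrableOn_tailMoment k hx
  have h1 : ∫ u in s, u ^ k * Real.exp (-(x * u) - u ^ 2 / 2) ≤ tailMoment k x := by
    refine setIntegral_mono_set hint ?_ hsub.eventuallyLE
    refine (ae_restrict_iff' measurableSet_Ioi).2 (ae_of_all _ fun u hu => ?_)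
    have hu : (0 : ℝ) < u := hu
    simp only [Pi.zero_apply]
    positivity
  have h2 : ∫ _u in s, (1 / (2 * (1 + x))) ^ k * Real.exp (-(3 / 2))
      ≤ ∫ u in s, u ^ k * Real.exp (-(x * u) - u ^ 2 / 2) := by
    refine setIntegral_mono_on (integrableOn_const (by simp [hs])) (hint.mono_set hsub)
        measurableSet_Ioc ?_
    intro u hu
    have hu0 : 0 < u := hsub hu
    have hu1 : u * (1 + x) ≤ 1 := by
      have := hu.2
      rwa [le_div_iff₀ hx1] at this
    have hux : 0 ≤ u * x := by positivity
    gcongr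
    · exact hu.1.le
    · nlinarith
  refine le_trans (le_of_eq ?_) (h2.trans h1)
  rw [setIntegral_const, hs, Real.volume_real_Ioc_of_le (by gcongr; linarith)]
  rw [smul_eq_mul]
  have : 1 / (1 + x) - 1 / (2 * (1 + x)) = 1 / (2 * (1 + x)) := by field_simp; norm_num
  rw [this, pow_succ, div_pow, one_pow]
  field_simp

lemma integral_pos_part_pow (k : ℕ) (x : ℝ) :
    ∫ z, (if x < z then (z - x) ^ k else 0) ∂(gaussianReal 0 1) = nd x * tailMoment k x := by
  have := integral_stdGaussian_sub (fun u => if 0 < u then u ^ k else 0) x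
  simp only [sub_pos] at this
  rw [this, tailMoment, ← integral_indicator measurableSet_Ioi]
  congr 2
  ext u
  by_cases hu : 0 < u <;> simp [hu, mul_comm]

lemma Phi_neg_eq_real (x : ℝ) : Phi (-x) = (gaussianReal 0 1).real (Set.Ioi x) := by
  have h := gaussianReal_map_neg (μ := 0) (v := 1)
  rw [neg_zero] at h
  have hna := nullSingletonClass_gaussianReal (μ := 0) (v := 1) one_ne_zero
  rw [Phi, cdf_eq_real]
  conv_lhs => rw [← h]
  rw [map_measureReal_apply (by fun_prop) measurableSet_Iic]
  have : (fun y : ℝ => -y) ⁻¹' Set.Iic (-x) = Set.Ici x := by ext; simp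
  rw [this]
  exact measureReal_congr Ioi_ae_eq_Ici.symm

lemma Phi_neg_eq (x : ℝ) : Phi (-x) = nd x * tailMoment 0 x := by
  rw [Phi_neg_eq_real, ← integral_pos_part_pow]
  have : (fun z : ℝ => if x < z then (z - x) ^ 0 else 0) = Set.indicator (Set.Ioi x) 1 := by
    ext z
    by_cases hz : x < z <;> simp [hz]
  rw [this, integral_indicator_one measurableSet_Ioi]

lemma Phi_nonneg (x : ℝ) : 0 ≤ Phi x := cdf_nonneg _ _

lemma Phi_mono : Monotone Phi := monotone_cdf _

lemma Phi_neg_le {x : ℝ} (hx : 0 ≤ x) : Phi (-x) ≤ nd x * (Real.exp (1 / 2) / (1 + x)) := by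
  rw [Phi_neg_eq]
  have := tailMoment_le 0 hx
  simp at this
  gcongr
  · exact (nd_pos x).le
  · simpa using this

lemma le_Phi_neg {x : ℝ} (hx : 0 ≤ x) :
    nd x * (Real.exp (-(3 / 2)) / (2 * (1 + x))) ≤ Phi (-x) := by
  rw [Phi_neg_eq]
  have := le_tailMoment 0 hx
  gcongr
  · exact (nd_pos x).le
  · simpa using this

/-- `Φ(-x) ≤ e^{1/2} e^{-x²/2}`, in the form used for crude bounds. -/
lemma Phi_neg_le_exp {x : ℝ} (hx : 0 ≤ x) : Phi (-x) ≤ 2 * Real.exp (-x ^ 2 / 2) := by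
  refine (Phi_neg_le hx).trans ?_
  have h1 := nd_le_exp x
  have h2 : Real.exp (1 / 2) / (1 + x) ≤ 2 := by
    have : Real.exp (1 / 2) ≤ 2 := by
      have h3 : Real.exp (1 / 2) ^ 2 ≤ 2 ^ 2 := by
        rw [← Real.exp_nat_mul]
        have := Real.exp_one_lt_d9
        norm_num
        linarith
      exact le_of_sq_le_sq h3 (by norm_num)
    rw [div_le_iff₀ (by linarith)]
    linarith
  have := nd_pos x
  have h3 : (0 : ℝ) ≤ Real.exp (1 / 2) / (1 + x) := by positivity
  calc _ ≤ Real.exp (-x ^ 2 / 2) * 2 := by gcongr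
    _ = _ := by ring

lemma hasDerivAt_Phi (x : ℝ) : HasDerivAt Phi (nd x) x := by
  have hint : ∀ y, IntegrableOn nd (Set.Iic y) := fun y =>
    (integrable_gaussianPDFReal 0 1).integrableOn
  have hcont : Continuous nd := by
    have : nd = fun x => (√(2 * Real.pi))⁻¹ * Real.exp (-x ^ 2 / 2) := funext nd_eq
    rw [this]
    fun_prop
  have h1 : ∀ y, Phi y = Phi x + ∫ z in x..y, nd z := by
    intro y
    have hP : ∀ y, Phi y = ∫ z in Set.Iic y, nd z := by
      intro y
      rw [Phi, cdf_eq_real, Measure.real, gaussianReal_apply_eq_integral _ one_ne_zero,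
        ENNReal.toReal_ofReal]
      · rfl
      · exact integral_nonneg fun z => (nd_pos z).le
    rw [hP, hP, ← intervalIntegral.integral_Iic_sub_Iic (hint x) (hint y)]
    ring
  have h2 := intervalIntegral.integral_hasDerivAt_right (a := x) (b := x) (f := nd)
    (hcont.intervalIntegrable _ _) (hcont.stronglyMeasurableAtFilter _ _) hcont.continuousAt
  have h3 := h2.const_add (Phi x)
  exact h3.congr_of_eventuallyEq (Eventually.of_forall h1)

lemma Phi_strictMono : StrictMono Phi :=
  strictMono_of_hasDerivAt_pos (fun x => hasDerivAt_Phi x) fun x => nd_pos x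

lemma Phi_continuous : Continuous Phi :=
  continuous_iff_continuousAt.2 fun x => (hasDerivAt_Phi x).continuousAt

lemma Phi_pos (x : ℝ) : 0 < Phi x :=
  (Phi_nonneg (x - 1)).trans_lt (Phi_strictMono (by linarith))

lemma Phi_add_Phi_neg (x : ℝ) : Phi x + Phi (-x) = 1 := by
  rw [Phi_neg_eq_real, Phi, cdf_eq_real, ← Set.compl_Iic]
  exact probReal_add_probReal_compl measurableSet_Iic

lemma Phi_zero : Phi 0 = 1 / 2 := by
  have := Phi_add_Phi_neg 0
  rw [neg_zero] at this
  linarith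

/-- The density ratio `nd (z + d) / nd z = exp(-dz - d²/2)` decreases in `z`. Hence right side minus
left side is antitone on `[y, ∞)`, and it vanishes at infinity. The sign of `y` is irrelevant. -/
lemma Phi_neg_add_le (y : ℝ) {d : ℝ} (hd : 0 ≤ d) :
    Phi (-(y + d)) ≤ Real.exp (-(d * y) - d ^ 2 / 2) * Phi (-y) := by
  have hd1 : ∀ z, HasDerivAt (fun z => Real.exp (-(d * y) - d ^ 2 / 2) * Phi (-z) - Phi (-(z + d)))
      (Real.exp (-(d * y) - d ^ 2 / 2) * -nd (-z) - -nd (-(z + d))) z := by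
    intro z
    have h1 := ((hasDerivAt_Phi (-z)).comp z (hasDerivAt_neg z)).const_mul
      (Real.exp (-(d * y) - d ^ 2 / 2))
    have h2 := (hasDerivAt_Phi (-(z + d))).comp z ((hasDerivAt_id z).add_const d).neg
    refine (h1.sub h2).congr_deriv ?_
    simp
  set F := fun z => Real.exp (-(d * y) - d ^ 2 / 2) * Phi (-z) - Phi (-(z + d)) with hF
  have hanti : AntitoneOn F (Set.Ici y) := by
    refine antitoneOn_of_deriv_nonpos (convex_Ici y)
      (fun z _ => (hd1 z).continuousAt.continuousWithinAt)
      (fun z _ => (hd1 z).differentiableAt.differentiableWithinAt) ?_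
    intro z hz
    rw [interior_Ici] at hz
    have hz : y < z := hz
    rw [(hd1 z).deriv]
    have hsym : ∀ w, nd (-w) = nd w := fun w => by simp [nd_eq]
    rw [hsym, hsym, nd_add, mul_comm z d]
    have : Real.exp (-(d * z) - d ^ 2 / 2) ≤ Real.exp (-(d * y) - d ^ 2 / 2) := by
      apply Real.exp_le_exp.2
      nlinarith
    nlinarith [nd_pos z]
  have hPt : Tendsto (fun z : ℝ => Phi (-z)) atTop (𝓝 0) :=
    (tendsto_cdf_atBot (gaussianReal 0 1)).comp tendsto_neg_atTop_atBot
  have hlim : Tendsto F atTop (𝓝 0) := by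
    have h2 : Tendsto (fun z : ℝ => Phi (-(z + d))) atTop (𝓝 0) :=
      hPt.comp (tendsto_atTop_add_const_right _ d tendsto_id)
    have := (hPt.const_mul (Real.exp (-(d * y) - d ^ 2 / 2))).sub h2
    simpa only [mul_zero, sub_zero] using this
  have h0 : 0 ≤ F y :=
    le_of_tendsto hlim ((eventually_ge_atTop y).mono fun z hz =>
      hanti (Set.mem_Ici.2 le_rfl) (Set.mem_Ici.2 hz) hz)
  simp only [hF] at h0
  linarith

lemma exists_Phi_eq {p : ℝ} (h0 : 0 < p) (h1 : p < 1) : ∃ t, Phi t = p := by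
  have hb := (tendsto_cdf_atBot (gaussianReal 0 1)).eventually (gt_mem_nhds h0)
  have ht := (tendsto_cdf_atTop (gaussianReal 0 1)).eventually (lt_mem_nhds h1)
  obtain ⟨a, ha⟩ := hb.exists
  obtain ⟨b, hb⟩ := ht.exists
  exact mem_range_of_exists_le_of_exists_ge Phi_continuous ⟨a, le_of_lt ha⟩ ⟨b, le_of_lt hb⟩

lemma PhiInv_Phi (t : ℝ) : PhiInv (Phi t) = t := by
  have : {s : ℝ | Phi t ≤ Phi s} = Set.Ici t := by
    ext s
    simp [Phi_strictMono.le_iff_le]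
  rw [PhiInv, this, csInf_Ici]

lemma Phi_PhiInv {p : ℝ} (h0 : 0 < p) (h1 : p < 1) : Phi (PhiInv p) = p := by
  obtain ⟨t, rfl⟩ := exists_Phi_eq h0 h1
  rw [PhiInv_Phi]

lemma Phi_neg_lt_iff {x y : ℝ} : Phi (-x) < Phi (-y) ↔ y < x := by
  rw [Phi_strictMono.lt_iff_lt, neg_lt_neg_iff]

lemma Phi_neg_le_iff {x y : ℝ} : Phi (-x) ≤ Phi (-y) ↔ y ≤ x := by
  rw [Phi_strictMono.le_iff_le, neg_le_neg_iff]

lemma integrable_of_abs_le_sq {μ : ℝ} {f : ℝ → ℝ} (hf : Measurable f) {A B : ℝ}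
    (h : ∀ y, |f y| ≤ A + B * y ^ 2) : Integrable f (gaussianReal μ 1) := by
  have h2 : Integrable (fun y : ℝ => y ^ 2) (gaussianReal μ 1) :=
    (memLp_id_gaussianReal (μ := μ) (v := 1) 2).integrable_sq
  exact ((integrable_const A).add (h2.const_mul B)).mono' hf.aestronglyMeasurable
    (ae_of_all _ fun y => h y)

lemma integral_sq_stdGaussian : ∫ z, z ^ 2 ∂(gaussianReal 0 1) = 1 := by
  have h := variance_id_gaussianReal (μ := 0) (v := 1)
  rw [variance_of_integral_eq_zero (by fun_prop) (by simp)] at h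
  simpa using h

lemma measurable_soft (l : ℝ) : Measurable (soft l) := by
  unfold soft
  have : Measurable Real.sign := by
    unfold Real.sign
    exact Measurable.ite measurableSet_Iio measurable_const
      (Measurable.ite measurableSet_Ioi measurable_const measurable_const)
  fun_prop

lemma soft_of_nonneg {l x : ℝ} (hl : 0 ≤ l) (hx : 0 ≤ x) : soft l x = max (x - l) 0 := by
  rcases hx.eq_or_lt with rfl | hx
  · simp [soft, hl]
  · rw [soft, Real.sign_of_pos hx, abs_of_pos hx, one_mul]

lemma soft_neg (l x : ℝ) : soft l (-x) = -soft l x := by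
  simp [soft, Real.sign_neg]

lemma abs_soft {l : ℝ} (hl : 0 ≤ l) (x : ℝ) : |soft l x| = max (|x| - l) 0 := by
  rcases le_total 0 x with hx | hx
  · rw [soft_of_nonneg hl hx, abs_of_nonneg hx, abs_of_nonneg (le_max_right _ _)]
  · rw [← neg_neg x, soft_neg, soft_of_nonneg hl (by linarith), abs_neg, abs_neg,
      abs_of_nonneg (le_max_right _ _), abs_of_nonneg (by linarith : (0 : ℝ) ≤ -x)]

lemma soft_sq {l : ℝ} (hl : 0 ≤ l) (x : ℝ) : soft l x ^ 2 = (max (|x| - l) 0) ^ 2 := by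
  rw [← sq_abs, abs_soft hl]

lemma abs_soft_le {l : ℝ} (hl : 0 ≤ l) (x : ℝ) : |soft l x| ≤ |x| := by
  rw [abs_soft hl]
  exact max_le (by linarith) (abs_nonneg x)

lemma integrable_softRisk {l : ℝ} (hl : 0 ≤ l) (μ : ℝ) :
    Integrable (fun z => (soft l (z + μ) - μ) ^ 2) (gaussianReal 0 1) := by
  have hm := measurable_soft l
  refine integrable_of_abs_le_sq (by fun_prop) (A := 8 * μ ^ 2) (B := 2) fun z => ?_
  rw [abs_of_nonneg (sq_nonneg _)]
  have h1 := abs_soft_le hl (z + μ)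
  have h2 : |soft l (z + μ) - μ| ≤ |z| + 2 * |μ| := by
    have := abs_add_le z μ
    have := abs_sub (soft l (z + μ)) μ
    linarith
  rw [← sq_abs]
  calc _ ≤ (|z| + 2 * |μ|) ^ 2 := by gcongr
    _ ≤ _ := by rw [← sq_abs z, ← sq_abs μ]; nlinarith [sq_nonneg (|z| - 2 * |μ|)]

/-- The one-sided excess second moment of a standard normal variable. -/
lemma integral_excess_sq (l : ℝ) :
    ∫ z, (max (z - l) 0) ^ 2 ∂(gaussianReal 0 1) = nd l * tailMoment 2 l := by
  rw [← integral_pos_part_pow]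
  congr 1
  ext z
  by_cases hz : l < z
  · simp [hz, max_eq_left (sub_nonneg.2 hz.le)]
  · simp [hz, max_eq_right (sub_nonpos.2 (not_lt.1 hz))]

lemma integrable_excess_sq (l : ℝ) :
    Integrable (fun z => (max (z - l) 0) ^ 2) (gaussianReal 0 1) := by
  refine integrable_of_abs_le_sq (by fun_prop) (A := 2 * l ^ 2) (B := 2) fun z => ?_
  rw [abs_of_nonneg (sq_nonneg _)]
  rcases max_cases (z - l) 0 with h | h <;> rw [h.1] <;> nlinarith [sq_nonneg (z + l)]

lemma softRisk_zero {l : ℝ} (hl : 0 ≤ l) : softRisk 0 l = 2 * (nd l * tailMoment 2 l) := by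
  have h1 : softRisk 0 l = ∫ z, ((max (z - l) 0) ^ 2 + (max (-z - l) 0) ^ 2)
      ∂(gaussianReal 0 1) := by
    unfold softRisk
    congr 1
    ext z
    rw [add_zero, sub_zero, soft_sq hl]
    rcases le_total 0 z with hz | hz
    · rw [abs_of_nonneg hz, max_eq_right (by linarith : -z - l ≤ 0)]
      ring
    · rw [abs_of_nonpos hz, max_eq_right (by linarith : z - l ≤ 0)]
      ring
  have hi := integrable_excess_sq l
  have hi2 : Integrable (fun z => (max (-z - l) 0) ^ 2) (gaussianReal 0 1) := by
    refine integrable_of_abs_le_sq (by fun_prop) (A := 2 * l ^ 2) (B := 2) fun z => ?_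
    rw [abs_of_nonneg (sq_nonneg _)]
    rcases max_cases (-z - l) 0 with h | h <;> rw [h.1] <;> nlinarith [sq_nonneg (z - l)]
  rw [h1, integral_add hi hi2,
    integral_stdGaussian_neg (fun z => (max (z - l) 0) ^ 2), integral_excess_sq]
  ring

lemma softRisk_zero_le {l : ℝ} (hl : 0 ≤ l) :
    softRisk 0 l ≤ 8 * Real.exp (-l ^ 2 / 2) / (1 + l) ^ 3 := by
  rw [softRisk_zero hl]
  have h := tailMoment_le 2 hl
  have he : Real.exp (1 / 2) ≤ 2 := by
    have h3 : Real.exp (1 / 2) ^ 2 ≤ 2 ^ 2 := by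
      rw [← Real.exp_nat_mul]
      have := Real.exp_one_lt_d9
      norm_num
      linarith
    exact le_of_sq_le_sq h3 (by norm_num)
  have h2 : tailMoment 2 l ≤ 4 / (1 + l) ^ 3 := by
    refine h.trans ?_
    simp only [Nat.factorial]
    norm_num
    gcongr
    linarith
  have := nd_le_exp l
  have h3 : (0 : ℝ) ≤ 4 / (1 + l) ^ 3 := by positivity
  have := nd_pos l
  calc 2 * (nd l * tailMoment 2 l) ≤ 2 * (nd l * (4 / (1 + l) ^ 3)) := by gcongr
    _ ≤ 2 * (Real.exp (-l ^ 2 / 2) * (4 / (1 + l) ^ 3)) := by gcongr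
    _ = _ := by ring

lemma le_softRisk_zero : ∃ c : ℝ, 0 < c ∧ ∀ l : ℝ, 0 ≤ l →
    c * Real.exp (-l ^ 2 / 2) / (1 + l) ^ 3 ≤ softRisk 0 l := by
  refine ⟨Real.exp (-(3 / 2)) / 12, by positivity, fun l hl => ?_⟩
  rw [softRisk_zero hl]
  have h := le_tailMoment 2 hl
  have h1 := exp_le_nd l
  calc _ = 2 * (Real.exp (-l ^ 2 / 2) / 3 * (Real.exp (-(3 / 2)) / (2 * (1 + l)) ^ (2 + 1))) := by
        field_simp
        ring
    _ ≤ _ := by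
      gcongr
      · exact (nd_pos l).le
      · linarith

lemma softRisk_zero_pos {l : ℝ} (hl : 0 ≤ l) : 0 < softRisk 0 l := by
  obtain ⟨c, hc, h⟩ := le_softRisk_zero
  exact lt_of_lt_of_le (by positivity) (h l hl)

lemma softRisk_zero_anti {l l' : ℝ} (hl : 0 ≤ l) (h : l ≤ l') : softRisk 0 l' ≤ softRisk 0 l := by
  unfold softRisk
  refine integral_mono (integrable_softRisk (hl.trans h) 0) (integrable_softRisk hl 0) fun z => ?_
  simp only [add_zero, sub_zero]
  rw [soft_sq hl, soft_sq (hl.trans h)]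
  gcongr

lemma softRisk_neg {l : ℝ} (μ : ℝ) : softRisk (-μ) l = softRisk μ l := by
  unfold softRisk
  rw [← integral_stdGaussian_neg]
  congr 1
  ext z
  rw [← neg_add, soft_neg]
  ring

lemma softRisk_abs {l : ℝ} (μ : ℝ) : softRisk |μ| l = softRisk μ l := by
  rcases abs_choice μ with h | h <;> rw [h]
  exact softRisk_neg μ

/-- For `z ≥ l` the error at mean `|μ|` is exactly `z - l`, so one of the two symmetric tails that
make up the null risk survives at every mean. -/
lemma softRisk_zero_le_two_mul {l : ℝ} (hl : 0 ≤ l) (μ : ℝ) : softRisk 0 l ≤ 2 * softRisk μ l := by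
  rw [← softRisk_abs μ]
  have hμ := abs_nonneg μ
  rw [softRisk_zero hl, ← integral_excess_sq]
  have : ∫ z, (max (z - l) 0) ^ 2 ∂(gaussianReal 0 1) ≤ softRisk |μ| l := by
    refine integral_mono (integrable_excess_sq l) (integrable_softRisk hl _) fun z => ?_
    rcases le_total z l with hz | hz
    · simp only [max_eq_right (sub_nonpos.2 hz)]
      simpa using sq_nonneg (soft l (z + |μ|) - |μ|)
    · simp only [max_eq_left (sub_nonneg.2 hz)]
      rw [soft_of_nonneg hl (by linarith), max_eq_left (by linarith)]
      exact le_of_eq (by ring)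
  linarith

/-- With probability one half the noise is nonpositive. Then the estimate of `ν = |μ|` is at most
`(ν - l)₊`, an error of at least `min(ν, l)`. -/
lemma min_sq_le_two_mul_softRisk {l : ℝ} (hl : 0 ≤ l) (μ : ℝ) :
    min (μ ^ 2) (l ^ 2) ≤ 2 * softRisk μ l := by
  rw [← softRisk_abs μ, ← sq_abs μ]
  set ν := |μ| with hν
  have hμ : 0 ≤ ν := abs_nonneg μ
  have hmin : 0 ≤ min (ν ^ 2) (l ^ 2) := le_min (sq_nonneg _) (sq_nonneg _)
  have h1 : ∫ z, Set.indicator (Set.Iic 0) (fun _ => min (ν ^ 2) (l ^ 2)) z ∂(gaussianReal 0 1)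
      ≤ softRisk ν l := by
    refine integral_mono ((integrable_const _).indicator measurableSet_Iic)
      (integrable_softRisk hl _) fun z => ?_
    by_cases hz : z ≤ 0
    · rw [Set.indicator_of_mem (show z ∈ Set.Iic 0 from hz)]
      have h2 : soft l (z + ν) ≤ max (ν - l) 0 := by
        rcases le_total 0 (z + ν) with h | h
        · rw [soft_of_nonneg hl h]
          gcongr
          linarith
        · have : soft l (z + ν) ≤ 0 := by
            rw [← neg_neg (z + ν), soft_neg, soft_of_nonneg hl (by linarith)]
            simp
          exact this.trans (le_max_right _ _)
      rcases le_total ν l with h | h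
      · rw [max_eq_right (by linarith)] at h2
        refine (min_le_left _ _).trans ?_
        nlinarith
      · rw [max_eq_left (by linarith)] at h2
        refine (min_le_right _ _).trans ?_
        nlinarith
    · rw [Set.indicator_of_notMem (show z ∉ Set.Iic 0 from hz)]
      positivity
  rw [integral_indicator measurableSet_Iic, setIntegral_const] at h1
  have h3 : (gaussianReal 0 1).real (Set.Iic 0) = 1 / 2 := by
    rw [← Phi_zero, Phi, cdf_eq_real]
  rw [h3, smul_eq_mul] at h1
  linarith

/-! ### Coordinatewise risk bounds -/

lemma exists_pow_mul_exp_le (m : ℕ) {c : ℝ} (hc : 0 < c) :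
    ∃ C : ℝ, 0 < C ∧ ∀ x : ℝ, 0 ≤ x → (1 + x) ^ m * Real.exp (-(c * x)) ≤ C := by
  refine ⟨m.factorial / c ^ m * Real.exp c, by positivity, fun x hx => ?_⟩
  have h := Real.pow_div_factorial_le_exp (c * (1 + x)) (by positivity) m
  have h2 : Real.exp (c * (1 + x)) = Real.exp c * Real.exp (c * x) := by
    rw [← Real.exp_add]; ring_nf
  rw [h2, mul_pow, div_le_iff₀ (by positivity)] at h
  rw [Real.exp_neg, ← div_eq_mul_inv, div_le_iff₀ (Real.exp_pos _), div_mul_eq_mul_div,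
    div_mul_eq_mul_div, le_div_iff₀ (by positivity)]
  linarith

lemma exists_pow_mul_exp_sq_le (m : ℕ) {c : ℝ} (hc : 0 < c) :
    ∃ C : ℝ, 0 < C ∧ ∀ x : ℝ, 0 ≤ x → (1 + x) ^ m * Real.exp (-(c * x ^ 2)) ≤ C := by
  obtain ⟨C, hC, h⟩ := exists_pow_mul_exp_le m hc
  refine ⟨C * Real.exp c, by positivity, fun x hx => ?_⟩
  calc (1 + x) ^ m * Real.exp (-(c * x ^ 2))
      ≤ (1 + x) ^ m * (Real.exp (-(c * x)) * Real.exp c) := by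
        rw [← Real.exp_add]
        gcongr
        nlinarith [sq_nonneg (x - 1)]
    _ = (1 + x) ^ m * Real.exp (-(c * x)) * Real.exp c := by ring
    _ ≤ _ := by
        gcongr
        exact h x hx

/-- The reference risk of level `l` at `θ`, equivalent to the soft threshold risk from below. -/
def refRisk (θ l : ℝ) : ℝ := min (θ ^ 2) (l ^ 2) + softRisk 0 l

lemma refRisk_le {l : ℝ} (hl : 0 ≤ l) (θ : ℝ) : refRisk θ l ≤ 4 * softRisk θ l := by
  have h1 := softRisk_zero_le_two_mul hl θ
  have h2 := min_sq_le_two_mul_softRisk hl θ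
  unfold refRisk
  linarith

lemma min_sq_nonneg (a b : ℝ) : 0 ≤ min (a ^ 2) (b ^ 2) := le_min (sq_nonneg _) (sq_nonneg _)

lemma refRisk_pos {l : ℝ} (hl : 0 ≤ l) (θ : ℝ) : 0 < refRisk θ l :=
  add_pos_of_nonneg_of_pos (min_sq_nonneg _ _) (softRisk_zero_pos hl)

lemma real_Ioi_gaussian (θ ξ : ℝ) : (gaussianReal θ 1).real (Set.Ioi ξ) = Phi (-(ξ - θ)) := by
  have h := gaussianReal_map_add_const (μ := 0) (v := 1) θ
  rw [zero_add] at h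
  rw [Phi_neg_eq_real, ← h, map_measureReal_apply (by fun_prop) measurableSet_Ioi]
  congr 1
  ext y
  simp [sub_lt_iff_lt_add]

lemma real_Ici_gaussian (θ ξ : ℝ) : (gaussianReal θ 1).real (Set.Ici ξ) = Phi (-(ξ - θ)) := by
  have hna := nullSingletonClass_gaussianReal (μ := θ) (v := 1) one_ne_zero
  rw [← real_Ioi_gaussian]
  exact measureReal_congr Ioi_ae_eq_Ici.symm

lemma real_Iic_gaussian (θ ξ : ℝ) : (gaussianReal θ 1).real (Set.Iic ξ) = Phi (ξ - θ) := by
  rw [← Set.compl_Ioi, probReal_compl_eq_one_sub measurableSet_Ioi, real_Ioi_gaussian,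
    ← Phi_add_Phi_neg (ξ - θ)]
  ring

/-- The probability that an `N(θ, 1)` variable is at least `ξ` in absolute value. -/
def pAbove (θ ξ : ℝ) : ℝ := (gaussianReal θ 1).real {y | ξ ≤ |y|}

lemma setOf_le_abs (ξ : ℝ) : {y : ℝ | ξ ≤ |y|} = Set.Iic (-ξ) ∪ Set.Ici ξ := by
  ext y
  simp only [Set.mem_ofPred_eq, Set.mem_union, Set.mem_Iic, Set.mem_Ici, le_abs]
  constructor <;> rintro (h | h)
  · exact Or.inr h
  · exact Or.inl (by linarith)
  · exact Or.inr (by linarith)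
  · exact Or.inl h

lemma pAbove_le (θ ξ : ℝ) : pAbove θ ξ ≤ Phi (-(ξ - θ)) + Phi (-(ξ + θ)) := by
  have := measureReal_union_le (μ := gaussianReal θ 1) (Set.Iic (-ξ)) (Set.Ici ξ)
  rw [← setOf_le_abs, real_Iic_gaussian, real_Ici_gaussian] at this
  rw [show -(ξ + θ) = -ξ - θ by ring]
  unfold pAbove
  linarith

lemma le_pAbove (θ ξ : ℝ) : Phi (-(ξ - |θ|)) ≤ pAbove θ ξ := by
  rcases abs_choice θ with h | h <;> rw [h, pAbove, setOf_le_abs]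
  · rw [← real_Ici_gaussian]
    exact measureReal_mono Set.subset_union_right
  · rw [show -(ξ - -θ) = -ξ - θ by ring, ← real_Iic_gaussian]
    exact measureReal_mono Set.subset_union_left

lemma pAbove_nonneg (θ ξ : ℝ) : 0 ≤ pAbove θ ξ := measureReal_nonneg

lemma pAbove_le_one (θ ξ : ℝ) : pAbove θ ξ ≤ 1 := measureReal_le_one

lemma nd_sub_nd_le {ξ θ : ℝ} (hθ : 0 ≤ θ) (h : θ ≤ ξ / 2) :
    nd (θ - ξ) - nd (-ξ - θ) ≤ 2 * ξ * θ * Real.exp (-(1 / 8 * ξ ^ 2)) := by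
  have h1 : nd (-ξ - θ) = nd (θ - ξ) * Real.exp (-(2 * ξ * θ)) := by
    rw [nd_eq, nd_eq, mul_assoc, ← Real.exp_add]
    congr 2
    ring
  have h2 : nd (θ - ξ) ≤ Real.exp (-(1 / 8 * ξ ^ 2)) := by
    refine (nd_le_exp _).trans (Real.exp_le_exp.2 ?_)
    nlinarith
  have h3 := Real.add_one_le_exp (-(2 * ξ * θ))
  have h4 : 0 ≤ 2 * ξ * θ := by have : 0 ≤ ξ := by linarith
                                positivity
  have h5 := nd_pos (θ - ξ)
  rw [h1]
  nlinarith

/-- Summing the two tails cancels the linear term in `θ`. The derivative of the sum is a difference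
of densities, bounded by `nd_sub_nd_le` linearly in `θ`, and integrating gives a quadratic
remainder. -/
lemma Phi_second_diff_le {ξ θ : ℝ} (hθ : 0 ≤ θ) (h : θ ≤ ξ / 2) :
    Phi (-(ξ - θ)) + Phi (-(ξ + θ)) ≤
      2 * Phi (-ξ) + ξ * Real.exp (-(1 / 8 * ξ ^ 2)) * θ ^ 2 := by
  set E := ξ * Real.exp (-(1 / 8 * ξ ^ 2)) with hE
  have hd : ∀ u, HasDerivAt (fun u => E * u ^ 2 - Phi (u - ξ) - Phi (-ξ - u))
      (E * (2 * u) - nd (u - ξ) - -nd (-ξ - u)) u := by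
    intro u
    have h1 := (hasDerivAt_Phi (u - ξ)).comp u ((hasDerivAt_id u).sub_const ξ)
    have h2 := (hasDerivAt_Phi (-ξ - u)).comp u ((hasDerivAt_id u).const_sub (-ξ))
    have h3 := ((hasDerivAt_id u).pow 2).const_mul E
    refine ((h3.sub h1).sub h2).congr_deriv ?_
    simp
  have hmono : MonotoneOn (fun u => E * u ^ 2 - Phi (u - ξ) - Phi (-ξ - u))
      (Set.Icc 0 (ξ / 2)) := by
    refine monotoneOn_of_deriv_nonneg (convex_Icc _ _)
      (fun z _ => (hd z).continuousAt.continuousWithinAt)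
      (fun z _ => (hd z).differentiableAt.differentiableWithinAt) ?_
    intro u hu
    rw [interior_Icc] at hu
    rw [(hd u).deriv]
    have := nd_sub_nd_le hu.1.le hu.2.le
    rw [hE]
    linarith
  have := hmono (Set.left_mem_Icc.2 (by linarith)) ⟨hθ, h⟩ hθ
  simp only [zero_sub, sub_zero] at this
  rw [show -(ξ - θ) = θ - ξ by ring, show -(ξ + θ) = -ξ - θ by ring]
  linarith

/-- The excess over the null probability has to be charged to `min(θ², ξ²)`, so a bound linear in
`|θ|` would not do. For `|θ| ≤ ξ/2` the second-difference bound applies. For larger means the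
trivial bound 1 suffices, as `ξ` and `1 + ξ` are comparable above `x₀`. -/
lemma pAbove_le_null_add {x₀ : ℝ} (hx₀ : 0 < x₀) : ∃ C : ℝ, 0 < C ∧ ∀ ξ θ : ℝ, x₀ ≤ ξ →
    pAbove θ ξ ≤ 2 * Phi (-ξ) + C * min (θ ^ 2) (ξ ^ 2) / (1 + ξ) ^ 2 := by
  obtain ⟨C₁, hC₁, h₁⟩ := exists_pow_mul_exp_sq_le 3 (c := 1 / 8) (by norm_num)
  refine ⟨C₁ + 4 * (1 + x₀) ^ 2 / x₀ ^ 2, by positivity, fun ξ θ hξ => ?_⟩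
  have hξ0 : 0 < ξ := hx₀.trans_le hξ
  have hmin := min_sq_nonneg θ ξ
  have hP := Phi_nonneg (-ξ)
  rw [add_mul, add_div]
  have hA : 0 ≤ C₁ * min (θ ^ 2) (ξ ^ 2) / (1 + ξ) ^ 2 := by positivity
  have hB : 0 ≤ 4 * (1 + x₀) ^ 2 / x₀ ^ 2 * min (θ ^ 2) (ξ ^ 2) / (1 + ξ) ^ 2 := by positivity
  rcases le_total |θ| (ξ / 2) with h | h
  · have hsym : Phi (-(ξ - θ)) + Phi (-(ξ + θ)) = Phi (-(ξ - |θ|)) + Phi (-(ξ + |θ|)) := by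
      rcases abs_choice θ with h | h <;> rw [h]
      rw [sub_neg_eq_add, ← sub_eq_add_neg, add_comm]
    have h2 := pAbove_le θ ξ
    rw [hsym] at h2
    have h3 := Phi_second_diff_le (abs_nonneg θ) h
    rw [sq_abs] at h3
    have hm : min (θ ^ 2) (ξ ^ 2) = θ ^ 2 := by
      refine min_eq_left ?_
      rw [← sq_abs]
      gcongr
      linarith
    have h4 : ξ * Real.exp (-(1 / 8 * ξ ^ 2)) * θ ^ 2 ≤
        C₁ * min (θ ^ 2) (ξ ^ 2) / (1 + ξ) ^ 2 := by
      rw [hm, le_div_iff₀ (by positivity)]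
      have h5 : ξ * (1 + ξ) ^ 2 * Real.exp (-(1 / 8 * ξ ^ 2)) ≤ C₁ := by
        refine le_trans ?_ (h₁ ξ hξ0.le)
        gcongr
        nlinarith [sq_nonneg (1 + ξ)]
      nlinarith [mul_le_mul_of_nonneg_right h5 (sq_nonneg θ)]
    linarith
  · have h1 := pAbove_le_one θ ξ
    have h2 : 1 ≤ 4 * (1 + x₀) ^ 2 / x₀ ^ 2 * min (θ ^ 2) (ξ ^ 2) / (1 + ξ) ^ 2 := by
      have hm : ξ ^ 2 / 4 ≤ min (θ ^ 2) (ξ ^ 2) := by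
        refine le_min ?_ (by nlinarith)
        rw [← sq_abs θ]
        nlinarith
      rw [le_div_iff₀ (by positivity), one_mul, div_mul_eq_mul_div, le_div_iff₀ (by positivity)]
      calc (1 + ξ) ^ 2 * x₀ ^ 2 = ((1 + ξ) * x₀) ^ 2 := by ring
        _ ≤ ((1 + x₀) * ξ) ^ 2 := by gcongr ?_ ^ 2; nlinarith
        _ = 4 * (1 + x₀) ^ 2 * (ξ ^ 2 / 4) := by ring
        _ ≤ _ := by gcongr
    linarith

lemma pAbove_zero_le (t : ℝ) : pAbove 0 t ≤ 2 * Phi (-t) := by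
  have := pAbove_le 0 t
  simp at this
  linarith

lemma measurableSet_le_abs (ξ : ℝ) : MeasurableSet {y : ℝ | ξ ≤ |y|} :=
  measurableSet_le measurable_const (by fun_prop)

lemma integrable_excess_abs (μ a : ℝ) (θ : ℝ) :
    Integrable (fun y => (max (|y + θ| - a) 0) ^ 2) (gaussianReal μ 1) := by
  refine integrable_of_abs_le_sq (by fun_prop) (A := 4 * a ^ 2 + 4 * θ ^ 2) (B := 2) fun z => ?_
  rw [abs_of_nonneg (sq_nonneg _)]
  have h1 : max (|z + θ| - a) 0 ≤ |z| + (|θ| + |a|) := by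
    refine max_le ?_ (by positivity)
    have := abs_add_le z θ
    have := neg_abs_le a
    linarith
  calc _ ≤ (|z| + (|θ| + |a|)) ^ 2 := by gcongr
    _ ≤ _ := by
      rw [← sq_abs z, ← sq_abs θ, ← sq_abs a]
      nlinarith [sq_nonneg (|z| - (|θ| + |a|)), sq_nonneg (|θ| - |a|)]

/-- The excess is the distance to `[-a, a]`. Replacing it at `z ± θ` by the distance to the
projection `p` of `z` and using the parallelogram law leaves only `2θ²` beyond twice the squared
excess at `z`. If `|z| < a - |θ|` all three excesses vanish. -/
lemma excess_second_diff_le {a : ℝ} (ha : 0 ≤ a) (z θ : ℝ) :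
    (max (|z + θ| - a) 0) ^ 2 + (max (|z - θ| - a) 0) ^ 2 ≤
      2 * (max (|z| - a) 0) ^ 2 + Set.indicator {y : ℝ | a - |θ| ≤ |y|} (fun _ => 2 * θ ^ 2) z := by
  have key : ∀ w p : ℝ, |p| ≤ a → (max (|w| - a) 0) ^ 2 ≤ (w - p) ^ 2 := by
    intro w p hp
    rw [← sq_abs (w - p)]
    gcongr
    refine max_le ?_ (abs_nonneg _)
    have := abs_sub_abs_le_abs_sub w p
    linarith
  by_cases hz : a - |θ| ≤ |z|
  · rw [Set.indicator_of_mem (show z ∈ {y : ℝ | a - |θ| ≤ |y|} from hz)]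
    obtain ⟨p, hp, hpz⟩ : ∃ p : ℝ, |p| ≤ a ∧ (z - p) ^ 2 = (max (|z| - a) 0) ^ 2 := by
      rcases le_total |z| a with h | h
      · exact ⟨z, h, by rw [max_eq_right (by linarith)]; ring⟩
      · rcases abs_cases z with h' | h'
        · exact ⟨a, (abs_of_nonneg ha).le, by rw [max_eq_left (by linarith), h'.1]⟩
        · refine ⟨-a, by rw [abs_neg, abs_of_nonneg ha], ?_⟩
          rw [max_eq_left (by linarith), h'.1]
          ring
    have h1 := key (z + θ) p hp
    have h2 := key (z - θ) p hp
    nlinarith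
  · rw [Set.indicator_of_notMem (show z ∉ {y : ℝ | a - |θ| ≤ |y|} from hz)]
    push Not at hz
    have h1 := abs_add_le z θ
    have h2 := abs_sub z θ
    have h3 := abs_nonneg θ
    rw [max_eq_right (by linarith), max_eq_right (by linarith), max_eq_right (by linarith)]
    simp

lemma integral_excess_shift_le {a : ℝ} (ha : 0 ≤ a) (θ : ℝ) :
    ∫ y, (max (|y| - a) 0) ^ 2 ∂(gaussianReal θ 1) ≤
      softRisk 0 a + θ ^ 2 * pAbove 0 (a - |θ|) := by
  rw [integral_gaussian_shift]
  have hsym : ∫ z, (max (|z - θ| - a) 0) ^ 2 ∂(gaussianReal 0 1)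
      = ∫ z, (max (|z + θ| - a) 0) ^ 2 ∂(gaussianReal 0 1) := by
    rw [← integral_stdGaussian_neg]
    congr 1
    ext z
    rw [← neg_add', abs_neg]
  have hi1 := integrable_excess_abs 0 a θ
  have hi2 : Integrable (fun z => (max (|z - θ| - a) 0) ^ 2) (gaussianReal 0 1) := by
    simpa only [sub_eq_add_neg] using integrable_excess_abs 0 a (-θ)
  have hi3 : Integrable (fun z => (max (|z| - a) 0) ^ 2) (gaussianReal 0 1) := by
    simpa only [add_zero] using integrable_excess_abs 0 a 0
  have hi4 : Integrable (Set.indicator {y : ℝ | a - |θ| ≤ |y|} (fun _ => 2 * θ ^ 2))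
      (gaussianReal 0 1) := (integrable_const _).indicator (measurableSet_le_abs _)
  have h := integral_mono (hi1.add hi2) ((hi3.const_mul 2).add hi4)
    (fun z => excess_second_diff_le ha z θ)
  simp only [Pi.add_apply] at h
  rw [integral_add hi1 hi2, integral_add (hi3.const_mul 2) hi4, hsym, integral_const_mul,
    integral_indicator (measurableSet_le_abs _), setIntegral_const, smul_eq_mul] at h
  have hs : ∫ z, (max (|z| - a) 0) ^ 2 ∂(gaussianReal 0 1) = softRisk 0 a := by
    unfold softRisk
    congr 1
    ext z
    rw [add_zero, sub_zero, soft_sq ha]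
  rw [hs] at h
  unfold pAbove
  linarith

lemma exists_pAbove_le_pow (m : ℕ) {c : ℝ} (hc : 0 < c) : ∃ C : ℝ, 0 < C ∧ ∀ a t : ℝ, 0 ≤ a →
    c * a ≤ t → pAbove 0 t ≤ C / (1 + a) ^ m := by
  obtain ⟨C, hC, h⟩ := exists_pow_mul_exp_sq_le m (c := c ^ 2 / 2) (by positivity)
  refine ⟨4 * C, by positivity, fun a t ha hat => ?_⟩
  rw [le_div_iff₀ (by positivity)]
  have h1 : pAbove 0 t ≤ 4 * Real.exp (-(c ^ 2 / 2 * a ^ 2)) := by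
    have h2 := pAbove_zero_le t
    have h3 : Phi (-t) ≤ Phi (-(c * a)) := Phi_mono (by linarith)
    have h4 := Phi_neg_le_exp (x := c * a) (by positivity)
    rw [show -(c * a) ^ 2 / 2 = -(c ^ 2 / 2 * a ^ 2) by ring] at h4
    linarith
  have := h a ha
  calc _ ≤ 4 * Real.exp (-(c ^ 2 / 2 * a ^ 2)) * (1 + a) ^ m := by gcongr
    _ ≤ _ := by linarith

lemma integral_sq_sub_gaussian (θ : ℝ) : ∫ y, (y - θ) ^ 2 ∂(gaussianReal θ 1) = 1 := by
  rw [integral_gaussian_shift]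
  simpa using integral_sq_stdGaussian

lemma integrable_sq_sub_gaussian (θ : ℝ) :
    Integrable (fun y => (y - θ) ^ 2) (gaussianReal θ 1) := by
  refine integrable_of_abs_le_sq (by fun_prop) (A := 2 * θ ^ 2) (B := 2) fun z => ?_
  rw [abs_of_nonneg (sq_nonneg _)]
  nlinarith [sq_nonneg (z + θ)]

/-- The loss caused by lowering the threshold level to `a`. -/
def upLoss (θ a y : ℝ) : ℝ := min ((y - θ) ^ 2) (4 * (max (|y| - a) 0) ^ 2)

lemma upLoss_nonneg (θ a y : ℝ) : 0 ≤ upLoss θ a y := le_min (sq_nonneg _) (by positivity)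

lemma integrable_upLoss (θ a : ℝ) : Integrable (upLoss θ a) (gaussianReal θ 1) := by
  refine (integrable_sq_sub_gaussian θ).mono' ?_ (ae_of_all _ fun y => ?_)
  · unfold upLoss
    fun_prop
  · rw [Real.norm_of_nonneg (upLoss_nonneg _ _ _)]
    exact min_le_left _ _

lemma upLoss_anti (θ y : ℝ) {a b : ℝ} (h : a ≤ b) : upLoss θ b y ≤ upLoss θ a y := by
  unfold upLoss
  gcongr

lemma integral_upLoss_le_one (θ a : ℝ) : ∫ y, upLoss θ a y ∂(gaussianReal θ 1) ≤ 1 := by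
  rw [← integral_sq_sub_gaussian θ]
  exact integral_mono (integrable_upLoss θ a) (integrable_sq_sub_gaussian θ)
    fun y => min_le_left _ _

lemma integral_upLoss_le_excess {a : ℝ} (ha : 0 ≤ a) (θ : ℝ) :
    ∫ y, upLoss θ a y ∂(gaussianReal θ 1) ≤
      4 * (softRisk 0 a + θ ^ 2 * pAbove 0 (a - |θ|)) := by
  have h1 : ∫ y, upLoss θ a y ∂(gaussianReal θ 1) ≤
      ∫ y, 4 * (max (|y| - a) 0) ^ 2 ∂(gaussianReal θ 1) := by
    refine integral_mono (integrable_upLoss θ a) ?_ fun y => min_le_right _ _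
    simpa only [add_zero] using (integrable_excess_abs θ a 0).const_mul 4
  rw [integral_const_mul] at h1
  linarith [integral_excess_shift_le ha θ]

/-- The loss never exceeds 1, which settles `a ≤ 1` and `l ≤ 1` by the null risk. It also settles
`|θ| ≥ a/4`, where `min(θ², l²)` is of order `a²` or equals `l²`; this is why both weights
`1/(1+a)²` and `1/(1+l)²` appear. For small means the excess bound leaves a tail probability beyond
`3a/4`, which decays faster than any power of `a`. -/
lemma exists_integral_upLoss_le : ∃ C : ℝ, 0 < C ∧ ∀ a l θ : ℝ, 0 ≤ a → 0 ≤ l →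
    ∫ y, upLoss θ a y ∂(gaussianReal θ 1) ≤
      C * (softRisk 0 a + (1 / (1 + a) ^ 2 + 1 / (1 + l) ^ 2) * refRisk θ l) := by
  obtain ⟨C₁, hC₁, h₁⟩ := exists_pAbove_le_pow 4 (c := 3 / 4) (by norm_num)
  have hs1 := softRisk_zero_pos (l := 1) zero_le_one
  set s := softRisk 0 1 with hs
  refine ⟨4 / s + 64 + 4 * C₁ + 4, by positivity, fun a l θ ha hl => ?_⟩
  have hsa := softRisk_zero_pos ha
  have hsl := softRisk_zero_pos hl
  have hrr : 0 < refRisk θ l := refRisk_pos hl θ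
  have hm := min_sq_nonneg θ l
  have hA0 : 0 < 1 / (1 + a) ^ 2 := by positivity
  have hL0 : 0 < 1 / (1 + l) ^ 2 := by positivity
  have hle1 := integral_upLoss_le_one θ a
  have hT : 0 < softRisk 0 a + (1 / (1 + a) ^ 2 + 1 / (1 + l) ^ 2) * refRisk θ l := by positivity
  suffices h : ∃ c ∈ ({4 / s, 64, 4 * C₁ + 4} : Set ℝ), ∫ y, upLoss θ a y ∂(gaussianReal θ 1) ≤
      c * (softRisk 0 a + (1 / (1 + a) ^ 2 + 1 / (1 + l) ^ 2) * refRisk θ l) by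
    obtain ⟨c, hc, h⟩ := h
    refine h.trans (mul_le_mul_of_nonneg_right ?_ hT.le)
    have h4s : 0 < 4 / s := by positivity
    rcases hc with rfl | rfl | rfl <;> linarith
  rcases le_total a 1 with ha1 | ha1
  · refine ⟨4 / s, by simp, hle1.trans ?_⟩
    have h2 := softRisk_zero_anti ha ha1
    rw [div_mul_eq_mul_div, le_div_iff₀ hs1]
    have : 0 ≤ (1 / (1 + a) ^ 2 + 1 / (1 + l) ^ 2) * refRisk θ l := by positivity
    linarith
  rcases le_total l 1 with hl1 | hl1
  · refine ⟨4 / s, by simp, hle1.trans ?_⟩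
    have h2 := softRisk_zero_anti hl hl1
    rw [div_mul_eq_mul_div, le_div_iff₀ hs1]
    have h3 : 1 / 4 ≤ 1 / (1 + l) ^ 2 := by
      apply one_div_le_one_div_of_le (by positivity)
      nlinarith
    have h4 : s ≤ refRisk θ l := by unfold refRisk; linarith
    have h5 : 1 / 4 * s ≤ (1 / (1 + a) ^ 2 + 1 / (1 + l) ^ 2) * refRisk θ l := by
      gcongr
      linarith
    linarith
  have hl4 : 1 / 4 ≤ l ^ 2 * (1 / (1 + l) ^ 2) := by
    rw [mul_one_div, le_div_iff₀ (by positivity)]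
    nlinarith
  have ha4 : 1 / 4 ≤ a ^ 2 * (1 / (1 + a) ^ 2) := by
    rw [mul_one_div, le_div_iff₀ (by positivity)]
    nlinarith
  have hprod : (1 / (1 + a) ^ 2 + 1 / (1 + l) ^ 2) * min (θ ^ 2) (l ^ 2) ≤
      (1 / (1 + a) ^ 2 + 1 / (1 + l) ^ 2) * refRisk θ l := by
    gcongr
    unfold refRisk
    linarith
  rcases le_total (a / 4) |θ| with ht | ht
  · refine ⟨64, by simp, hle1.trans ?_⟩
    have h2 : 1 / 64 ≤ (1 / (1 + a) ^ 2 + 1 / (1 + l) ^ 2) * min (θ ^ 2) (l ^ 2) := by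
      rcases min_choice (θ ^ 2) (l ^ 2) with h | h <;> rw [h]
      · have : a ^ 2 / 16 ≤ θ ^ 2 := by rw [← sq_abs θ]; nlinarith
        have h5 : a ^ 2 / 16 * (1 / (1 + a) ^ 2) ≤ θ ^ 2 * (1 / (1 + a) ^ 2) := by gcongr
        nlinarith [sq_nonneg θ]
      · nlinarith [sq_nonneg l]
    linarith
  · refine ⟨4 * C₁ + 4, by simp, (integral_upLoss_le_excess ha θ).trans ?_⟩
    have h2 := h₁ a (a - |θ|) ha (by linarith)
    -- Of the four powers of `1 + a`, two are kept as the weight and two turn `θ²` into `min(θ²,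
    -- l²)`, because `θ²/(1+a)² ≤ 1 ≤ l²`.
    have h3 : θ ^ 2 * pAbove 0 (a - |θ|) ≤ C₁ * (1 / (1 + a) ^ 2 * min (θ ^ 2) (l ^ 2)) := by
      have hp4 : C₁ / (1 + a) ^ 4 = C₁ * (1 / (1 + a) ^ 2 * (1 / (1 + a) ^ 2)) := by
        field_simp
      have hAle : 1 / (1 + a) ^ 2 ≤ 1 := by
        rw [div_le_one (by positivity)]
        nlinarith
      have hθa : θ ^ 2 ≤ a ^ 2 := by
        rw [← sq_abs θ]; gcongr; linarith
      have haA : a ^ 2 * (1 / (1 + a) ^ 2) ≤ 1 := by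
        rw [mul_one_div, div_le_one (by positivity)]
        nlinarith
      have h6 : θ ^ 2 * (1 / (1 + a) ^ 2) ≤ min (θ ^ 2) (l ^ 2) := by
        refine le_min ?_ ?_
        · exact mul_le_of_le_one_right (sq_nonneg _) hAle
        · calc θ ^ 2 * (1 / (1 + a) ^ 2) ≤ a ^ 2 * (1 / (1 + a) ^ 2) := by gcongr
            _ ≤ 1 := haA
            _ ≤ l ^ 2 := by nlinarith
      calc θ ^ 2 * pAbove 0 (a - |θ|) ≤ θ ^ 2 * (C₁ / (1 + a) ^ 4) := by gcongr
        _ = C₁ * (1 / (1 + a) ^ 2 * (θ ^ 2 * (1 / (1 + a) ^ 2))) := by rw [hp4]; ring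
        _ ≤ _ := by gcongr
    have h7 : 1 / (1 + a) ^ 2 * min (θ ^ 2) (l ^ 2) ≤
        (1 / (1 + a) ^ 2 + 1 / (1 + l) ^ 2) * min (θ ^ 2) (l ^ 2) := by
      gcongr
      linarith
    have h8 := h7.trans hprod
    have h9 : C₁ * (1 / (1 + a) ^ 2 * min (θ ^ 2) (l ^ 2)) ≤
      C₁ * ((1 / (1 + a) ^ 2 + 1 / (1 + l) ^ 2) * refRisk θ l) := by gcongr
    have h10 : 0 ≤ C₁ * softRisk 0 a := by positivity
    have h11 : 0 ≤ (1 / (1 + a) ^ 2 + 1 / (1 + l) ^ 2) * refRisk θ l := by positivity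
    linarith

/-- The loss caused by raising the threshold level from `l`, for a small mean. -/
def downLoss (θ l y : ℝ) : ℝ := min (θ ^ 2) ((max (|y| - l) 0) ^ 2)

lemma downLoss_nonneg (θ l y : ℝ) : 0 ≤ downLoss θ l y := le_min (sq_nonneg _) (sq_nonneg _)

lemma integrable_downLoss (θ l : ℝ) : Integrable (downLoss θ l) (gaussianReal θ 1) := by
  refine (integrable_const (θ ^ 2)).mono' ?_ (ae_of_all _ fun y => ?_)
  · unfold downLoss
    fun_prop
  · rw [Real.norm_of_nonneg (downLoss_nonneg _ _ _)]
    exact min_le_left _ _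

/-- When `l ≥ 1` and `|θ| ≥ l/2`, the mean is at most one unit beyond the level, so the loss is
`O(1)` against a reference risk of order `l²`. When `|θ| ≤ l/2`, a nonzero loss needs noise of size
at least `l/2`. -/
lemma exists_integral_downLoss_le : ∃ C : ℝ, 0 < C ∧ ∀ l θ : ℝ, 0 ≤ l → |θ| ≤ l + 1 →
    ∫ y, downLoss θ l y ∂(gaussianReal θ 1) ≤ C * (1 / (1 + l) ^ 2 * refRisk θ l) := by
  obtain ⟨C₁, hC₁, h₁⟩ := exists_pAbove_le_pow 2 (c := 1 / 2) (by norm_num)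
  have hs1 := softRisk_zero_pos (l := 1) zero_le_one
  set s := softRisk 0 1 with hs
  refine ⟨16 / s + 64 + C₁, by positivity, fun l θ hl hθ => ?_⟩
  have hsl := softRisk_zero_pos hl
  have hrr : 0 < refRisk θ l := refRisk_pos hl θ
  have hm := min_sq_nonneg θ l
  have hL0 : 0 < 1 / (1 + l) ^ 2 := by positivity
  have hT : 0 < 1 / (1 + l) ^ 2 * refRisk θ l := by positivity
  suffices h : ∃ c ∈ ({16 / s, 64, C₁} : Set ℝ), ∫ y, downLoss θ l y ∂(gaussianReal θ 1) ≤
      c * (1 / (1 + l) ^ 2 * refRisk θ l) by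
    obtain ⟨c, hc, h⟩ := h
    refine h.trans (mul_le_mul_of_nonneg_right ?_ hT.le)
    have h4s : 0 < 16 / s := by positivity
    rcases hc with rfl | rfl | rfl <;> linarith
  have hle : ∫ y, downLoss θ l y ∂(gaussianReal θ 1) ≤ θ ^ 2 := by
    have := integral_mono (integrable_downLoss θ l) (integrable_const (θ ^ 2))
      fun y => min_le_left _ _
    simpa using this
  rcases le_total l 1 with hl1 | hl1
  · refine ⟨16 / s, by simp, hle.trans ?_⟩
    have h2 := softRisk_zero_anti hl hl1
    have h3 : 1 / 4 ≤ 1 / (1 + l) ^ 2 := by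
      apply one_div_le_one_div_of_le (by positivity)
      nlinarith
    have h4 : s ≤ refRisk θ l := by unfold refRisk; linarith
    have h5 : 1 / 4 * s ≤ 1 / (1 + l) ^ 2 * refRisk θ l := by gcongr
    rw [div_mul_eq_mul_div, le_div_iff₀ hs1]
    have h6 : θ ^ 2 ≤ 4 := by rw [← sq_abs]; nlinarith [abs_nonneg θ]
    nlinarith
  have hl4 : 1 / 4 ≤ l ^ 2 * (1 / (1 + l) ^ 2) := by
    rw [mul_one_div, le_div_iff₀ (by positivity)]
    nlinarith
  have hprod : 1 / (1 + l) ^ 2 * min (θ ^ 2) (l ^ 2) ≤ 1 / (1 + l) ^ 2 * refRisk θ l := by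
    gcongr
    unfold refRisk
    linarith
  rcases le_total (l / 2) |θ| with ht | ht
  · refine ⟨64, by simp, ?_⟩
    have h1 : ∫ y, downLoss θ l y ∂(gaussianReal θ 1) ≤ 4 := by
      have h2 : ∫ y, downLoss θ l y ∂(gaussianReal θ 1) ≤
          ∫ y, (2 + 2 * (y - θ) ^ 2) ∂(gaussianReal θ 1) := by
        refine integral_mono (integrable_downLoss θ l)
          ((integrable_const _).add ((integrable_sq_sub_gaussian θ).const_mul 2)) fun y => ?_
        refine (min_le_right _ _).trans ?_
        have h3 : max (|y| - l) 0 ≤ 1 + |y - θ| := by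
          refine max_le ?_ (by positivity)
          have := abs_sub_abs_le_abs_sub y θ
          linarith
        calc _ ≤ (1 + |y - θ|) ^ 2 := by gcongr
          _ ≤ _ := by
            rw [← sq_abs (y - θ)]
            nlinarith [sq_nonneg (1 - |y - θ|)]
      rw [integral_add (integrable_const _) ((integrable_sq_sub_gaussian θ).const_mul 2),
        integral_const_mul, integral_sq_sub_gaussian] at h2
      simp at h2
      linarith
    have h2 : 1 / 16 ≤ 1 / (1 + l) ^ 2 * min (θ ^ 2) (l ^ 2) := by
      have : l ^ 2 / 4 ≤ min (θ ^ 2) (l ^ 2) := by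
        refine le_min ?_ (by nlinarith)
        rw [← sq_abs θ]
        nlinarith
      calc 1 / 16 ≤ 1 / (1 + l) ^ 2 * (l ^ 2 / 4) := by linarith
        _ ≤ _ := by gcongr
    linarith
  · refine ⟨C₁, by simp, ?_⟩
    have hmin : min (θ ^ 2) (l ^ 2) = θ ^ 2 := by
      refine min_eq_left ?_
      rw [← sq_abs]
      gcongr
      linarith
    have h2 : ∫ y, downLoss θ l y ∂(gaussianReal θ 1) ≤ θ ^ 2 * pAbove 0 (l - |θ|) := by
      rw [integral_gaussian_shift]
      have h3 : ∫ z, downLoss θ l (z + θ) ∂(gaussianReal 0 1) ≤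
          ∫ z, Set.indicator {y : ℝ | l - |θ| ≤ |y|} (fun _ => θ ^ 2) z ∂(gaussianReal 0 1) := by
        refine integral_mono ?_ ((integrable_const _).indicator (measurableSet_le_abs _))
          fun z => ?_
        · refine (integrable_const (θ ^ 2)).mono' ?_ (ae_of_all _ fun y => ?_)
          · unfold downLoss
            fun_prop
          · rw [Real.norm_of_nonneg (downLoss_nonneg _ _ _)]
            exact min_le_left _ _
        · by_cases hz : l - |θ| ≤ |z|
          · rw [Set.indicator_of_mem (show z ∈ {y : ℝ | l - |θ| ≤ |y|} from hz)]
            exact min_le_left _ _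
          · rw [Set.indicator_of_notMem (show z ∉ {y : ℝ | l - |θ| ≤ |y|} from hz)]
            refine (min_le_right _ _).trans ?_
            have := abs_add_le z θ
            rw [max_eq_right (by linarith)]
            simp
      rw [integral_indicator (measurableSet_le_abs _), setIntegral_const, smul_eq_mul] at h3
      unfold pAbove
      linarith
    have h4 := h₁ l (l - |θ|) hl (by linarith)
    calc _ ≤ θ ^ 2 * pAbove 0 (l - |θ|) := h2
      _ ≤ θ ^ 2 * (C₁ / (1 + l) ^ 2) := by gcongr
      _ = C₁ * (1 / (1 + l) ^ 2 * min (θ ^ 2) (l ^ 2)) := by rw [hmin]; ring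
      _ ≤ _ := by gcongr

/-! ### Candidate levels and smooth threshold functions -/

lemma Phi_neg_xi {α : ℝ} (h0 : 0 < α) (h1 : α < 1) {n k : ℕ} (hn : 1 ≤ n) (hk : 1 ≤ k)
    (hkn : k ≤ n + 1) : Phi (-xi α n k) = α * k / (2 * n) := by
  have hn' : (1 : ℝ) ≤ n := by exact_mod_cast hn
  have hk' : (1 : ℝ) ≤ k := by exact_mod_cast hk
  have hkn' : (k : ℝ) ≤ n + 1 := by exact_mod_cast hkn
  rw [xi, neg_neg, Phi_PhiInv (by positivity)]
  rw [div_lt_one (by positivity)]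
  nlinarith

lemma xi_anti {α : ℝ} (h0 : 0 < α) (h1 : α < 1) {n k k' : ℕ} (hn : 1 ≤ n) (hk : 1 ≤ k)
    (hkk : k ≤ k') (hkn : k' ≤ n + 1) : xi α n k' ≤ xi α n k := by
  rw [← Phi_neg_le_iff, Phi_neg_xi h0 h1 hn hk (hkk.trans hkn),
    Phi_neg_xi h0 h1 hn (hk.trans hkk) hkn]
  gcongr

lemma le_xi {α α' : ℝ} (h0 : 0 < α) (h1 : α ≤ α') (h2 : α' < 1) {n k : ℕ} (hn : 1 ≤ n)
    (hk : 1 ≤ k) (hkn : k ≤ n) : -PhiInv (α' / 2) ≤ xi α n k := by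
  rw [← Phi_neg_le_iff, Phi_neg_xi h0 (h1.trans_lt h2) hn hk (by omega), neg_neg,
    Phi_PhiInv (by linarith) (by linarith)]
  have hn' : (0 : ℝ) < n := by exact_mod_cast hn
  have hkn' : (k : ℝ) ≤ n := by exact_mod_cast hkn
  rw [div_le_div_iff₀ (by positivity) (by positivity)]
  have : α * k ≤ α' * n := by gcongr; linarith
  linarith

lemma neg_PhiInv_half_pos {α : ℝ} (h0 : 0 < α) (h1 : α < 1) : 0 < -PhiInv (α / 2) := by
  rw [← Phi_neg_lt_iff, neg_neg, neg_zero, Phi_PhiInv (by linarith) (by linarith), Phi_zero]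
  linarith

lemma xi_pos {α : ℝ} (h0 : 0 < α) (h1 : α < 1) {n k : ℕ} (hn : 1 ≤ n) (hk : 1 ≤ k)
    (hkn : k ≤ n) : 0 < xi α n k :=
  (neg_PhiInv_half_pos h0 h1).trans_le (le_xi h0 le_rfl h1 hn hk hkn)

lemma finite_levels (α : ℝ) (n : ℕ) (P : ℕ → Prop) :
    {y : ℝ | ∃ k : ℕ, 1 ≤ k ∧ k ≤ n ∧ P k ∧ y = xi α n k}.Finite := by
  refine ((Finset.Icc 1 n).finite_toSet.image (xi α n)).subset ?_
  rintro y ⟨k, h1, h2, -, rfl⟩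
  exact ⟨k, by simp [h1, h2], rfl⟩

lemma exists_xiHat1_eq (α : ℝ) {n : ℕ} (hn : 1 ≤ n) (x : Fin n → ℝ) :
    ∃ k : ℕ, 1 ≤ k ∧ k ≤ n ∧ (k = 1 ∨ k ≤ countAbove x (xi α n k)) ∧ xiHat1 α x = xi α n k := by
  by_cases h : ∃ k : ℕ, 1 ≤ k ∧ k ≤ n ∧ k ≤ countAbove x (xi α n k)
  · rw [xiHat1, if_pos h]
    obtain ⟨k, h1, h2, h3⟩ := h
    have hmem := Set.Nonempty.csInf_mem (s := {y : ℝ | ∃ k : ℕ, 1 ≤ k ∧ k ≤ n ∧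
      k ≤ countAbove x (xi α n k) ∧ y = xi α n k}) ⟨_, k, h1, h2, h3, rfl⟩
      (finite_levels α n fun k => k ≤ countAbove x (xi α n k))
    obtain ⟨j, h1, h2, h3, h4⟩ := hmem
    exact ⟨j, h1, h2, Or.inr h3, h4⟩
  · rw [xiHat1, if_neg h]
    -- Here `xiHat1` takes its default value `ξ_1`, about which the count says nothing; hence the
    -- alternative `k = 1`.
    exact ⟨1, le_rfl, hn, Or.inl rfl, rfl⟩

lemma exists_xiHat2_eq (α : ℝ) {n : ℕ} (hn : 1 ≤ n) (x : Fin n → ℝ) :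
    ∃ k : ℕ, 1 ≤ k ∧ k ≤ n ∧ countAbove x (xi α n (k + 1)) < k + 1 ∧
      xiHat2 α x = xi α n k := by
  have hmem := Set.Nonempty.csSup_mem (s := {y : ℝ | ∃ k : ℕ, 1 ≤ k ∧ k ≤ n ∧
      countAbove x (xi α n (k + 1)) < k + 1 ∧ y = xi α n k})
      -- The index `n` always qualifies, since at most `n` coordinates can exceed any level.
      ⟨_, n, hn, le_rfl, by
        have : countAbove x (xi α n (n + 1)) ≤ n := by
          unfold countAbove
          exact (Finset.card_filter_le _ _).trans (by simp)
        omega, rfl⟩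
      (finite_levels α n fun k => countAbove x (xi α n (k + 1)) < k + 1)
  exact hmem

lemma soft_eq {l : ℝ} (hl : 0 ≤ l) (x : ℝ) : soft l x = max (x - l) 0 - max (-x - l) 0 := by
  rcases le_total 0 x with hx | hx
  · rw [soft_of_nonneg hl hx, max_eq_right (by linarith : -x - l ≤ 0), sub_zero]
  · rw [← neg_neg x, soft_neg, soft_of_nonneg hl (by linarith), neg_neg,
      max_eq_right (by linarith : x - l ≤ 0), zero_sub]

lemma hard_neg (l x : ℝ) : hard l (-x) = -hard l x := by
  unfold hard
  rw [abs_neg]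
  split_ifs <;> simp

lemma max_zero_le_hard {l x : ℝ} (hl : 0 ≤ l) (hx : 0 ≤ x) : max (x - l) 0 ≤ hard l x := by
  unfold hard
  rw [abs_of_nonneg hx]
  split_ifs with h
  · exact max_le (by linarith) hx
  · rw [max_eq_right (by linarith)]

lemma isSmoothThreshold_soft : IsSmoothThreshold 1 1 soft where
  between_nonneg l x hl hx := ⟨le_rfl, by
    rw [soft_of_nonneg hl hx]
    exact max_zero_le_hard hl hx⟩
  between_neg l x hl hx := ⟨by
    have := max_zero_le_hard hl (x := -x) (by linarith)
    rw [hard_neg, ← soft_of_nonneg hl (by linarith), soft_neg] at this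
    linarith, le_rfl⟩
  smooth_x l x y hl hxy := by
    rw [soft_eq hl, soft_eq hl]
    rcases max_cases (x - l) 0 with h1 | h1 <;> rcases max_cases (-x - l) 0 with h2 | h2 <;>
    rcases max_cases (y - l) 0 with h3 | h3 <;> rcases max_cases (-y - l) 0 with h4 | h4 <;>
    constructor <;> linarith
  smooth_level l l' x hl hl' := by
    rw [one_mul]
    wlog hx : 0 ≤ x generalizing x
    · have := this (-x) (by linarith)
      rwa [soft_neg, soft_neg, ← abs_neg, neg_sub_neg, ← neg_sub, neg_neg] at this
    rw [soft_of_nonneg hl hx, soft_of_nonneg hl' hx]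
    refine (abs_max_sub_max_le_abs _ _ _).trans (le_of_eq ?_)
    rw [← abs_neg]
    congr 1
    ring

namespace IsSmoothThreshold

variable {κ₀ κ₁ : ℝ} {t : ℝ → ℝ → ℝ}

lemma apply_zero (ht : IsSmoothThreshold κ₀ κ₁ t) {l : ℝ} (hl : 0 ≤ l) : t l 0 = 0 := by
  have h := ht.between_nonneg l 0 hl le_rfl
  rw [soft_of_nonneg hl le_rfl, max_eq_right (by linarith)] at h
  have h2 : hard l 0 = 0 := by simp [hard]
  linarith

/-- The threshold function need not be odd. Reflection stays within the class and reduces negative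
observations to nonnegative ones. -/
lemma reflect (ht : IsSmoothThreshold κ₀ κ₁ t) :
    IsSmoothThreshold κ₀ κ₁ (fun l x => -t l (-x)) where
  between_nonneg l x hl hx := by
    rcases hx.eq_or_lt with rfl | hx
    · simp only [neg_zero, ht.apply_zero hl]
      rw [soft_of_nonneg hl le_rfl, max_eq_right (by linarith)]
      simp [hard]
    · have h := ht.between_neg l (-x) hl (by linarith)
      rw [hard_neg, soft_neg] at h
      constructor <;> linarith
  between_neg l x hl hx := by
    have h := ht.between_nonneg l (-x) hl (by linarith)
    rw [hard_neg, soft_neg] at h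
    constructor <;> linarith
  smooth_x l x y hl hxy := by
    have h := ht.smooth_x l (-y) (-x) hl (by linarith)
    constructor <;> linarith
  smooth_level l l' x hl hl' := by
    have h := ht.smooth_level l l' (-x) hl hl'
    rwa [neg_sub_neg, ← neg_sub, abs_neg]

/-- Soft and hard thresholding both vanish at `x = l`, hence so does `t l`, and slope below 2 gives
`t l x ≤ 2 (x - l)` beyond it. This produces the factor 4 in `upLoss`. -/
lemma bounds_of_nonneg (ht : IsSmoothThreshold κ₀ κ₁ t) (hκ : κ₀ < 2) {l x : ℝ} (hl : 0 ≤ l)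
    (hx : 0 ≤ x) : max (x - l) 0 ≤ t l x ∧ t l x ≤ x ∧ t l x ≤ 2 * max (x - l) 0 := by
  have h := ht.between_nonneg l x hl hx
  rw [soft_of_nonneg hl hx, hard, abs_of_nonneg hx] at h
  refine ⟨h.1, h.2.trans ?_, ?_⟩
  · split_ifs <;> linarith
  · rcases le_or_gt x l with hxl | hxl
    · rw [if_neg (by linarith)] at h
      rw [max_eq_right (by linarith)]
      linarith
    · have h2 := ht.between_nonneg l l hl hl
      rw [hard, abs_of_nonneg hl, if_neg (lt_irrefl l), soft_of_nonneg hl hl, sub_self, max_self]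
        at h2
      have h3 := (ht.smooth_x l l x hl hxl).2
      rw [max_eq_left (by linarith)]
      nlinarith

lemma abs_le (ht : IsSmoothThreshold κ₀ κ₁ t) (hκ : κ₀ < 2) {l : ℝ} (hl : 0 ≤ l) (x : ℝ) :
    |t l x| ≤ |x| := by
  rcases le_total 0 x with hx | hx
  · obtain ⟨h1, h2, -⟩ := ht.bounds_of_nonneg hκ hl hx
    rw [abs_of_nonneg hx, abs_of_nonneg ((le_max_right _ _).trans h1)]
    exact h2
  · obtain ⟨h1, h2, -⟩ := ht.reflect.bounds_of_nonneg hκ hl (x := -x) (by linarith)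
    rw [neg_neg] at h1 h2
    have := (le_max_right _ _).trans h1
    rw [abs_of_nonpos hx, abs_of_nonpos (by linarith)]
    exact h2

/-- Write `T` for the new estimate, `s` for the soft one and `w` for the positive part of the error
increase. If `s ≤ T`, then `w` is at most `T`, hence at most `2 (x - a)₊`, and also at most `|x -
θ|` because `T ≤ x`. If `T ≤ s`, then `w` is at most `s`, at most `|θ|`, and at most `(b - m)₊`
because `T ≥ (x - b)₊`. -/
lemma sq_excess_loss_le_of_nonneg (ht : IsSmoothThreshold κ₀ κ₁ t) (hκ : κ₀ < 2)
    {a b l m : ℝ} (ha : 0 ≤ a) (hal : a ≤ l) (hlb : l ≤ b) (hm : 0 ≤ m) (θ : ℝ) {x : ℝ}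
    (hx : 0 ≤ x) :
    (max (|t l x - θ| - |soft m x - θ|) 0) ^ 2 ≤
      upLoss θ a x + min (downLoss θ m x) ((max (b - m) 0) ^ 2) := by
  obtain ⟨h1, h2, h3⟩ := ht.bounds_of_nonneg hκ (ha.trans hal) hx
  have hu := upLoss_nonneg θ a x
  have hd : 0 ≤ min (downLoss θ m x) ((max (b - m) 0) ^ 2) :=
    le_min (downLoss_nonneg _ _ _) (sq_nonneg _)
  rw [soft_of_nonneg hm hx]
  set s := max (x - m) 0 with hs
  set T := t l x with hT
  have hs0 : 0 ≤ s := le_max_right _ _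
  have hT0 : 0 ≤ T := (le_max_right _ _).trans h1
  rcases le_total (|T - θ|) (|s - θ|) with h | h
  · rw [max_eq_right (by linarith)]
    simpa using add_nonneg hu hd
  rw [max_eq_left (by linarith)]
  set w := |T - θ| - |s - θ| with hw
  have hw0 : 0 ≤ w := by linarith
  have hwTs : w ≤ |T - s| := by
    have := abs_sub_abs_le_abs_sub (T - θ) (s - θ)
    rwa [sub_sub_sub_cancel_right] at this
  have hsθ := abs_nonneg (s - θ)
  rcases le_total s T with hsT | hsT
  · rw [abs_of_nonneg (by linarith)] at hwTs
    have hw1 : w ≤ |x - θ| := by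
      rcases le_total θ T with hθ | hθ
      · rw [abs_of_nonneg (by linarith)] at hw
        rw [abs_of_nonneg (by linarith)]
        linarith
      · rw [abs_of_nonpos (by linarith : T - θ ≤ 0)] at hw
        rw [abs_of_nonpos (by linarith : s - θ ≤ 0)] at hw
        have := abs_nonneg (x - θ)
        linarith
    have hw2 : w ≤ 2 * max (x - a) 0 := by
      have : max (x - l) 0 ≤ max (x - a) 0 := by gcongr
      linarith
    have hle : w ^ 2 ≤ upLoss θ a x := by
      refine le_min ?_ ?_
      · rw [← sq_abs (x - θ)]
        gcongr
      · rw [abs_of_nonneg hx]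
        calc w ^ 2 ≤ (2 * max (x - a) 0) ^ 2 := by gcongr
          _ = _ := by ring
    linarith
  · rw [abs_of_nonpos (by linarith)] at hwTs
    have hw1 : w ≤ |θ| := by
      rcases le_total θ T with hθ | hθ
      · rw [abs_of_nonneg (by linarith : 0 ≤ T - θ), abs_of_nonneg (by linarith : 0 ≤ s - θ)] at hw
        have := abs_nonneg θ
        linarith
      · rw [abs_of_nonpos (by linarith : T - θ ≤ 0)] at hw
        have := le_abs_self θ
        linarith
    have hw3 : w ≤ max (b - m) 0 := by
      have : s ≤ max (x - l) 0 + max (b - m) 0 := by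
        refine max_le ?_ (by positivity)
        have := le_max_left (x - l) 0
        have := le_max_left (b - m) 0
        linarith
      linarith
    have hle : w ^ 2 ≤ min (downLoss θ m x) ((max (b - m) 0) ^ 2) := by
      refine le_min (le_min ?_ ?_) ?_
      · rw [← sq_abs θ]
        gcongr
      · rw [abs_of_nonneg hx]
        gcongr
        linarith
      · gcongr
    linarith

lemma sq_excess_loss_le (ht : IsSmoothThreshold κ₀ κ₁ t) (hκ : κ₀ < 2)
    {a b l m : ℝ} (ha : 0 ≤ a) (hal : a ≤ l) (hlb : l ≤ b) (hm : 0 ≤ m) (θ x : ℝ) :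
    (max (|t l x - θ| - |soft m x - θ|) 0) ^ 2 ≤
      upLoss θ a x + min (downLoss θ m x) ((max (b - m) 0) ^ 2) := by
  rcases le_total 0 x with hx | hx
  · exact ht.sq_excess_loss_le_of_nonneg hκ ha hal hlb hm θ hx
  · have h := ht.reflect.sq_excess_loss_le_of_nonneg hκ ha hal hlb hm (-θ) (x := -x) (by linarith)
    have e1 : upLoss (-θ) a (-x) = upLoss θ a x := by
      unfold upLoss
      rw [abs_neg, neg_sub_neg, ← neg_sub, neg_sq]
    have e2 : downLoss (-θ) m (-x) = downLoss θ m x := by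
      unfold downLoss
      rw [abs_neg, neg_sq]
    have e3 : ∀ u : ℝ, |(-u) - -θ| = |u - θ| := fun u => by
      rw [neg_sub_neg, ← neg_sub, abs_neg]
    rwa [e1, e2, soft_neg, neg_neg, e3, e3] at h

lemma sq_loss_le (ht : IsSmoothThreshold κ₀ κ₁ t) (hκ : κ₀ < 2)
    {a b l m ε : ℝ} (ha : 0 ≤ a) (hal : a ≤ l) (hlb : l ≤ b) (hm : 0 ≤ m) (hε : 0 < ε)
    (θ x : ℝ) :
    (t l x - θ) ^ 2 ≤ (1 + ε) * (soft m x - θ) ^ 2 +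
      (1 + 1 / ε) * (upLoss θ a x + min (downLoss θ m x) ((max (b - m) 0) ^ 2)) := by
  have h := ht.sq_excess_loss_le hκ ha hal hlb hm θ x
  set w := max (|t l x - θ| - |soft m x - θ|) 0 with hw
  have hw1 : |t l x - θ| ≤ |soft m x - θ| + w := by
    have := le_max_left (|t l x - θ| - |soft m x - θ|) 0
    linarith
  have h2 : (t l x - θ) ^ 2 ≤ (|soft m x - θ| + w) ^ 2 := by
    rw [← sq_abs (t l x - θ)]
    gcongr
  have h3 : (|soft m x - θ| + w) ^ 2 ≤ (1 + ε) * (soft m x - θ) ^ 2 + (1 + 1 / ε) * w ^ 2 := by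
    rw [← sq_abs (soft m x - θ)]
    have h4 : 0 ≤ (ε * |soft m x - θ| - w) ^ 2 / ε := by positivity
    have h5 : (ε * |soft m x - θ| - w) ^ 2 / ε =
      ε * |soft m x - θ| ^ 2 - 2 * |soft m x - θ| * w + 1 / ε * w ^ 2 := by
      field_simp
      ring
    linarith
  refine h2.trans (h3.trans ?_)
  gcongr

/-- Joint continuity makes the estimator with a random level measurable. The level is truncated at
zero since nothing is assumed about `t` at negative levels. -/
lemma continuous_uncurry (ht : IsSmoothThreshold κ₀ κ₁ t) :
    Continuous fun p : ℝ × ℝ => t (max p.1 0) p.2 := by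
  have hx : ∀ l x y : ℝ, 0 ≤ l → |t l x - t l y| ≤ |κ₀| * |x - y| := by
    intro l x y hl
    rcases lt_trichotomy x y with h | h | h
    · obtain ⟨h1, h2⟩ := ht.smooth_x l x y hl h
      rw [abs_sub_comm, abs_of_nonneg h1, abs_sub_comm, abs_of_pos (sub_pos.2 h)]
      refine h2.trans ?_
      gcongr
      exact le_abs_self _
    · simp [h]
    · obtain ⟨h1, h2⟩ := ht.smooth_x l y x hl h
      rw [abs_of_nonneg h1, abs_of_pos (sub_pos.2 h)]
      refine h2.trans ?_
      gcongr
      exact le_abs_self _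
  have hdist : ∀ p q : ℝ × ℝ, |t (max p.1 0) p.2 - t (max q.1 0) q.2| ≤
      |κ₀| * |p.2 - q.2| + |κ₁| * |max p.1 0 - max q.1 0| := by
    intro p q
    have h1 := hx (max p.1 0) p.2 q.2 (le_max_right _ _)
    have h2 := ht.smooth_level (max p.1 0) (max q.1 0) q.2 (le_max_right _ _) (le_max_right _ _)
    have h3 : κ₁ * |max p.1 0 - max q.1 0| ≤ |κ₁| * |max p.1 0 - max q.1 0| := by
      gcongr
      exact le_abs_self _
    have := abs_sub_le (t (max p.1 0) p.2) (t (max p.1 0) q.2) (t (max q.1 0) q.2)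
    linarith
  rw [continuous_iff_continuousAt]
  intro q
  rw [ContinuousAt, tendsto_iff_dist_tendsto_zero]
  refine squeeze_zero (fun p => dist_nonneg) (fun p => hdist p q) ?_
  have hc : Continuous fun p : ℝ × ℝ =>
      |κ₀| * |p.2 - q.2| + |κ₁| * |max p.1 0 - max q.1 0| := by fun_prop
  have := hc.tendsto q
  simpa using this

end IsSmoothThreshold

/-! ### Product measure computations -/

instance {n : ℕ} (θ : Fin n → ℝ) : IsProbabilityMeasure (normalMeans θ) := by
  unfold normalMeans
  infer_instance

lemma integrable_coord {n : ℕ} (θ : Fin n → ℝ) (i : Fin n) {f : ℝ → ℝ}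
    (hf : Integrable f (gaussianReal (θ i) 1)) :
    Integrable (fun x : Fin n → ℝ => f (x i)) (normalMeans θ) :=
  integrable_comp_eval (μ := fun i => gaussianReal (θ i) 1) hf

lemma integral_coord {n : ℕ} (θ : Fin n → ℝ) (i : Fin n) {f : ℝ → ℝ}
    (hf : Integrable f (gaussianReal (θ i) 1)) :
    ∫ x : Fin n → ℝ, f (x i) ∂(normalMeans θ) = ∫ y, f y ∂(gaussianReal (θ i) 1) :=
  integral_comp_eval (μ := fun i => gaussianReal (θ i) 1) hf.aestronglyMeasurable

lemma integrable_soft_sub_sq {l : ℝ} (hl : 0 ≤ l) (μ : ℝ) :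
    Integrable (fun y => (soft l y - μ) ^ 2) (gaussianReal μ 1) := by
  have hm := measurable_soft l
  refine integrable_of_abs_le_sq (by fun_prop) (A := 2 * μ ^ 2) (B := 2) fun z => ?_
  rw [abs_of_nonneg (sq_nonneg _)]
  have h1 : soft l z ^ 2 ≤ z ^ 2 := sq_le_sq.2 (abs_soft_le hl z)
  nlinarith [sq_nonneg (soft l z + μ)]

lemma integral_soft_sub_sq (l μ : ℝ) :
    ∫ y, (soft l y - μ) ^ 2 ∂(gaussianReal μ 1) = softRisk μ l := by
  rw [integral_gaussian_shift]
  rfl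

lemma mse_soft_const {n : ℕ} (θ : Fin n → ℝ) {l : ℝ} (hl : 0 ≤ l) :
    mse θ (thresholdEst soft fun _ => l) = ∑ i, softRisk (θ i) l := by
  unfold mse sqLoss thresholdEst
  rw [integral_finsetSum _ fun i _ => integrable_coord θ i (integrable_soft_sub_sq hl (θ i))]
  refine Finset.sum_congr rfl fun i _ => ?_
  rw [integral_coord θ i (integrable_soft_sub_sq hl (θ i)), integral_soft_sub_sq]

/-- Exponential weight of an exceedance. -/
def expInd (s ξ y : ℝ) : ℝ := Set.indicator {y : ℝ | ξ ≤ |y|} (fun _ => Real.exp s - 1) y + 1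

lemma expInd_of_le {s ξ y : ℝ} (h : ξ ≤ |y|) : expInd s ξ y = Real.exp s := by
  simp [expInd, h]

lemma expInd_of_lt {s ξ y : ℝ} (h : ¬ ξ ≤ |y|) : expInd s ξ y = 1 := by
  simp [expInd, h]

lemma expInd_pos (s ξ y : ℝ) : 0 < expInd s ξ y := by
  by_cases h : ξ ≤ |y|
  · rw [expInd_of_le h]
    exact Real.exp_pos _
  · rw [expInd_of_lt h]
    exact one_pos

lemma integrable_expInd (μ s ξ : ℝ) : Integrable (expInd s ξ) (gaussianReal μ 1) :=
  ((integrable_const _).indicator (measurableSet_le_abs ξ)).add (integrable_const _)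

lemma integral_expInd (μ s ξ : ℝ) :
    ∫ y, expInd s ξ y ∂(gaussianReal μ 1) = 1 + (Real.exp s - 1) * pAbove μ ξ := by
  unfold expInd
  rw [integral_add ((integrable_const _).indicator (measurableSet_le_abs ξ)) (integrable_const _),
    integral_indicator (measurableSet_le_abs _), setIntegral_const]
  simp [pAbove]
  ring

lemma prod_expInd {n : ℕ} (s ξ : ℝ) (x : Fin n → ℝ) :
    ∏ j, expInd s ξ (x j) = Real.exp (s * countAbove x ξ) := by
  classical
  have h : ∀ j, expInd s ξ (x j) = if ξ ≤ |x j| then Real.exp s else 1 := by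
    intro j
    split_ifs with h
    · exact expInd_of_le h
    · exact expInd_of_lt h
  simp_rw [h]
  rw [Finset.prod_ite, Finset.prod_const, Finset.prod_const_one, mul_one, mul_comm,
    Real.exp_nat_mul,
    countAbove]

lemma integral_expInd_nonneg (μ s ξ : ℝ) : 0 ≤ ∫ y, expInd s ξ y ∂(gaussianReal μ 1) :=
  integral_nonneg fun y => (expInd_pos s ξ y).le

lemma integral_expInd_le (μ s ξ : ℝ) :
    ∫ y, expInd s ξ y ∂(gaussianReal μ 1) ≤ Real.exp ((Real.exp s - 1) * pAbove μ ξ) := by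
  rw [integral_expInd, add_comm]
  exact Real.add_one_le_exp _

/-- A Chernoff bound for the lower tail of the number of exceedances, in the form of an
integrable majorant of the indicator. -/
lemma exists_majorant_countAbove_le {n : ℕ} (θ : Fin n → ℝ) (ξ : ℝ) (k : ℕ) :
    ∃ H : (Fin n → ℝ) → ℝ, Integrable H (normalMeans θ) ∧ (∀ x, 0 ≤ H x) ∧
      (∀ x, countAbove x ξ < k + 1 → 1 ≤ H x) ∧
      ∫ x, H x ∂(normalMeans θ) ≤
        Real.exp (k - (1 - Real.exp (-1)) * ∑ j, pAbove (θ j) ξ) := by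
  -- The exponential moment is taken at the fixed parameter `-1`; the product equals `exp(-N(ξ))`,
  -- which independence factorizes.
  refine ⟨fun x => Real.exp k * ∏ j, expInd (-1) ξ (x j), ?_, ?_, ?_, ?_⟩
  · refine Integrable.const_mul ?_ _
    exact Integrable.fintype_prod (μ := fun j => gaussianReal (θ j) 1)
      fun j => integrable_expInd (θ j) (-1) ξ
  · intro x
    have : 0 ≤ ∏ j, expInd (-1) ξ (x j) := Finset.prod_nonneg fun j _ => (expInd_pos _ _ _).le
    positivity
  · intro x hx
    beta_reduce
    rw [prod_expInd, ← Real.exp_add]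
    apply Real.one_le_exp
    have : (countAbove x ξ : ℝ) ≤ k := by exact_mod_cast Nat.lt_succ_iff.1 hx
    linarith
  · rw [integral_const_mul]
    have h1 : ∫ x : Fin n → ℝ, ∏ j, expInd (-1) ξ (x j) ∂(normalMeans θ) =
        ∏ j, ∫ y, expInd (-1) ξ y ∂(gaussianReal (θ j) 1) :=
      integral_fintype_prod_eq_prod (μ := fun j => gaussianReal (θ j) 1) (𝕜 := ℝ)
        (fun _ => expInd (-1) ξ)
    rw [h1, sub_eq_add_neg, Real.exp_add]
    gcongr
    calc _ ≤ ∏ j, Real.exp ((Real.exp (-1) - 1) * pAbove (θ j) ξ) :=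
          Finset.prod_le_prod (fun j _ => integral_expInd_nonneg _ _ _)
            fun j _ => integral_expInd_le _ _ _
      _ = _ := by
          rw [← Real.exp_sum, ← Finset.mul_sum]
          congr 1
          ring

/-- A leave-one-out Chernoff bound for the upper tail of the number of exceedances, in the form
of an integrable majorant. -/
lemma exists_majorant_le_countAbove {n : ℕ} (θ : Fin n → ℝ) (ξ : ℝ) (k : ℕ) (i : Fin n)
    {s : ℝ} (hs : 0 ≤ s) {F : ℝ → ℝ} (hF : Integrable F (gaussianReal (θ i) 1))
    (hF0 : ∀ y, 0 ≤ F y) :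
    ∃ H : (Fin n → ℝ) → ℝ, Integrable H (normalMeans θ) ∧ (∀ x, 0 ≤ H x) ∧
      (∀ x, k ≤ countAbove x ξ → F (x i) ≤ H x) ∧
      ∫ x, H x ∂(normalMeans θ) ≤ (∫ y, F y ∂(gaussianReal (θ i) 1)) *
        Real.exp (s - s * k + (Real.exp s - 1) * ∑ j, pAbove (θ j) ξ) := by
  classical
  -- The coordinate `i` carries `F` in place of its exponential weight, so the product decouples the
  -- loss from the count. The weight left out is at most `exp s`, which accounts for the additional
  -- `s` in the exponent.
  set G : Fin n → ℝ → ℝ := fun j => if j = i then F else expInd s ξ with hG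
  have hGi : G i = F := by simp [hG]
  have hGj : ∀ j ∈ Finset.univ.erase i, G j = expInd s ξ := fun j hj => by
    simp [hG, Finset.ne_of_mem_erase hj]
  have hsplit : ∀ x : Fin n → ℝ, ∏ j, G j (x j) =
      F (x i) * ∏ j ∈ Finset.univ.erase i, expInd s ξ (x j) := by
    intro x
    rw [← Finset.mul_prod_erase _ _ (Finset.mem_univ i), hGi]
    congr 1
    exact Finset.prod_congr rfl fun j hj => by rw [hGj j hj]
  have hpos : ∀ x : Fin n → ℝ, 0 < ∏ j ∈ Finset.univ.erase i, expInd s ξ (x j) := fun x =>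
    Finset.prod_pos fun j _ => expInd_pos _ _ _
  refine ⟨fun x => Real.exp (s - s * k) * ∏ j, G j (x j), ?_, ?_, ?_, ?_⟩
  · refine Integrable.const_mul ?_ _
    refine Integrable.fintype_prod (μ := fun j => gaussianReal (θ j) 1) fun j => ?_
    by_cases hj : j = i
    · subst hj
      rw [hGi]
      exact hF
    · simp only [hG, if_neg hj]
      exact integrable_expInd _ _ _
  · intro x
    beta_reduce
    rw [hsplit]
    have := hpos x
    have := hF0 (x i)
    positivity
  · intro x hx
    beta_reduce
    rw [hsplit]
    have h1 : Real.exp (s * k) ≤ Real.exp s * ∏ j ∈ Finset.univ.erase i, expInd s ξ (x j) := by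
      have h2 : Real.exp (s * k) ≤ ∏ j, expInd s ξ (x j) := by
        rw [prod_expInd]
        gcongr
      rw [← Finset.mul_prod_erase _ _ (Finset.mem_univ i)] at h2
      refine h2.trans (mul_le_mul_of_nonneg_right ?_ (hpos x).le)
      by_cases h : ξ ≤ |x i|
      · rw [expInd_of_le h]
      · rw [expInd_of_lt h]
        exact Real.one_le_exp hs
    have h3 : 1 ≤ Real.exp (s - s * k) * ∏ j ∈ Finset.univ.erase i, expInd s ξ (x j) := by
      rw [Real.exp_sub, div_mul_eq_mul_div, one_le_div (Real.exp_pos _)]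
      exact h1
    calc F (x i) = F (x i) * 1 := (mul_one _).symm
      _ ≤ F (x i) * (Real.exp (s - s * k) *
          ∏ j ∈ Finset.univ.erase i, expInd s ξ (x j)) := by
        gcongr
        exact hF0 _
      _ = _ := by ring
  · rw [integral_const_mul]
    have h1 : ∫ x : Fin n → ℝ, ∏ j, G j (x j) ∂(normalMeans θ) =
        ∏ j, ∫ y, G j y ∂(gaussianReal (θ j) 1) :=
      integral_fintype_prod_eq_prod (μ := fun j => gaussianReal (θ j) 1) (𝕜 := ℝ) G
    have hes : 0 ≤ Real.exp s - 1 := by linarith [Real.one_le_exp hs]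
    have h2 : ∏ j ∈ Finset.univ.erase i, ∫ y, G j y ∂(gaussianReal (θ j) 1) ≤
        Real.exp ((Real.exp s - 1) * ∑ j, pAbove (θ j) ξ) := by
      calc _ = ∏ j ∈ Finset.univ.erase i, ∫ y, expInd s ξ y ∂(gaussianReal (θ j) 1) :=
            Finset.prod_congr rfl fun j hj => by rw [hGj j hj]
        _ ≤ ∏ j ∈ Finset.univ.erase i, Real.exp ((Real.exp s - 1) * pAbove (θ j) ξ) :=
          Finset.prod_le_prod (fun j _ => integral_expInd_nonneg _ _ _)
            fun j _ => integral_expInd_le _ _ _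
        _ = Real.exp ((Real.exp s - 1) * ∑ j ∈ Finset.univ.erase i, pAbove (θ j) ξ) := by
          rw [← Real.exp_sum, ← Finset.mul_sum]
        _ ≤ _ := by
          exact Real.exp_le_exp.2 (mul_le_mul_of_nonneg_left
            (Finset.sum_le_sum_of_subset_of_nonneg (Finset.subset_univ _)
              fun j _ _ => pAbove_nonneg _ _) hes)
    have hFi : 0 ≤ ∫ y, F y ∂(gaussianReal (θ i) 1) := integral_nonneg hF0
    rw [h1, ← Finset.mul_prod_erase _ _ (Finset.mem_univ i), hGi, Real.exp_add]
    calc _ ≤ Real.exp (s - s * k) * ((∫ y, F y ∂(gaussianReal (θ i) 1)) *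
          Real.exp ((Real.exp s - 1) * ∑ j, pAbove (θ j) ξ)) := by gcongr
      _ = _ := by ring

/-! ### The loss from overestimating the level -/

lemma exists_sum_pow_mul_exp_le (b : ℕ) {c : ℝ} (hc : 0 < c) : ∃ C : ℝ, 0 < C ∧
    ∀ s : Finset ℕ, ∑ k ∈ s, (k : ℝ) ^ b * Real.exp (-(c * k)) ≤ C := by
  have h := Real.summable_pow_mul_exp_neg_nat_mul b hc
  have h0 : 0 ≤ ∑' k : ℕ, (k : ℝ) ^ b * Real.exp (-c * k) :=
    tsum_nonneg fun k => by positivity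
  refine ⟨(∑' k : ℕ, (k : ℝ) ^ b * Real.exp (-c * k)) + 1, by positivity, fun s => ?_⟩
  have := h.sum_le_tsum s fun k _ => by positivity
  simp only [neg_mul] at this ⊢
  linarith

lemma add_three_sq_mul_exp_le {d y : ℝ} (hd : 1 ≤ d) (hy : 0 ≤ y) :
    (y + 3) ^ 2 * Real.exp (-(d * y)) ≤ 36 := by
  have h1 : Real.exp (-(d * y)) ≤ Real.exp (-y) := Real.exp_le_exp.2 (by nlinarith)
  have h2 := Real.add_one_le_exp (y / 2)
  have h3 : (1 + y / 2) ^ 2 ≤ Real.exp y := by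
    calc (1 + y / 2) ^ 2 ≤ Real.exp (y / 2) ^ 2 := by gcongr; linarith
      _ = Real.exp y := by rw [← Real.exp_nat_mul]; congr 1; push_cast; ring
  calc (y + 3) ^ 2 * Real.exp (-(d * y)) ≤ (y + 3) ^ 2 * Real.exp (-y) := by gcongr
    _ ≤ 36 * Real.exp y * Real.exp (-y) := by gcongr; nlinarith
    _ = 36 := by rw [mul_assoc, ← Real.exp_add]; simp

/-- Moving from `l` to `l + 1` gains a factor `exp(-l)`, which pays for the three powers of `1 + l`
in the null risk and the two additional ones. This is the purpose of the margin 1 in the definition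
of far means. -/
lemma exists_exp_le_softRisk : ∃ C : ℝ, 0 < C ∧ ∀ l : ℝ, 0 ≤ l →
    Real.exp (-(l + 1) ^ 2 / 2) ≤ C * (softRisk 0 l / (1 + l) ^ 2) := by
  obtain ⟨c, hc, h⟩ := le_softRisk_zero
  obtain ⟨C, hC, h2⟩ := exists_pow_mul_exp_le 5 (c := 1) one_pos
  refine ⟨C / c, by positivity, fun l hl => ?_⟩
  have h3 := h l hl
  have h4 := h2 l hl
  have h5 : Real.exp (-(l + 1) ^ 2 / 2) ≤ Real.exp (-l ^ 2 / 2) * Real.exp (-(1 * l)) := by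
    rw [← Real.exp_add]
    apply Real.exp_le_exp.2
    linarith
  have hl1 : 0 < (1 + l) ^ 5 := by positivity
  calc Real.exp (-(l + 1) ^ 2 / 2) ≤ Real.exp (-l ^ 2 / 2) * Real.exp (-(1 * l)) := h5
    _ ≤ Real.exp (-l ^ 2 / 2) * (C / (1 + l) ^ 5) := by
        gcongr
        rw [le_div_iff₀ hl1]
        linarith
    _ = C / c * (c * Real.exp (-l ^ 2 / 2) / (1 + l) ^ 3 / (1 + l) ^ 2) := by
        field_simp
    _ ≤ _ := by gcongr

/-- Lowering the level by 2 at least doubles the tail probability, whereas passing from `k` to `k +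
1` multiplies it by `(k+1)/k ≤ 2`. -/
lemma xi_sub_two_le {α : ℝ} (h0 : 0 < α) (h1 : α < 1) {n k : ℕ} (hn : 1 ≤ n) (hk : 1 ≤ k)
    (hkn : k ≤ n) (hξ : 2 < xi α n k) : xi α n k - 2 ≤ xi α n (k + 1) := by
  set y := xi α n k - 2 with hy
  have h := Phi_neg_add_le y (d := 2) (by norm_num)
  rw [show y + 2 = xi α n k by rw [hy]; ring] at h
  have he : Real.exp (-(2 * y) - 2 ^ 2 / 2) ≤ 1 / 2 := by
    have h2 : Real.exp (-(2 * y) - 2 ^ 2 / 2) ≤ Real.exp (-1) := by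
      apply Real.exp_le_exp.2
      have : 0 < y := by rw [hy]; linarith
      linarith
    have h3 : Real.exp (-1) ≤ 1 / 2 := by
      rw [Real.exp_neg, ← one_div]
      exact one_div_le_one_div_of_le two_pos (by have := Real.add_one_le_exp (1 : ℝ); linarith)
    linarith
  have hP := Phi_pos (-y)
  have h4 : 2 * Phi (-xi α n k) ≤ Phi (-y) := by nlinarith
  rw [← Phi_neg_le_iff]
  refine le_trans ?_ h4
  rw [Phi_neg_xi h0 h1 hn hk (by omega), Phi_neg_xi h0 h1 hn (by omega) (by omega)]
  have hn' : (0 : ℝ) < n := by exact_mod_cast hn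
  have hk' : (1 : ℝ) ≤ k := by exact_mod_cast hk
  rw [mul_div_assoc']
  refine div_le_div_of_nonneg_right ?_ (by positivity)
  push_cast
  nlinarith

/-- The number of means exceeding `t` in absolute value. -/
def farCount {n : ℕ} (θ : Fin n → ℝ) (t : ℝ) : ℕ := (Finset.univ.filter fun i => t < |θ i|).card

lemma farCount_mul_le_sum {n : ℕ} (θ : Fin n → ℝ) (t ξ : ℝ) :
    farCount θ t * Phi (-(ξ - t)) ≤ ∑ i, pAbove (θ i) ξ := by
  rw [farCount, ← nsmul_eq_mul]
  refine (Finset.card_nsmul_le_sum _ (fun i => pAbove (θ i) ξ) _ fun i hi => ?_).trans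
    (Finset.sum_le_sum_of_subset_of_nonneg (Finset.subset_univ _) fun j _ _ => pAbove_nonneg _ _)
  refine le_trans (Phi_mono ?_) (le_pAbove (θ i) ξ)
  have := (Finset.mem_filter.1 hi).2
  linarith

lemma one_sub_exp_neg_one : (0.6 : ℝ) ≤ 1 - Real.exp (-1) := by
  have h2 : Real.exp (-1) ≤ 0.4 := by
    rw [Real.exp_neg, inv_le_comm₀ (Real.exp_pos _) (by norm_num)]
    have := Real.exp_one_gt_d9
    norm_num
    linarith
  linarith

/-- Let `m` be the number of far means and `p k` the least probability with which each of them
exceeds `ξ_{k+1}`. For `ξ_k` within 3 of `l` the contribution is at most `9m`. Otherwise, if `m p k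
< 4(k+1)`, the tail comparison `key` bounds `m (ξ_k - l)²` deterministically; if not, having fewer
than `k + 1` exceedances has a Chernoff probability summable over `k`. -/
lemma exists_majorant_xiHat2 {α' : ℝ} (hα' : 0 < α') : ∃ C : ℝ, 0 < C ∧
    ∀ (α : ℝ) (n : ℕ) (θ : Fin n → ℝ) (l : ℝ), α' ≤ α → α < 1 → 1 ≤ n → 0 ≤ l →
    ∃ H : (Fin n → ℝ) → ℝ, Integrable H (normalMeans θ) ∧
      (∀ x, farCount θ (l + 1) * (max (xiHat2 α x - l) 0) ^ 2 ≤ H x) ∧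
      ∫ x, H x ∂(normalMeans θ) ≤
        C * (farCount θ (l + 1) + n * softRisk 0 l / (1 + l) ^ 2) := by
  classical
  obtain ⟨C₁, hC₁, h₁⟩ := exists_exp_le_softRisk
  obtain ⟨C₂, hC₂, h₂⟩ := exists_sum_pow_mul_exp_le 0 (c := 0.2) (by norm_num)
  refine ⟨9 + (288 + 144 * C₂) / α' * C₁, by positivity, fun α n θ l hα hα1 hn hl => ?_⟩
  have hα0 : 0 < α := hα'.trans_le hα
  have hn' : (1 : ℝ) ≤ n := by exact_mod_cast hn
  set m : ℝ := ((farCount θ (l + 1) : ℕ) : ℝ) with hm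
  have hm0 : 0 ≤ m := Nat.cast_nonneg _
  set E := Real.exp (-(l + 1) ^ 2 / 2) with hE
  have hE0 : 0 < E := Real.exp_pos _
  set p : ℕ → ℝ := fun k => Phi (-(xi α n (k + 1) - (l + 1))) with hp
  have hp0 : ∀ k, 0 < p k := fun k => Phi_pos _
  set v : ℕ → ℝ := fun k => (xi α n k - l) ^ 2 with hv
  have hv0 : ∀ k, 0 ≤ v k := fun k => sq_nonneg _
  -- With `y = ξ_{k+1} - (l+1) ≥ 0`, the null tail `α(k+1)/(2n)` at `ξ_{k+1}` is at most `E
  -- exp(-(l+1)y) p k`, and the exponential absorbs `(ξ_k - l)² ≤ (y+3)²`.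
  have key : ∀ k, 1 ≤ k → k ≤ n → l + 3 < xi α n k →
      v k * (α * (k + 1) / (2 * n)) ≤ 36 * E * p k := by
    intro k hk hkn hξ
    have hgap := xi_sub_two_le hα0 hα1 hn hk hkn (by linarith)
    set y := xi α n (k + 1) - (l + 1) with hy
    have hy0 : 0 ≤ y := by rw [hy]; linarith
    have h3 := Phi_neg_add_le y (d := l + 1) (by linarith)
    rw [show y + (l + 1) = xi α n (k + 1) by rw [hy]; ring,
      Phi_neg_xi hα0 hα1 hn (by omega) (by omega)] at h3
    push_cast at h3
    have h4 : v k ≤ (y + 3) ^ 2 := by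
      simp only [hv]
      gcongr
      · linarith
      · rw [hy]; linarith
    have h5 := add_three_sq_mul_exp_le (d := l + 1) (by linarith) hy0
    have h6 : Real.exp (-((l + 1) * y) - (l + 1) ^ 2 / 2) = Real.exp (-((l + 1) * y)) * E := by
      rw [hE, ← Real.exp_add]
      congr 1
      ring
    rw [h6] at h3
    have hpk : p k = Phi (-y) := rfl
    rw [hpk]
    have hP := Phi_pos (-y)
    calc v k * (α * (k + 1) / (2 * n)) ≤
          (y + 3) ^ 2 * (Real.exp (-((l + 1) * y)) * E * Phi (-y)) := by gcongr
      _ = (y + 3) ^ 2 * Real.exp (-((l + 1) * y)) * (E * Phi (-y)) := by ring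
      _ ≤ 36 * (E * Phi (-y)) := by gcongr
      _ = _ := by ring
  choose H hHi hH0 hH1 hHint using fun k => exists_majorant_countAbove_le θ (xi α n (k + 1)) k
  set w : ℕ → ℝ := fun k =>
    if l + 3 < xi α n k ∧ 4 * (k + 1) ≤ m * p k then m * v k else 0 with hw
  have hw0 : ∀ k, 0 ≤ w k := by
    intro k
    simp only [hw]
    split_ifs
    · exact mul_nonneg hm0 (hv0 k)
    · exact le_rfl
  have hsum0 : ∀ x, 0 ≤ ∑ k ∈ Finset.Icc 1 n, w k * H k x := fun x =>
    Finset.sum_nonneg fun k _ => mul_nonneg (hw0 k) (hH0 k x)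
  have hA0 : 0 ≤ 288 * n * E / α := by positivity
  have hsumi : Integrable (fun x => ∑ k ∈ Finset.Icc 1 n, w k * H k x) (normalMeans θ) :=
    integrable_finsetSum _ fun k _ => (hHi k).const_mul _
  refine ⟨fun x => (9 * m + 288 * n * E / α) + ∑ k ∈ Finset.Icc 1 n, w k * H k x,
    (integrable_const _).add hsumi, ?_, ?_⟩
  · intro x
    obtain ⟨k, hk, hkn, hcount, hξ⟩ := exists_xiHat2_eq α hn x
    have hs0 := hsum0 x
    rw [hξ]
    rcases le_or_gt (xi α n k) (l + 3) with hle | hgt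
    · have : (max (xi α n k - l) 0) ^ 2 ≤ 3 ^ 2 := by
        gcongr
        exact max_le (by linarith) (by norm_num)
      nlinarith
    · have hmax : max (xi α n k - l) 0 = xi α n k - l := max_eq_left (by linarith)
      rw [hmax]
      by_cases hc : 4 * (k + 1) ≤ m * p k
      · have h3 : m * v k * H k x ≤ ∑ k ∈ Finset.Icc 1 n, w k * H k x := by
          have h4 : w k = m * v k := by simp only [hw]; rw [if_pos ⟨hgt, hc⟩]
          rw [← h4]
          exact Finset.single_le_sum (f := fun k => w k * H k x)
            (fun j _ => mul_nonneg (hw0 j) (hH0 j x)) (Finset.mem_Icc.2 ⟨hk, hkn⟩)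
        have h4 := hH1 k x hcount
        have h5 : m * v k * 1 ≤ m * v k * H k x := by
          have := hv0 k
          gcongr
        have h6 : v k = (xi α n k - l) ^ 2 := rfl
        rw [← h6]
        linarith
      · push Not at hc
        have h3 := key k hk hkn hgt
        have h6 : v k = (xi α n k - l) ^ 2 := rfl
        rw [← h6]
        have h7 : m * v k ≤ 288 * n * E / α := by
          rw [le_div_iff₀ hα0]
          have hk1 : (0 : ℝ) < k + 1 := by positivity
          have h8 : v k * α * (k + 1) ≤ 72 * n * E * p k := by
            rw [mul_div_assoc', div_le_iff₀ (by positivity)] at h3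
            linarith
          have h9 : m * v k * α * (k + 1) ≤ 288 * n * E * (k + 1) := by
            calc m * v k * α * (k + 1) = m * (v k * α * (k + 1)) := by ring
              _ ≤ m * (72 * n * E * p k) := by gcongr
              _ = 72 * n * E * (m * p k) := by ring
              _ ≤ 72 * n * E * (4 * (k + 1)) := by gcongr
              _ = _ := by ring
          exact le_of_mul_le_mul_right h9 hk1
        linarith
  · rw [integral_add (integrable_const _) hsumi,
      integral_finsetSum _ fun k _ => (hHi k).const_mul _]
    simp only [integral_const_mul, integral_const, probReal_univ, one_smul]
    have hterm : ∀ k ∈ Finset.Icc 1 n, w k * ∫ x, H k x ∂(normalMeans θ) ≤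
        144 * n * E / α * ((k : ℝ) ^ 0 * Real.exp (-(0.2 * k))) := by
      intro k hk
      obtain ⟨hk, hkn⟩ := Finset.mem_Icc.1 hk
      simp only [hw]
      split_ifs with hc
      · obtain ⟨hgt, hc⟩ := hc
        have h3 := key k hk hkn hgt
        have hk1 : (1 : ℝ) ≤ k := by exact_mod_cast hk
        have hmp : 0 < m * p k := by linarith
        have hmpos : 0 < m := by
          rcases hm0.eq_or_lt with h | h
          · rw [← h] at hmp; simp at hmp
          · exact h
        -- The Chernoff exponent is at most `k - 0.6 m p k`, and `4(k+1) ≤ m p k` turns it into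
        -- `-0.2 k - 0.3 m p k`. The second part is spent on the factor `1/(m p k)` that cancels `m`
        -- and `p k`; the first makes the sum over `k` converge.
        have h4 : ∫ x, H k x ∂(normalMeans θ) ≤ Real.exp (-(0.2 * k)) * (4 / (m * p k)) := by
          refine (hHint k).trans ?_
          have h5 := farCount_mul_le_sum θ (l + 1) (xi α n (k + 1))
          have h6 : m * p k ≤ ∑ j, pAbove (θ j) (xi α n (k + 1)) := h5
          have h7 := one_sub_exp_neg_one
          have h8 : Real.exp (k - (1 - Real.exp (-1)) * ∑ j, pAbove (θ j) (xi α n (k + 1))) ≤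
              Real.exp (-(0.2 * k)) * Real.exp (-(0.3 * (m * p k))) := by
            rw [← Real.exp_add]
            apply Real.exp_le_exp.2
            have h9 : 0.6 * (m * p k) ≤
              (1 - Real.exp (-1)) * ∑ j, pAbove (θ j) (xi α n (k + 1)) := by gcongr
            linarith
          refine h8.trans ?_
          gcongr
          rw [Real.exp_neg, inv_le_comm₀ (Real.exp_pos _) (by positivity), inv_div]
          have := Real.add_one_le_exp (0.3 * (m * p k))
          linarith
        have hpk := hp0 k
        have hvk := hv0 k
        calc m * v k * ∫ x, H k x ∂(normalMeans θ)
            ≤ m * v k * (Real.exp (-(0.2 * k)) * (4 / (m * p k))) := by gcongr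
          _ = 4 * (v k / p k) * Real.exp (-(0.2 * k)) := by field_simp
          _ ≤ 4 * (36 * n * E / α) * Real.exp (-(0.2 * k)) := by
              have h5 : v k / p k ≤ 36 * n * E / α := by
                rw [div_le_div_iff₀ hpk hα0]
                rw [mul_div_assoc', div_le_iff₀ (by positivity)] at h3
                have : v k * (α * (1 + 1)) ≤ v k * (α * (k + 1)) := by gcongr
                linarith
              exact mul_le_mul_of_nonneg_right (mul_le_mul_of_nonneg_left h5 (by norm_num))
                (Real.exp_pos _).le
          _ = _ := by ring
      · rw [zero_mul]
        positivity
    have h3 := (Finset.sum_le_sum hterm)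
    rw [← Finset.mul_sum] at h3
    have h4 := h₂ (Finset.Icc 1 n)
    have h5 : 144 * n * E / α * ∑ k ∈ Finset.Icc 1 n, ((k : ℝ) ^ 0 * Real.exp (-(0.2 * k))) ≤
        144 * n * E / α * C₂ := by gcongr
    have h6 := h₁ l hl
    have h7 : (288 * n * E / α + 144 * n * E / α * C₂) ≤
        (288 + 144 * C₂) / α' * C₁ * (n * softRisk 0 l / (1 + l) ^ 2) := by
      calc (288 * n * E / α + 144 * n * E / α * C₂) = (288 + 144 * C₂) / α * n * E := by ring
        _ ≤ (288 + 144 * C₂) / α' * n * (C₁ * (softRisk 0 l / (1 + l) ^ 2)) := by gcongr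
        _ = _ := by ring
    have h8 : 0 ≤ n * softRisk 0 l / (1 + l) ^ 2 := by
      have := softRisk_zero_pos hl
      positivity
    have h9 : 0 ≤ (288 + 144 * C₂) / α' * C₁ := by positivity
    nlinarith

lemma one_add_sq_le_refRisk : ∃ C : ℝ, 0 < C ∧ ∀ l θ : ℝ, 0 ≤ l → l ≤ |θ| →
    (1 + l) ^ 2 ≤ C * refRisk θ l := by
  have hs1 := softRisk_zero_pos (l := 1) zero_le_one
  set s := softRisk 0 1 with hs
  refine ⟨4 + 4 / s, by positivity, fun l θ hl hθ => ?_⟩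
  have hsl := softRisk_zero_pos hl
  have hmin : min (θ ^ 2) (l ^ 2) = l ^ 2 := by
    refine min_eq_right ?_
    rw [← sq_abs θ]
    gcongr
  rw [refRisk, hmin]
  have h4s : 0 < 4 / s := by positivity
  rcases le_total l 1 with h | h
  · have h2 := softRisk_zero_anti hl h
    have h3 : 4 ≤ 4 / s * softRisk 0 l := by
      rw [div_mul_eq_mul_div, le_div_iff₀ hs1]
      linarith
    have h5 : (1 + l) ^ 2 ≤ 4 := by nlinarith
    have : 0 ≤ 4 / s * l ^ 2 := by positivity
    nlinarith
  · have h5 : (1 + l) ^ 2 ≤ 4 * l ^ 2 := by nlinarith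
    have : 0 ≤ 4 / s * (l ^ 2 + softRisk 0 l) := by positivity
    nlinarith

lemma sq_pos_part_sqrt_mul_sub_le {δ ξ l : ℝ} (hδ : 0 ≤ δ) (hl : 0 ≤ l) :
    (max (√(1 + δ) * ξ - l) 0) ^ 2 ≤ 4 * δ * l ^ 2 + (4 * δ + 2) * (max (ξ - l) 0) ^ 2 := by
  set e := max (ξ - l) 0 with he
  have he0 : 0 ≤ e := le_max_right _ _
  have he1 : ξ - l ≤ e := le_max_left _ _
  set r := √(1 + δ) with hr
  have hr1 : 1 ≤ r := Real.one_le_sqrt.2 (by linarith)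
  have hr2 : r ^ 2 = 1 + δ := Real.sq_sqrt (by linarith)
  have hr3 : (r - 1) ^ 2 ≤ δ := by nlinarith
  have h1 : max (r * ξ - l) 0 ≤ (r - 1) * (l + e) + e := by
    refine max_le ?_ (by nlinarith)
    nlinarith
  have h2 : (max (r * ξ - l) 0) ^ 2 ≤ ((r - 1) * (l + e) + e) ^ 2 := by
    gcongr
  have h3 : ((r - 1) * (l + e) + e) ^ 2 ≤ 2 * ((r - 1) ^ 2 * (l + e) ^ 2) + 2 * e ^ 2 := by
    nlinarith [sq_nonneg ((r - 1) * (l + e) - e)]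
  have h4 : (r - 1) ^ 2 * (l + e) ^ 2 ≤ δ * (2 * l ^ 2 + 2 * e ^ 2) := by
    gcongr
    nlinarith [sq_nonneg (l - e)]
  linarith

/-- Near means use the first entry of the minimum and their individual bounds. Far means use the
second, which does not depend on the coordinate, and each has reference risk of order at least
`(1+l)²`, so their number is at most a multiple of `S/(1+l)²`. -/
lemma exists_majorant_downLoss {α' : ℝ} (hα' : 0 < α') : ∃ C : ℝ, 0 < C ∧
    ∀ (α : ℝ) (n : ℕ) (θ : Fin n → ℝ) (l δ : ℝ), α' ≤ α → α < 1 → 1 ≤ n → 0 ≤ l → 0 ≤ δ →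
    ∃ H : (Fin n → ℝ) → ℝ, Integrable H (normalMeans θ) ∧
      (∀ x, ∑ i, min (downLoss (θ i) l (x i)) ((max (√(1 + δ) * xiHat2 α x - l) 0) ^ 2) ≤ H x) ∧
      ∫ x, H x ∂(normalMeans θ) ≤ C * ((δ + 1 / (1 + l) ^ 2) * ∑ i, refRisk (θ i) l) := by
  classical
  obtain ⟨C₁, hC₁, h₁⟩ := exists_majorant_xiHat2 hα'
  obtain ⟨C₂, hC₂, h₂⟩ := exists_integral_downLoss_le
  obtain ⟨C₃, hC₃, h₃⟩ := one_add_sq_le_refRisk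
  refine ⟨C₂ + 4 * C₃ + 4 * C₁ * (C₃ + 1), by positivity, fun α n θ l δ hα hα1 hn hl hδ => ?_⟩
  obtain ⟨H, hHi, hHle, hHint⟩ := h₁ α n θ l hα hα1 hn hl
  set m : ℝ := ((farCount θ (l + 1) : ℕ) : ℝ) with hm
  have hm0 : 0 ≤ m := Nat.cast_nonneg _
  set S := ∑ i, refRisk (θ i) l with hS
  have hr0 : ∀ i, 0 ≤ refRisk (θ i) l := fun i => (refRisk_pos hl _).le
  have hS0 : 0 ≤ S := Finset.sum_nonneg fun i _ => hr0 i
  set near := Finset.univ.filter fun i => ¬ l + 1 < |θ i| with hnear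
  have hdi : Integrable (fun x : Fin n → ℝ => ∑ i ∈ near, downLoss (θ i) l (x i))
      (normalMeans θ) :=
    integrable_finsetSum _ fun i _ => integrable_coord θ i (integrable_downLoss (θ i) l)
  have hci : Integrable (fun x => m * (4 * δ * l ^ 2) + (4 * δ + 2) * H x) (normalMeans θ) :=
    (integrable_const _).add (hHi.const_mul _)
  refine ⟨fun x => ∑ i ∈ near, downLoss (θ i) l (x i) + (m * (4 * δ * l ^ 2) + (4 * δ + 2) * H x),
    hdi.add hci, ?_, ?_⟩
  · intro x
    rw [← Finset.sum_filter_not_add_sum_filter _ (fun i => l + 1 < |θ i|)]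
    refine add_le_add (Finset.sum_le_sum fun i _ => min_le_left _ _) ?_
    have h4 := sq_pos_part_sqrt_mul_sub_le (ξ := xiHat2 α x) hδ hl
    have h5 : ∑ i ∈ Finset.univ.filter (fun i => l + 1 < |θ i|),
        min (downLoss (θ i) l (x i)) ((max (√(1 + δ) * xiHat2 α x - l) 0) ^ 2) ≤
        m * (max (√(1 + δ) * xiHat2 α x - l) 0) ^ 2 := by
      rw [hm, farCount, ← nsmul_eq_mul]
      exact Finset.sum_le_card_nsmul _ _ _ fun i _ => min_le_right _ _
    have h6 := hHle x
    calc _ ≤ m * (max (√(1 + δ) * xiHat2 α x - l) 0) ^ 2 := h5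
      _ ≤ m * (4 * δ * l ^ 2 + (4 * δ + 2) * (max (xiHat2 α x - l) 0) ^ 2) := by gcongr
      _ = m * (4 * δ * l ^ 2) + (4 * δ + 2) * (m * (max (xiHat2 α x - l) 0) ^ 2) := by ring
      _ ≤ _ := by gcongr
  · rw [integral_add hdi hci,
      integral_add (integrable_const _) (hHi.const_mul _),
      integral_const_mul (4 * δ + 2) H,
      integral_finsetSum _ fun i _ => integrable_coord θ i (integrable_downLoss (θ i) l)]
    simp only [integral_const, probReal_univ, one_smul]
    set q := 1 / (1 + l) ^ 2 with hq
    have hq0 : 0 < q := by positivity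
    have hq1 : q ≤ 1 := by
      rw [hq, div_le_one (by positivity)]
      nlinarith
    have h4 : ∑ i ∈ near, ∫ x : Fin n → ℝ, downLoss (θ i) l (x i) ∂(normalMeans θ) ≤
        C₂ * (q * S) := by
      calc _ ≤ ∑ i ∈ near, C₂ * (q * refRisk (θ i) l) := by
            refine Finset.sum_le_sum fun i hi => ?_
            rw [integral_coord θ i (integrable_downLoss (θ i) l)]
            exact h₂ l (θ i) hl (not_lt.1 (Finset.mem_filter.1 hi).2)
        _ ≤ ∑ i, C₂ * (q * refRisk (θ i) l) :=
            Finset.sum_le_sum_of_subset_of_nonneg (Finset.subset_univ _) fun i _ _ => by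
              have := hr0 i
              positivity
        _ = C₂ * (q * S) := by rw [← Finset.mul_sum, ← Finset.mul_sum]
    have h5 : m * (1 + l) ^ 2 ≤ C₃ * S := by
      rw [hS, Finset.mul_sum, hm, farCount, ← nsmul_eq_mul]
      refine (Finset.card_nsmul_le_sum _ (fun i => C₃ * refRisk (θ i) l) _ fun i hi => ?_).trans
        (Finset.sum_le_sum_of_subset_of_nonneg (Finset.subset_univ _) fun j _ _ => ?_)
      · have := (Finset.mem_filter.1 hi).2
        exact h₃ l (θ i) hl (by linarith)
      · have := hr0 j
        positivity
    have h6 : n * softRisk 0 l ≤ S := by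
      have : ∑ _i : Fin n, softRisk 0 l ≤ S := by
        refine Finset.sum_le_sum fun i _ => ?_
        unfold refRisk
        have := min_sq_nonneg (θ i) l
        linarith
      simpa using this
    have h7 : m ≤ C₃ * (q * S) := by
      have : m = q * (m * (1 + l) ^ 2) := by rw [hq]; field_simp
      rw [this]
      calc q * (m * (1 + l) ^ 2) ≤ q * (C₃ * S) := by gcongr
        _ = _ := by ring
    have h8 : n * softRisk 0 l / (1 + l) ^ 2 ≤ q * S := by
      calc n * softRisk 0 l / (1 + l) ^ 2 = q * (n * softRisk 0 l) := by rw [hq]; ring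
        _ ≤ _ := by gcongr
    have h9 : ∫ x, H x ∂(normalMeans θ) ≤ C₁ * (C₃ + 1) * (q * S) := by
      refine hHint.trans ?_
      rw [mul_assoc]
      gcongr
      linarith
    have h10 : m * (4 * δ * l ^ 2) ≤ 4 * C₃ * (δ * S) := by
      calc m * (4 * δ * l ^ 2) ≤ m * (4 * δ * (1 + l) ^ 2) := by gcongr; linarith
        _ = 4 * δ * (m * (1 + l) ^ 2) := by ring
        _ ≤ 4 * δ * (C₃ * S) := by gcongr
        _ = _ := by ring
    have h11 : (4 * δ + 2) * ∫ x, H x ∂(normalMeans θ) ≤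
        4 * C₁ * (C₃ + 1) * ((δ + q) * S) := by
      calc _ ≤ (4 * δ + 2) * (C₁ * (C₃ + 1) * (q * S)) := by gcongr
        _ = C₁ * (C₃ + 1) * S * (4 * δ * q + 2 * q) := by ring
        _ ≤ C₁ * (C₃ + 1) * S * (4 * δ * 1 + 4 * q) := by
            gcongr
            norm_num
        _ = _ := by ring
    have hδS : 0 ≤ δ * S := by positivity
    have hqS : 0 ≤ q * S := by positivity
    calc _ ≤ C₂ * (q * S) + (4 * C₃ * (δ * S) + 4 * C₁ * (C₃ + 1) * ((δ + q) * S)) := by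
          linarith
      _ ≤ C₂ * ((δ + q) * S) + (4 * C₃ * ((δ + q) * S) + 4 * C₁ * (C₃ + 1) * ((δ + q) * S)) := by
          have e1 : q * S ≤ (δ + q) * S := by nlinarith
          have e2 : δ * S ≤ (δ + q) * S := by nlinarith
          gcongr
      _ = _ := by ring

/-! ### The loss from underestimating the level -/

lemma exists_chernoff_rate {β : ℝ} (hβ0 : 0 < β) (hβ : β < 1) : ∃ s c : ℝ, 0 < s ∧ 0 < c ∧
    c ≤ s - (Real.exp s - 1) * β := by
  -- With `exp s - 1 ≤ s + s²` and `1 - β = 2s`, the rate is at least `2s² - βs² ≥ s²`.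
  refine ⟨(1 - β) / 2, ((1 - β) / 2) ^ 2, by linarith, by
    have : 0 < (1 - β) / 2 := by linarith
    positivity, ?_⟩
  set s := (1 - β) / 2 with hs
  have hs0 : 0 < s := by linarith
  have h := (abs_le.1 (Real.abs_exp_sub_one_sub_id_le (x := s) (by
    rw [abs_of_pos hs0]; linarith))).2
  have h2 : (Real.exp s - 1) * β ≤ (s + s ^ 2) * β := by gcongr; linarith
  nlinarith

/-- A union over the possible indices. Those up to `K` are replaced by `K`, since `upLoss` decreases
in the level. Each later one carries a leave-one-out Chernoff factor `exp(-ck)`, against which the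
factors `k ^ B` and `k` allowed in the hypotheses are summable. -/
lemma exists_majorant_upLoss {β : ℝ} (hβ0 : 0 < β) (hβ : β < 1) (B : ℕ) : ∃ C : ℝ, 0 < C ∧
    ∀ (n K : ℕ) (θ : Fin n → ℝ) (l ρ v : ℝ) (ξ a : ℕ → ℝ) (A : (Fin n → ℝ) → ℝ),
    0 ≤ l → 1 ≤ K → K ≤ n →
    (∀ k, 1 ≤ k → k ≤ n → 0 ≤ a k) →
    (∀ k, 1 ≤ k → k ≤ K → a K ≤ a k) →
    (∀ x, ∃ k, 1 ≤ k ∧ k ≤ n ∧ (k = 1 ∨ k ≤ countAbove x (ξ k)) ∧ A x = a k) →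
    (∀ k, K < k → k ≤ n → ∑ i, pAbove (θ i) (ξ k) ≤ β * k) →
    softRisk 0 (a K) ≤ ρ → (∀ k, K < k → k ≤ n → softRisk 0 (a k) ≤ ρ * k ^ B) →
    1 / (1 + a K) ^ 2 ≤ v → (∀ k, K < k → k ≤ n → 1 / (1 + a k) ^ 2 ≤ v * k) →
    ∃ H : (Fin n → ℝ) → ℝ, Integrable H (normalMeans θ) ∧
      (∀ x, ∑ i, upLoss (θ i) (A x) (x i) ≤ H x) ∧
      ∫ x, H x ∂(normalMeans θ) ≤
        C * (n * ρ + (v + 1 / (1 + l) ^ 2) * ∑ i, refRisk (θ i) l) := by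
  classical
  obtain ⟨s, c, hs, hc, hsc⟩ := exists_chernoff_rate hβ0 hβ
  obtain ⟨C₁, hC₁, h₁⟩ := exists_integral_upLoss_le
  obtain ⟨C₂, hC₂, h₂⟩ := exists_sum_pow_mul_exp_le (B + 1) hc
  refine ⟨C₁ + C₁ * Real.exp s * C₂, by positivity, ?_⟩
  intro n K θ l ρ v ξ a A hl hK hKn ha0 haK hA hp hρ hρk hv hvk
  set q := 1 / (1 + l) ^ 2 with hq
  have hq0 : 0 < q := by positivity
  set S := ∑ i, refRisk (θ i) l with hS
  have hr0 : ∀ i, 0 ≤ refRisk (θ i) l := fun i => (refRisk_pos hl _).le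
  have hS0 : 0 ≤ S := Finset.sum_nonneg fun i _ => hr0 i
  have hv0 : 0 ≤ v := le_trans (by positivity) hv
  have hρ0 : 0 ≤ ρ := (softRisk_zero_pos (ha0 K hK hKn)).le.trans hρ
  choose H hHi hH0 hHle hHint using fun (k : ℕ) (i : Fin n) =>
    exists_majorant_le_countAbove θ (ξ k) k i hs.le (integrable_upLoss (θ i) (a k))
      (upLoss_nonneg (θ i) (a k))
  have hI1 : Integrable (fun x : Fin n → ℝ => ∑ i, upLoss (θ i) (a K) (x i)) (normalMeans θ) :=
    integrable_finsetSum _ fun i _ => integrable_coord θ i (integrable_upLoss (θ i) (a K))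
  have hI2 : Integrable (fun x => ∑ k ∈ Finset.Ioc K n, ∑ i, H k i x) (normalMeans θ) :=
    integrable_finsetSum _ fun k _ => integrable_finsetSum _ fun i _ => hHi k i
  have hU : ∀ k i, 1 ≤ k → k ≤ n → ∫ y, upLoss (θ i) (a k) y ∂(gaussianReal (θ i) 1) ≤
      C₁ * (softRisk 0 (a k) + (1 / (1 + a k) ^ 2 + q) * refRisk (θ i) l) :=
    fun k i hk hkn => h₁ (a k) l (θ i) (ha0 k hk hkn) hl
  refine ⟨fun x => ∑ i, upLoss (θ i) (a K) (x i) + ∑ k ∈ Finset.Ioc K n, ∑ i, H k i x,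
    hI1.add hI2, ?_, ?_⟩
  · intro x
    obtain ⟨k, hk, hkn, hcount, hAk⟩ := hA x
    rw [hAk]
    have hnn : ∀ k, 0 ≤ ∑ i, H k i x := fun k => Finset.sum_nonneg fun i _ => hH0 k i x
    rcases le_or_gt k K with h | h
    · have h3 : ∑ i, upLoss (θ i) (a k) (x i) ≤ ∑ i, upLoss (θ i) (a K) (x i) :=
        Finset.sum_le_sum fun i _ => upLoss_anti _ _ (haK k hk h)
      have h4 : 0 ≤ ∑ k ∈ Finset.Ioc K n, ∑ i, H k i x := Finset.sum_nonneg fun k _ => hnn k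
      linarith
    · have hcount' : k ≤ countAbove x (ξ k) := by
        rcases hcount with h' | h'
        · omega
        · exact h'
      have h3 : ∑ i, upLoss (θ i) (a k) (x i) ≤ ∑ i, H k i x :=
        Finset.sum_le_sum fun i _ => hHle k i x hcount'
      have h4 : ∑ i, H k i x ≤ ∑ k ∈ Finset.Ioc K n, ∑ i, H k i x :=
        Finset.single_le_sum (f := fun k => ∑ i, H k i x) (fun k _ => hnn k)
          (Finset.mem_Ioc.2 ⟨h, hkn⟩)
      have h5 : 0 ≤ ∑ i, upLoss (θ i) (a K) (x i) :=
        Finset.sum_nonneg fun i _ => upLoss_nonneg _ _ _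
      linarith
  · rw [integral_add hI1 hI2,
      integral_finsetSum _ fun i _ => integrable_coord θ i (integrable_upLoss (θ i) (a K)),
      integral_finsetSum _ fun k _ => integrable_finsetSum _ fun i _ => hHi k i]
    set T := n * ρ + (v + q) * S with hT
    have h3 : ∑ i, ∫ x : Fin n → ℝ, upLoss (θ i) (a K) (x i) ∂(normalMeans θ) ≤ C₁ * T := by
      calc _ ≤ ∑ i, C₁ * (ρ + (v + q) * refRisk (θ i) l) := by
            refine Finset.sum_le_sum fun i _ => ?_
            rw [integral_coord θ i (integrable_upLoss (θ i) (a K))]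
            refine (hU K i hK hKn).trans ?_
            have := hr0 i
            gcongr
        _ = C₁ * T := by
            rw [← Finset.mul_sum, Finset.sum_add_distrib, ← Finset.mul_sum]
            simp [hT, hS]
    have h4 : ∀ k ∈ Finset.Ioc K n, ∫ x, ∑ i, H k i x ∂(normalMeans θ) ≤
        C₁ * Real.exp s * T * ((k : ℝ) ^ (B + 1) * Real.exp (-(c * k))) := by
      intro k hk
      obtain ⟨hk, hkn⟩ := Finset.mem_Ioc.1 hk
      rw [integral_finsetSum _ fun i _ => hHi k i]
      have hk1 : (1 : ℝ) ≤ k := by exact_mod_cast (hK.trans hk.le)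
      have hexp : Real.exp (s - s * k + (Real.exp s - 1) * ∑ j, pAbove (θ j) (ξ k)) ≤
          Real.exp s * Real.exp (-(c * k)) := by
        rw [← Real.exp_add]
        apply Real.exp_le_exp.2
        have h5 : 0 ≤ Real.exp s - 1 := by linarith [Real.one_le_exp hs.le]
        have h6 : (Real.exp s - 1) * ∑ j, pAbove (θ j) (ξ k) ≤ (Real.exp s - 1) * (β * k) :=
          mul_le_mul_of_nonneg_left (hp k hk hkn) h5
        have h7 : c * k ≤ (s - (Real.exp s - 1) * β) * k := by gcongr
        linarith
      have hkB : (k : ℝ) ^ B ≤ (k : ℝ) ^ (B + 1) := pow_le_pow_right₀ hk1 (by omega)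
      have hk1B : (k : ℝ) ≤ (k : ℝ) ^ (B + 1) := le_self_pow₀ hk1 (by omega)
      have h1B : (1 : ℝ) ≤ (k : ℝ) ^ (B + 1) := one_le_pow₀ hk1
      calc ∑ i, ∫ x, H k i x ∂(normalMeans θ)
          ≤ ∑ i, (C₁ * (ρ * k ^ (B + 1) + (v * k ^ (B + 1) + q * k ^ (B + 1)) * refRisk (θ i) l)) *
            (Real.exp s * Real.exp (-(c * k))) := by
            refine Finset.sum_le_sum fun i _ => (hHint k i).trans ?_
            have hr := hr0 i
            have h8 : ∫ y, upLoss (θ i) (a k) y ∂(gaussianReal (θ i) 1) ≤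
                C₁ * (ρ * k ^ (B + 1) + (v * k ^ (B + 1) + q * k ^ (B + 1)) * refRisk (θ i) l) := by
              refine (hU k i (hK.trans hk.le) hkn).trans ?_
              have h9 : softRisk 0 (a k) ≤ ρ * k ^ (B + 1) := (hρk k hk hkn).trans (by gcongr)
              have h10 : 1 / (1 + a k) ^ 2 ≤ v * k ^ (B + 1) := (hvk k hk hkn).trans (by gcongr)
              have h11 : q ≤ q * k ^ (B + 1) := le_mul_of_one_le_right hq0.le h1B
              gcongr
            refine mul_le_mul h8 hexp (Real.exp_pos _).le ?_
            positivity
        _ = C₁ * Real.exp s * T * ((k : ℝ) ^ (B + 1) * Real.exp (-(c * k))) := by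
            rw [← Finset.sum_mul, ← Finset.mul_sum, Finset.sum_add_distrib, Finset.sum_const,
              Finset.card_univ, Fintype.card_fin, nsmul_eq_mul, ← Finset.mul_sum, ← hS, hT]
            ring
    have hT0 : 0 ≤ T := by positivity
    have h5 := Finset.sum_le_sum h4
    rw [← Finset.mul_sum] at h5
    have h6 : C₁ * Real.exp s * T * ∑ k ∈ Finset.Ioc K n,
        ((k : ℝ) ^ (B + 1) * Real.exp (-(c * k))) ≤ C₁ * Real.exp s * T * C₂ := by
      gcongr
      exact h₂ _
    calc _ ≤ C₁ * T + C₁ * Real.exp s * T * C₂ := add_le_add h3 (h5.trans h6)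
      _ = _ := by ring

/-! ### Relations between levels and risks -/

/-- The exponent is doubled on purpose to swallow the polynomial factor. The bound is used only
after taking logarithms, where constant factors do not matter. -/
lemma exists_exp_sq_le_softRisk : ∃ c : ℝ, 0 < c ∧ ∀ l : ℝ, 0 ≤ l →
    c * Real.exp (-l ^ 2) ≤ softRisk 0 l := by
  obtain ⟨c, hc, h⟩ := le_softRisk_zero
  obtain ⟨C, hC, h2⟩ := exists_pow_mul_exp_sq_le 3 (c := 1 / 2) (by norm_num)
  refine ⟨c / C, by positivity, fun l hl => le_trans ?_ (h l hl)⟩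
  have h3 := h2 l hl
  have hl1 : 0 < (1 + l) ^ 3 := by positivity
  rw [le_div_iff₀ hl1]
  calc c / C * Real.exp (-l ^ 2) * (1 + l) ^ 3
      = c / C * ((1 + l) ^ 3 * Real.exp (-(1 / 2 * l ^ 2))) * Real.exp (-l ^ 2 / 2) := by
        have e : Real.exp (-l ^ 2) = Real.exp (-(1 / 2 * l ^ 2)) * Real.exp (-l ^ 2 / 2) := by
          rw [← Real.exp_add]
          congr 1
          ring
        rw [e]
        ring
    _ ≤ c / C * C * Real.exp (-l ^ 2 / 2) := by gcongr
    _ = _ := by field_simp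

lemma exists_exp_sq_le_Phi_neg : ∃ c : ℝ, 0 < c ∧ ∀ x : ℝ, 0 ≤ x →
    c * Real.exp (-x ^ 2) ≤ Phi (-x) := by
  obtain ⟨C, hC, h2⟩ := exists_pow_mul_exp_sq_le 1 (c := 1 / 2) (by norm_num)
  refine ⟨Real.exp (-(3 / 2)) / (6 * C), by positivity, fun x hx => le_trans ?_ (le_Phi_neg hx)⟩
  have h3 := h2 x hx
  have h4 := exp_le_nd x
  rw [mul_div_assoc', le_div_iff₀ (by positivity)]
  calc Real.exp (-(3 / 2)) / (6 * C) * Real.exp (-x ^ 2) * (2 * (1 + x))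
      = Real.exp (-(3 / 2)) / (3 * C) * ((1 + x) ^ 1 * Real.exp (-(1 / 2 * x ^ 2))) *
        Real.exp (-x ^ 2 / 2) := by
        rw [show -x ^ 2 = -(1 / 2 * x ^ 2) + -x ^ 2 / 2 by ring, Real.exp_add]
        field_simp
        ring_nf
    _ ≤ Real.exp (-(3 / 2)) / (3 * C) * C * (3 * nd x) := by gcongr
    _ = _ := by field_simp

lemma log_le_of_exp_sq_le {c y t : ℝ} (hc : 0 < c) (ht : 0 < t) (hy : 0 ≤ y)
    (h : c * Real.exp (-y ^ 2) ≤ t) :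
    Real.log (8 / t) ≤ (1 + |Real.log (8 / c)|) * (1 + y) ^ 2 := by
  have h1 : Real.log (8 / t) ≤ Real.log (8 / c * Real.exp (y ^ 2)) := by
    apply Real.log_le_log (by positivity)
    rw [div_le_iff₀ ht]
    calc (8 : ℝ) = 8 / c * Real.exp (y ^ 2) * (c * Real.exp (-y ^ 2)) := by
          rw [Real.exp_neg]
          field_simp
      _ ≤ _ := by gcongr
  rw [Real.log_mul (by positivity) (Real.exp_pos _).ne', Real.log_exp] at h1
  have h2 := le_abs_self (Real.log (8 / c))
  have h3 := abs_nonneg (Real.log (8 / c))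
  have h4 : 1 ≤ (1 + y) ^ 2 := by nlinarith
  nlinarith

/-- Comparing Gaussian exponents gives `x²/2 ≤ y² + O(1)`. Applied to `y = g x`, this says that the
lowered level keeps the order of magnitude of the original one. -/
lemma exists_one_add_le_of_risk_le : ∃ C : ℝ, 1 ≤ C ∧ ∀ x y : ℝ, 0 ≤ x → 0 ≤ y →
    softRisk 0 y ≤ 4 * Phi (-x) → 1 + x ≤ C * (1 + y) := by
  obtain ⟨c, hc, h⟩ := exists_exp_sq_le_softRisk
  refine ⟨3 + 2 * |Real.log (8 / c)|, by linarith [abs_nonneg (Real.log (8 / c))],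
    fun x y hx hy hr => ?_⟩
  set D := |Real.log (8 / c)| with hD
  have hD0 : 0 ≤ D := abs_nonneg _
  have h1 := h y hy
  have h2 := Phi_neg_le_exp hx
  have h3 : c * Real.exp (-y ^ 2) ≤ 8 * Real.exp (-x ^ 2 / 2) := by linarith
  have h4 : x ^ 2 / 2 ≤ D + y ^ 2 := by
    have h5 : Real.exp (x ^ 2 / 2) ≤ 8 / c * Real.exp (y ^ 2) := by
      have e1 : Real.exp (-y ^ 2) * Real.exp (y ^ 2) = 1 := by rw [← Real.exp_add]; simp
      have e2 : Real.exp (-x ^ 2 / 2) * Real.exp (x ^ 2 / 2) = 1 := by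
        rw [← Real.exp_add, ← Real.exp_zero]
        congr 1
        ring
      rw [div_mul_eq_mul_div, le_div_iff₀ hc]
      calc Real.exp (x ^ 2 / 2) * c
          = c * Real.exp (-y ^ 2) * (Real.exp (x ^ 2 / 2) * Real.exp (y ^ 2)) := by
            linear_combination (-(Real.exp (x ^ 2 / 2) * c)) * e1
        _ ≤ 8 * Real.exp (-x ^ 2 / 2) * (Real.exp (x ^ 2 / 2) * Real.exp (y ^ 2)) := by gcongr
        _ = 8 * Real.exp (y ^ 2) := by linear_combination (8 * Real.exp (y ^ 2)) * e2
    have h6 := Real.log_le_log (Real.exp_pos _) h5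
    rw [Real.log_exp, Real.log_mul (by positivity) (Real.exp_pos _).ne', Real.log_exp] at h6
    have := le_abs_self (Real.log (8 / c))
    linarith
  have h7 : x ^ 2 ≤ (2 + 2 * D + 2 * y) ^ 2 := by nlinarith
  have h8 : x ≤ 2 + 2 * D + 2 * y := le_of_sq_le_sq h7 (by positivity)
  nlinarith

/-- The tail probabilities at the two levels have ratio `K/k ≥ 1/k`, while a gap `d` between
positive levels forces a ratio of at most `exp(-d²/2)`. -/
lemma sq_xi_sub_le {α : ℝ} (h0 : 0 < α) (h1 : α < 1) {n K k : ℕ} (hn : 1 ≤ n) (hK : 1 ≤ K)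
    (hKk : K ≤ k) (hkn : k ≤ n) : (xi α n K - xi α n k) ^ 2 ≤ 2 * Real.log k := by
  set d := xi α n K - xi α n k with hd
  have hd0 : 0 ≤ d := sub_nonneg.2 (xi_anti h0 h1 hn hK hKk (by omega))
  have hxk := xi_pos h0 h1 hn (hK.trans hKk) hkn
  have h := Phi_neg_add_le (xi α n k) hd0
  rw [show xi α n k + d = xi α n K by rw [hd]; ring, Phi_neg_xi h0 h1 hn hK (by omega),
    Phi_neg_xi h0 h1 hn (hK.trans hKk) (by omega)] at h
  have hn' : (0 : ℝ) < n := by exact_mod_cast hn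
  have hK' : (1 : ℝ) ≤ K := by exact_mod_cast hK
  have hk' : (1 : ℝ) ≤ k := by exact_mod_cast (hK.trans hKk)
  have h2 : Real.exp (-(d * xi α n k) - d ^ 2 / 2) ≤ Real.exp (-(d ^ 2 / 2)) := by
    apply Real.exp_le_exp.2
    have : 0 ≤ d * xi α n k := by positivity
    linarith
  have h3 : α * K / (2 * n) ≤ Real.exp (-(d ^ 2 / 2)) * (α * k / (2 * n)) :=
    h.trans (by gcongr)
  have h4 : 1 ≤ Real.exp (-(d ^ 2 / 2)) * k := by
    have h5 : α * K / (2 * n) = α / (2 * n) * K := by ring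
    have h6 : Real.exp (-(d ^ 2 / 2)) * (α * k / (2 * n)) =
      α / (2 * n) * (Real.exp (-(d ^ 2 / 2)) * k) := by ring
    rw [h5, h6] at h3
    have h7 := le_of_mul_le_mul_left h3 (by positivity)
    linarith
  have h5 : Real.exp (d ^ 2 / 2) ≤ k := by
    rw [Real.exp_neg, inv_mul_eq_div, one_le_div (Real.exp_pos _)] at h4
    exact h4
  have h6 := Real.log_le_log (Real.exp_pos _) h5
  rw [Real.log_exp] at h6
  linarith

lemma one_add_xi_sq_le {α : ℝ} (h0 : 0 < α) (h1 : α < 1) {n K k : ℕ} (hn : 1 ≤ n) (hK : 1 ≤ K)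
    (hKk : K ≤ k) (hkn : k ≤ n) : (1 + xi α n K) ^ 2 ≤ 6 * k * (1 + xi α n k) ^ 2 := by
  have h := sq_xi_sub_le h0 h1 hn hK hKk hkn
  have hd0 : 0 ≤ xi α n K - xi α n k := sub_nonneg.2 (xi_anti h0 h1 hn hK hKk (by omega))
  have hxk := xi_pos h0 h1 hn (hK.trans hKk) hkn
  have hk' : (1 : ℝ) ≤ k := by exact_mod_cast (hK.trans hKk)
  have hlog := Real.log_le_sub_one_of_pos (x := k) (by linarith)
  set d := xi α n K - xi α n k with hd
  have h3 : 1 + xi α n K ≤ (1 + xi α n k) * (1 + d) := by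
    have : xi α n K = xi α n k + d := by rw [hd]; ring
    rw [this]
    nlinarith
  have h4 : (1 + d) ^ 2 ≤ 6 * k := by nlinarith [sq_nonneg (1 - d)]
  have hxK : 0 < xi α n K := by linarith
  calc (1 + xi α n K) ^ 2 ≤ ((1 + xi α n k) * (1 + d)) ^ 2 := by gcongr
    _ = (1 + d) ^ 2 * (1 + xi α n k) ^ 2 := by ring
    _ ≤ _ := by gcongr

/-- Pure noise accounts for at most `αj ≤ α₁' j` expected exceedances, so a fixed fraction of `j` is
surplus. If `l ≥ ξ_j/2`, the surplus is charged to the means by `pAbove_le_null_add`. If `l <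
ξ_j/2`, the null risk `n R(0,l)` alone dominates `n Φ(-ξ_j)(1+ξ_j)²`, which is of order `j
(1+ξ_j)²`. -/
lemma exists_level_le_sum_refRisk {α₁' α₂' : ℝ} (h2 : 0 < α₂') (h21 : α₂' < α₁') (h1 : α₁' < 1) :
    ∃ C : ℝ, 0 < C ∧ ∀ (α : ℝ) (n j : ℕ) (θ : Fin n → ℝ) (l : ℝ), α₂' ≤ α → α ≤ α₁' → 1 ≤ n →
    1 ≤ j → j ≤ n → 0 ≤ l → (1 + α₁') / 2 * j < ∑ i, pAbove (θ i) (xi α n j) →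
    j ≤ C * (∑ i, refRisk (θ i) l) / (1 + xi α n j) ^ 2 := by
  have hα1 : 0 < α₁' := h2.trans h21
  set x₀ := -PhiInv (α₁' / 2) with hx₀
  have hx₀pos : 0 < x₀ := neg_PhiInv_half_pos hα1 h1
  obtain ⟨C₁, hC₁, h₁⟩ := pAbove_le_null_add hx₀pos
  obtain ⟨c, hc, h₂⟩ := le_softRisk_zero
  obtain ⟨C₃, hC₃, h₃⟩ := exists_pow_mul_exp_sq_le 5 (c := 3 / 8) (by norm_num)
  refine ⟨8 * C₁ / (1 - α₁') + 4 * C₃ / (α₂' * c), by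
    have : 0 < 1 - α₁' := by linarith
    positivity, fun α n j θ l hα2 hα1' hn hj hjn hl hgt => ?_⟩
  have hα0 : 0 < α := h2.trans_le hα2
  have hαlt : α < 1 := hα1'.trans_lt h1
  set ξ := xi α n j with hξ
  have hξx : x₀ ≤ ξ := le_xi hα0 hα1' h1 hn hj hjn
  have hξ0 : 0 < ξ := hx₀pos.trans_le hξx
  have hn' : (1 : ℝ) ≤ n := by exact_mod_cast hn
  have hj' : (1 : ℝ) ≤ j := by exact_mod_cast hj
  have hPhi : Phi (-ξ) = α * j / (2 * n) := Phi_neg_xi hα0 hαlt hn hj (by omega)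
  have hr0 : ∀ i, 0 ≤ refRisk (θ i) l := fun i => (refRisk_pos hl _).le
  set S := ∑ i, refRisk (θ i) l with hS
  have hS0 : 0 ≤ S := Finset.sum_nonneg fun i _ => hr0 i
  have h1α : 0 < 1 - α₁' := by linarith
  rw [add_mul, add_div]
  have hA : 0 ≤ 8 * C₁ / (1 - α₁') * S / (1 + ξ) ^ 2 := by positivity
  have hB : 0 ≤ 4 * C₃ / (α₂' * c) * S / (1 + ξ) ^ 2 := by positivity
  rcases le_total (ξ / 2) l with hlξ | hlξ
  · have h4 : ∑ i, pAbove (θ i) ξ ≤ α * j + 4 * C₁ * S / (1 + ξ) ^ 2 := by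
      calc ∑ i, pAbove (θ i) ξ
          ≤ ∑ i, (2 * Phi (-ξ) + C₁ * (4 * refRisk (θ i) l) / (1 + ξ) ^ 2) := by
            refine Finset.sum_le_sum fun i _ => (h₁ ξ (θ i) hξx).trans ?_
            gcongr
            have hsl := softRisk_zero_pos hl
            have h5 : min (θ i ^ 2) (ξ ^ 2) ≤ 4 * min (θ i ^ 2) (l ^ 2) := by
              rcases min_choice (θ i ^ 2) (l ^ 2) with h | h <;> rw [h]
              · exact (min_le_left _ _).trans (by nlinarith [sq_nonneg (θ i)])
              · exact (min_le_right _ _).trans (by nlinarith)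
            unfold refRisk
            linarith
        _ = α * j + 4 * C₁ * S / (1 + ξ) ^ 2 := by
            rw [Finset.sum_add_distrib, Finset.sum_const, Finset.card_univ, Fintype.card_fin,
              nsmul_eq_mul, ← Finset.sum_div, ← Finset.mul_sum, ← Finset.mul_sum, ← hS, hPhi]
            field_simp
    have h5 : (1 - α₁') / 2 * j ≤ 4 * C₁ * S / (1 + ξ) ^ 2 := by
      have : α * j ≤ α₁' * j := by gcongr
      linarith
    have h6 : (j : ℝ) ≤ 8 * C₁ / (1 - α₁') * S / (1 + ξ) ^ 2 := by
      have e : 8 * C₁ / (1 - α₁') * S / (1 + ξ) ^ 2 =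
        4 * C₁ * S / (1 + ξ) ^ 2 / ((1 - α₁') / 2) := by field_simp; ring
      rw [e, le_div_iff₀ (by positivity)]
      linarith
    linarith
  · have h4 : n * softRisk 0 l ≤ S := by
      have : ∑ _i : Fin n, softRisk 0 l ≤ S := by
        refine Finset.sum_le_sum fun i _ => ?_
        unfold refRisk
        have := min_sq_nonneg (θ i) l
        linarith
      simpa using this
    have h5 : softRisk 0 (ξ / 2) ≤ softRisk 0 l := softRisk_zero_anti hl hlξ
    have h6 := h₂ (ξ / 2) (by positivity)
    have h7 := h₃ ξ hξ0.le
    have h8 : Phi (-ξ) * (1 + ξ) ^ 2 ≤ 2 * C₃ / c * softRisk 0 (ξ / 2) := by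
      have h9 : c * Real.exp (-ξ ^ 2 / 8) / (1 + ξ) ^ 3 ≤ softRisk 0 (ξ / 2) := by
        refine le_trans ?_ h6
        rw [show -(ξ / 2) ^ 2 / 2 = -ξ ^ 2 / 8 by ring]
        gcongr
        linarith
      have h10 := Phi_neg_le_exp hξ0.le
      have e : Real.exp (-ξ ^ 2 / 2) = Real.exp (-ξ ^ 2 / 8) * Real.exp (-(3 / 8 * ξ ^ 2)) := by
        rw [← Real.exp_add]
        congr 1
        ring
      have h11 : Phi (-ξ) * (1 + ξ) ^ 5 ≤ 2 * C₃ * Real.exp (-ξ ^ 2 / 8) := by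
        calc Phi (-ξ) * (1 + ξ) ^ 5 ≤ 2 * Real.exp (-ξ ^ 2 / 2) * (1 + ξ) ^ 5 := by gcongr
          _ = 2 * ((1 + ξ) ^ 5 * Real.exp (-(3 / 8 * ξ ^ 2))) * Real.exp (-ξ ^ 2 / 8) := by
              rw [e]; ring
          _ ≤ _ := by gcongr
      calc Phi (-ξ) * (1 + ξ) ^ 2 = Phi (-ξ) * (1 + ξ) ^ 5 / (1 + ξ) ^ 3 := by field_simp
        _ ≤ 2 * C₃ * Real.exp (-ξ ^ 2 / 8) / (1 + ξ) ^ 3 := by gcongr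
        _ = 2 * C₃ / c * (c * Real.exp (-ξ ^ 2 / 8) / (1 + ξ) ^ 3) := by field_simp
        _ ≤ _ := by gcongr
    have h9 : (j : ℝ) = 2 * n / α * Phi (-ξ) := by
      rw [hPhi]
      field_simp
    have h10 : (j : ℝ) ≤ 4 * C₃ / (α₂' * c) * S / (1 + ξ) ^ 2 := by
      rw [le_div_iff₀ (by positivity), h9]
      calc 2 * n / α * Phi (-ξ) * (1 + ξ) ^ 2 = 2 * n / α * (Phi (-ξ) * (1 + ξ) ^ 2) := by ring
        _ ≤ 2 * n / α₂' * (2 * C₃ / c * softRisk 0 l) := by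
            have h11 := Phi_nonneg (-ξ)
            have h12 : Phi (-ξ) * (1 + ξ) ^ 2 ≤ 2 * C₃ / c * softRisk 0 l :=
              h8.trans (by gcongr)
            exact mul_le_mul (by gcongr) h12 (by positivity) (by positivity)
        _ = 4 * C₃ / (α₂' * c) * (n * softRisk 0 l) := by field_simp; ring
        _ ≤ _ := by gcongr
    linarith

/-! ### The null risk at the data-driven level -/

lemma abs_log_max_one_sub_le (y z : ℝ) :
    |Real.log (max 1 y) - Real.log (max 1 z)| ≤ |y - z| := by
  have key : ∀ y z : ℝ, Real.log (max 1 y) - Real.log (max 1 z) ≤ |y - z| := by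
    intro y z
    have hy : (1 : ℝ) ≤ max 1 y := le_max_left _ _
    have hz : (1 : ℝ) ≤ max 1 z := le_max_left _ _
    rw [← Real.log_div (by positivity) (by positivity)]
    have h1 := Real.log_le_sub_one_of_pos (x := max 1 y / max 1 z) (by positivity)
    have h2 : max 1 y / max 1 z - 1 ≤ |max 1 y - max 1 z| := by
      have h3 : max 1 y / max 1 z - 1 = (max 1 y - max 1 z) / max 1 z := by
        field_simp
      rw [h3]
      calc (max 1 y - max 1 z) / max 1 z ≤ |max 1 y - max 1 z| / max 1 z := by
            gcongr
            exact le_abs_self _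
        _ ≤ _ := div_le_self (abs_nonneg _) hz
    have h3 : |max 1 y - max 1 z| ≤ |y - z| := by
      rw [max_comm 1 y, max_comm 1 z]
      exact abs_max_sub_max_le_abs _ _ _
    linarith
  rw [abs_le]
  constructor
  · have := key z y
    rw [abs_sub_comm] at this
    linarith
  · exact key y z

lemma abs_log_max_one_two_mul_sub_le (y : ℝ) :
    |Real.log (max 1 (2 * y)) - Real.log (max 1 y)| ≤ 1 := by
  rcases le_total y 0 with h | h
  · rw [max_eq_left (by linarith), max_eq_left (by linarith)]
    simp
  · have h1 : max 1 y ≤ max 1 (2 * y) := max_le_max le_rfl (by linarith)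
    have h2 : max 1 (2 * y) ≤ 2 * max 1 y :=
      max_le (by linarith [le_max_left 1 y]) (by linarith [le_max_right 1 y])
    have hy : (1 : ℝ) ≤ max 1 y := le_max_left _ _
    have h3 := Real.log_le_log (by positivity) h1
    have h4 := Real.log_le_log (by positivity) h2
    rw [Real.log_mul (by norm_num) (by positivity)] at h4
    have := Real.log_two_lt_d9
    rw [abs_le]
    constructor <;> linarith

lemma exists_log_le_one_add_xi : ∃ C : ℝ, 1 ≤ C ∧ ∀ (α : ℝ) (n : ℕ), 0 < α → α < 1 → 1 ≤ n →
    Real.log n ≤ C * (1 + xi α n 1) ^ 2 := by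
  obtain ⟨c, hc, h⟩ := exists_exp_sq_le_Phi_neg
  refine ⟨1 + |Real.log (8 / c)|, by linarith [abs_nonneg (Real.log (8 / c))],
    fun α n h0 h1 hn => ?_⟩
  have hn' : (1 : ℝ) ≤ n := by exact_mod_cast hn
  have hx := xi_pos h0 h1 hn le_rfl hn
  have h2 := h _ hx.le
  rw [Phi_neg_xi h0 h1 hn le_rfl (by omega)] at h2
  have h3 : α * ((1 : ℕ) : ℝ) / (2 * n) ≤ 1 / n := by
    rw [div_le_div_iff₀ (by positivity) (by positivity)]
    push_cast
    nlinarith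
  have h4 := log_le_of_exp_sq_le hc (by positivity) hx.le (h2.trans h3)
  refine le_trans ?_ h4
  apply Real.log_le_log (by positivity)
  rw [div_div_eq_mul_div, div_one]
  linarith

/-- In other words `1 + ξ_k` is `√(log n)` up to a factor polynomial in `k`. The upper bound holds
since the tail at `ξ_k` is at least of order `1/n`; the lower one compares `ξ_k` with `ξ_1`. -/
lemma exists_abs_log_one_add_xi_sub_le {α₂' : ℝ} (h2 : 0 < α₂') : ∃ C : ℝ, 0 < C ∧
    ∀ (α : ℝ) (n k : ℕ), α₂' ≤ α → α < 1 → 2 ≤ n → 1 ≤ k → k ≤ n →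
    |Real.log (1 + xi α n k) - Real.log (Real.log n) / 2| ≤ C + Real.log k := by
  obtain ⟨C₁, hC₁, h₁⟩ := exists_log_le_one_add_xi
  set C₂ := 8 + 8 * |Real.log (4 / α₂')| with hC₂
  have hC₂0 : 1 ≤ C₂ := by
    have := abs_nonneg (Real.log (4 / α₂'))
    linarith
  refine ⟨Real.log (6 * C₁) + Real.log C₂, ?_, fun α n k hα hα1 hn hk hkn => ?_⟩
  · have := Real.log_pos (x := 6 * C₁) (by linarith)
    have := Real.log_nonneg hC₂0
    linarith
  have hα0 : 0 < α := h2.trans_le hα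
  have hn' : (2 : ℝ) ≤ n := by exact_mod_cast hn
  have hk' : (1 : ℝ) ≤ k := by exact_mod_cast hk
  set x := xi α n k with hx
  have hx0 : 0 < x := xi_pos hα0 hα1 (by omega) hk hkn
  have hlogn : 1 / 2 ≤ Real.log n := by
    have h3 := Real.log_le_log two_pos hn'
    have := Real.log_two_gt_d9
    linarith
  have hlogk := Real.log_nonneg hk'
  have hL1 := Real.log_nonneg (x := 6 * C₁) (by linarith)
  have hL2 := Real.log_nonneg hC₂0
  have hupper : (1 + x) ^ 2 ≤ C₂ * Real.log n := by
    have h3 := Phi_neg_le_exp hx0.le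
    rw [Phi_neg_xi hα0 hα1 (by omega) hk (by omega)] at h3
    have h4 : Real.exp (x ^ 2 / 2) ≤ 4 / α₂' * n := by
      have h5 : α₂' / (2 * n) ≤ 2 * Real.exp (-x ^ 2 / 2) := by
        refine le_trans ?_ h3
        gcongr
        nlinarith
      have e : Real.exp (-x ^ 2 / 2) * Real.exp (x ^ 2 / 2) = 1 := by
        rw [← Real.exp_add, ← Real.exp_zero]
        congr 1
        ring
      rw [div_mul_eq_mul_div, le_div_iff₀ h2]
      rw [div_le_iff₀ (by positivity)] at h5
      calc Real.exp (x ^ 2 / 2) * α₂'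
          ≤ Real.exp (x ^ 2 / 2) * (2 * Real.exp (-x ^ 2 / 2) * (2 * n)) := by gcongr
        _ = 4 * n := by linear_combination (4 * (n : ℝ)) * e
    have h5 := Real.log_le_log (Real.exp_pos _) h4
    rw [Real.log_exp, Real.log_mul (by positivity) (by positivity)] at h5
    have h6 := le_abs_self (Real.log (4 / α₂'))
    have h7 := abs_nonneg (Real.log (4 / α₂'))
    rw [hC₂]
    nlinarith [sq_nonneg (1 - x)]
  have hlower : Real.log n ≤ 6 * C₁ * k * (1 + x) ^ 2 := by
    have h3 := h₁ α n hα0 hα1 (by omega)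
    have h4 := one_add_xi_sq_le hα0 hα1 (n := n) (by omega) le_rfl hk hkn
    calc Real.log n ≤ C₁ * (1 + xi α n 1) ^ 2 := h3
      _ ≤ C₁ * (6 * k * (1 + x) ^ 2) := by gcongr
      _ = _ := by ring
  have h3 := Real.log_le_log (by positivity) hupper
  have h4 := Real.log_le_log (by positivity) hlower
  rw [Real.log_pow, Real.log_mul (by positivity) (by positivity)] at h3
  rw [Real.log_mul (by positivity) (by positivity), Real.log_pow,
    Real.log_mul (by positivity) (by positivity)] at h4
  push_cast at h3 h4
  rw [abs_le]
  constructor <;> linarith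

/-- Only the second summand inside `L2` is kept, and there `c₂ - 1` is replaced by `c₂`. What
remains is a pure monomial, whose logarithm is linear. -/
lemma exp_le_tau2 {δ c₁ c₂ : ℝ} (hδ : 0 ≤ δ) {n : ℕ} (hn : 2 ≤ n) :
    Real.exp (-3 * (Real.log (Real.log n) / 2) + (1 + δ) * ((3 - c₁) * (Real.log (Real.log n) / 2)
      - c₂ * Real.log (logPlus (Real.log n))) - (1 + δ) * Real.log n) ≤ tau2 δ c₁ c₂ n := by
  have hn' : (2 : ℝ) ≤ n := by exact_mod_cast hn
  have hlogn : 0 < Real.log n := Real.log_pos (by linarith)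
  have hP : 1 ≤ logPlus (Real.log n) := le_max_left _ _
  have hP0 : 0 < logPlus (Real.log n) := by linarith
  set Y := Real.log (Real.log n) / 2 with hY
  set P := Real.log (logPlus (Real.log n)) with hPdef
  have h1 : (Real.log n) ^ (-(3 / 2) : ℝ) = Real.exp (-3 * Y) := by
    rw [Real.rpow_def_of_pos hlogn]
    congr 1
    rw [hY]
    ring
  have h2 : (Real.log n) ^ ((3 - c₁) / 2) = Real.exp ((3 - c₁) * Y) := by
    rw [Real.rpow_def_of_pos hlogn]
    congr 1
    rw [hY]
    ring
  have h3 : Real.exp ((3 - c₁) * Y - c₂ * P) ≤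
      (Real.log n) ^ ((3 - c₁) / 2) / (logPlus (Real.log n)) ^ (c₂ - 1) := by
    have h4 : (logPlus (Real.log n)) ^ (c₂ - 1) ≤ Real.exp (c₂ * P) := by
      rw [mul_comm, ← Real.rpow_def_of_pos hP0]
      exact Real.rpow_le_rpow_of_exponent_le hP (by linarith)
    rw [h2, Real.exp_sub]
    have := Real.rpow_pos_of_pos hP0 (c₂ - 1)
    gcongr
  have h5 : 0 ≤ δ * (Real.log n) ^ ((5 - c₁) / 2) / (logPlus (Real.log n)) ^ c₂ := by positivity
  have h6 : Real.exp ((1 + δ) * ((3 - c₁) * Y - c₂ * P)) ≤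
      (δ * (Real.log n) ^ ((5 - c₁) / 2) / (logPlus (Real.log n)) ^ c₂
      + (Real.log n) ^ ((3 - c₁) / 2) / (logPlus (Real.log n)) ^ (c₂ - 1)) ^ (1 + δ) := by
    rw [mul_comm, Real.exp_mul]
    apply Real.rpow_le_rpow (Real.exp_pos _).le (by linarith) (by linarith)
  have h7 : (n : ℝ) ^ (1 + δ) = Real.exp ((1 + δ) * Real.log n) := by
    rw [Real.rpow_def_of_pos (by linarith), mul_comm]
  rw [tau2, L2, h1, h7, Real.exp_sub, Real.exp_add]
  gcongr

lemma rpow_add_two_ge {x c₁ : ℝ} (hx : 0 < x) (hc : 0 ≤ c₁) (hc2 : c₁ ≤ 2) :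
    Real.exp (c₁ * Real.log (1 + x)) ≤ 4 * (x ^ c₁ + 2) := by
  rw [mul_comm, ← Real.rpow_def_of_pos (by linarith)]
  have hm : (0 : ℝ) < max 1 x := lt_of_lt_of_le one_pos (le_max_left _ _)
  have h1 : (1 + x) ^ c₁ ≤ (2 * max 1 x) ^ c₁ :=
    Real.rpow_le_rpow (by linarith) (by linarith [le_max_left 1 x, le_max_right 1 x]) hc
  have h2 : (2 * max 1 x) ^ c₁ = 2 ^ c₁ * (max 1 x) ^ c₁ := Real.mul_rpow (by norm_num) hm.le
  have h3 : (2 : ℝ) ^ c₁ ≤ 4 := by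
    have := Real.rpow_le_rpow_of_exponent_le (x := 2) (by norm_num) hc2
    norm_num at this
    linarith
  have hx1 : 0 ≤ x ^ c₁ := Real.rpow_nonneg hx.le _
  have h4 : (max 1 x) ^ c₁ ≤ x ^ c₁ + 2 := by
    rcases max_choice 1 x with h | h <;> rw [h]
    · rw [Real.one_rpow]
      linarith
    · linarith
  have h5 : 0 ≤ (max 1 x) ^ c₁ := Real.rpow_nonneg hm.le _
  nlinarith

/-- The risk condition is solved for `exp(-G²/2)`. The lower bound on the null risk costs `(1+G)³ ≤
(1+x)³`, the condition returns `(1+x)^(-c₁)`, and this is the origin of the exponent `3 - c₁`. -/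
lemma neg_sq_half_le_of_risk_le {c M₀ c₁ c₂ x G t : ℝ} (hc : 0 < c) (hM : 0 < M₀)
    (hc1 : 0 ≤ c₁) (hc1' : c₁ ≤ 2) (hx0 : 0 < x) (hG0 : 0 ≤ G) (hGx : G ≤ x)
    (hR : c * Real.exp (-G ^ 2 / 2) / (1 + G) ^ 3 ≤ softRisk 0 G)
    (hrisk : softRisk 0 G ≤ M₀ * Phi (-x) / ((x ^ c₁ + 2) * (max 1 (Real.log x)) ^ c₂))
    (h6 : Phi (-x) ≤ Real.exp t) :
    -(G ^ 2) / 2 ≤ Real.log (4 * M₀ / c) + t + (3 - c₁) * Real.log (1 + x)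
      - c₂ * Real.log (max 1 (Real.log x)) := by
  set U := Real.log (1 + x) with hU
  set Λ := Real.log (max 1 (Real.log x)) with hΛ
  set D := Real.log (4 * M₀ / c) with hD
  set E := D + t + (3 - c₁) * U - c₂ * Λ with hE
  have hexpU : Real.exp U = 1 + x := Real.exp_log (by linarith)
  have h3 := hR
  have hmax : (0 : ℝ) < max 1 (Real.log x) := lt_of_lt_of_le one_pos (le_max_left _ _)
  have h4 : (max 1 (Real.log x)) ^ c₂ = Real.exp (c₂ * Λ) := by
    rw [Real.rpow_def_of_pos hmax, mul_comm]
  have h5 := rpow_add_two_ge hx0 hc1 hc1'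
  have h7 : Real.exp (-G ^ 2 / 2) ≤ Real.exp E := by
    have h8 : c * Real.exp (-G ^ 2 / 2) ≤ (1 + G) ^ 3 * softRisk 0 G := by
      rw [div_le_iff₀ (by positivity)] at h3
      linarith
    have h9 : (1 + G) ^ 3 ≤ Real.exp (3 * U) := by
      rw [show (3 : ℝ) * U = ((3 : ℕ) : ℝ) * U by norm_num, Real.exp_nat_mul, hexpU]
      gcongr
    have h10 : softRisk 0 G ≤ M₀ * Real.exp t /
        (Real.exp (c₁ * U) / 4 * Real.exp (c₂ * Λ)) := by
      refine hrisk.trans ?_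
      rw [h4]
      gcongr
      linarith
    have hs0 := (softRisk_zero_pos hG0).le
    have h11 : c * Real.exp (-G ^ 2 / 2) ≤ Real.exp (3 * U) * (M₀ * Real.exp t /
        (Real.exp (c₁ * U) / 4 * Real.exp (c₂ * Λ))) :=
      h8.trans (mul_le_mul h9 h10 hs0 (Real.exp_pos _).le)
    have h12 : Real.exp E = Real.exp (3 * U) * (M₀ * Real.exp t /
        (Real.exp (c₁ * U) / 4 * Real.exp (c₂ * Λ))) / c := by
      have : E = D + t + 3 * U - c₁ * U - c₂ * Λ := by rw [hE]; ring
      rw [this, Real.exp_sub, Real.exp_sub, Real.exp_add, Real.exp_add, hD,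
        Real.exp_log (by positivity)]
      field_simp
    rw [h12, le_div_iff₀ hc]
    linarith
  exact Real.exp_le_exp.1 h7

/-- Bookkeeping on the logarithmic scale. Replacing `U` by `Y` and `Λ` by `P` costs a constant plus
a bounded multiple of `κ = log k`, which becomes the factor `k ^ B`. -/
lemma exponent_le {A M₀ C₁ r δ c₁ c₂ U Y Λ P κ D N B : ℝ} (hA : 0 < A) (hM : 0 < M₀)
    (hr : 0 ≤ r) (hδ : 0 ≤ δ) (hδA : δ ≤ A) (hc1 : 0 < c₁) (hc1' : c₁ ≤ 2) (hc2 : |c₂| ≤ M₀)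
    (hκ0 : 0 ≤ κ) (hUYk : |U - Y| ≤ C₁ + κ) (hΛP : |Λ - P| ≤ 1 + r + (C₁ + κ))
    (hB : (6 + 3 * A + (1 + A) * M₀) + (1 + A) ≤ B) :
    -3 * U + (1 + δ) * (D + κ - N + (3 - c₁) * U - c₂ * Λ) ≤
      ((6 + 3 * A + (1 + A) * M₀) * (C₁ + 1 + r) + (1 + A) * |D|) + B * κ +
        (-3 * Y + (1 + δ) * ((3 - c₁) * Y - c₂ * P) - (1 + δ) * N) := by
  have e1 : -3 * U + (1 + δ) * (D + κ - N + (3 - c₁) * U - c₂ * Λ) -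
      (-3 * Y + (1 + δ) * ((3 - c₁) * Y - c₂ * P) - (1 + δ) * N) = ((1 + δ) * (3 - c₁) - 3) * (U - Y) +
      (-((1 + δ) * c₂)) * (Λ - P) + (1 + δ) * (D + κ) := by
    ring
  have e2 : ((1 + δ) * (3 - c₁) - 3) * (U - Y) ≤ (6 + 3 * A) * (C₁ + κ) := by
    refine (le_abs_self _).trans ?_
    rw [abs_mul]
    refine mul_le_mul ?_ hUYk (abs_nonneg _) (by positivity)
    rw [abs_le]
    constructor <;> nlinarith
  have e3 : (-((1 + δ) * c₂)) * (Λ - P) ≤ ((1 + A) * M₀) * (1 + r + (C₁ + κ)) := by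
    refine (le_abs_self _).trans ?_
    rw [abs_mul, abs_neg, abs_mul, abs_of_nonneg (by linarith : 0 ≤ 1 + δ)]
    gcongr
  have e4 : (1 + δ) * (D + κ) ≤ (1 + A) * (|D| + κ) := by
    have := le_abs_self D
    have := abs_nonneg D
    calc (1 + δ) * (D + κ) ≤ (1 + δ) * (|D| + κ) := by gcongr
      _ ≤ _ := by gcongr
  have e5 : ((6 + 3 * A + (1 + A) * M₀) + (1 + A)) * κ ≤ B * κ := by gcongr
  have e7 : 0 ≤ (6 + 3 * A) * (1 + r) := by positivity
  have e8 : ((6 + 3 * A + (1 + A) * M₀) * (C₁ + 1 + r) + (1 + A) * |D|) +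
      ((6 + 3 * A + (1 + A) * M₀) + (1 + A)) * κ = (6 + 3 * A) * (C₁ + κ) +
      ((1 + A) * M₀) * (1 + r + (C₁ + κ)) + (1 + A) * (|D| + κ) +
      (6 + 3 * A) * (1 + r) := by
      ring
  linarith

/-- Multiplying the level by `√(1+δ)` raises `exp(-G²/2)` to the power `1 + δ`. The risk condition
and `Φ(-ξ_k) ≤ k/n` give `n^(-(1+δ))` and the power inside `L2`. The prefactor `(log n)^(-3/2)`
comes from the cubic denominator of the null risk, as `1 + G` is of the order of `1 + ξ_k`. -/
lemma exists_softRisk_level_le_tau2 {α₁' α₂' A M₀ : ℝ} (h2 : 0 < α₂') (h21 : α₂' < α₁')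
    (h1 : α₁' < 1) (hA : 0 < A) (hM : 0 < M₀) : ∃ (C : ℝ) (B : ℕ), 0 < C ∧
    ∀ (α δ c₁ c₂ : ℝ) (g : ℝ → ℝ) (n k : ℕ), α₂' ≤ α → α ≤ α₁' → 0 ≤ δ → δ ≤ A →
    LevelCond M₀ c₁ c₂ g → 2 ≤ n → 1 ≤ k → k ≤ n →
    softRisk 0 (√(1 + δ) * g (xi α n k)) ≤ C * tau2 δ c₁ c₂ n * k ^ B := by
  have hα1 : 0 < α₁' := h2.trans h21
  set x₀ := -PhiInv (α₁' / 2) with hx₀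
  have hx₀pos : 0 < x₀ := neg_PhiInv_half_pos hα1 h1
  obtain ⟨Cg, hCg, hg1⟩ := exists_one_add_le_of_risk_le
  obtain ⟨c, hc, hR⟩ := le_softRisk_zero
  obtain ⟨C₁, hC₁, hUY⟩ := exists_abs_log_one_add_xi_sub_le h2
  set D := Real.log (4 * M₀ / c) with hD
  set W := 6 + 3 * A + (1 + A) * M₀ with hW
  have hW0 : 0 < W := by positivity
  obtain ⟨B, hB⟩ := exists_nat_ge (W + (1 + A))
  set Z := W * (C₁ + 1 + 1 / x₀) + (1 + A) * |D| with hZ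
  refine ⟨8 * Cg ^ 3 * Real.exp Z, B, by positivity, ?_⟩
  intro α δ c₁ c₂ g n k hα2 hα1' hδ hδA hg hn hk hkn
  have hα0 : 0 < α := h2.trans_le hα2
  have hαlt : α < 1 := hα1'.trans_lt h1
  have hn' : (2 : ℝ) ≤ n := by exact_mod_cast hn
  have hk' : (1 : ℝ) ≤ k := by exact_mod_cast hk
  set x := xi α n k with hx
  have hxx₀ : x₀ ≤ x := le_xi hα0 hα1' h1 (by omega) hk hkn
  have hx0 : 0 < x := hx₀pos.trans_le hxx₀
  set G := g x with hG
  have hG0 : 0 ≤ G := hg.nonneg x hx0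
  have hGx : G ≤ x := hg.le_self x hx0
  have hrisk := hg.risk_le x hx0
  have hrisk1 := hrisk.trans (min_le_left _ _)
  have hrisk2 := hrisk.trans (min_le_right _ _)
  have hGlow := hg1 x G hx0.le hG0 hrisk1
  set U := Real.log (1 + x) with hU
  set Y := Real.log (Real.log n) / 2 with hY
  set κ := Real.log k with hκ
  have hκ0 : 0 ≤ κ := Real.log_nonneg hk'
  have hUYk : |U - Y| ≤ C₁ + κ := hUY α n k hα2 hαlt hn hk hkn
  set Λ := Real.log (max 1 (Real.log x)) with hΛ
  set P := Real.log (logPlus (Real.log n)) with hP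
  have hΛP : |Λ - P| ≤ 1 + 1 / x₀ + (C₁ + κ) := by
    have e1 := abs_log_max_one_sub_le (Real.log x) Y
    have e2 := abs_log_max_one_two_mul_sub_le Y
    have e3 : P = Real.log (max 1 (2 * Y)) := by
      rw [hP, logPlus, hY]
      congr 2
      ring
    have e4 : |Real.log x - U| ≤ 1 / x₀ := by
      rw [abs_sub_comm, hU, ← Real.log_div (by positivity) (by positivity)]
      have h3 : (1 + x) / x = 1 + 1 / x := by field_simp; ring
      rw [h3, abs_of_nonneg (Real.log_nonneg (by
        have : 0 < 1 / x := by positivity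
        linarith))]
      have h4 := Real.log_le_sub_one_of_pos (x := 1 + 1 / x) (by positivity)
      have h5 : 1 / x ≤ 1 / x₀ := one_div_le_one_div_of_le hx₀pos hxx₀
      linarith
    have e5 := abs_sub_le (Real.log x) U Y
    have e6 := abs_sub_le Λ (Real.log (max 1 Y)) P
    rw [← e3, abs_sub_comm] at e2
    linarith
  set E := D + κ - Real.log n + (3 - c₁) * U - c₂ * Λ with hE
  have hexpU : Real.exp U = 1 + x := Real.exp_log (by linarith)
  have hGE : -(G ^ 2) / 2 ≤ E := by
    have h6 : Phi (-x) ≤ Real.exp (κ - Real.log n) := by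
      rw [Phi_neg_xi hα0 hαlt (by omega) hk (by omega), Real.exp_sub, Real.exp_log (by linarith),
        Real.exp_log (by linarith), div_le_div_iff₀ (by positivity) (by positivity)]
      have : α * k ≤ 1 * k := by gcongr
      nlinarith
    have h7 := neg_sq_half_le_of_risk_le hc hM hg.c₁_pos.le hg.c₁_le hx0 hG0 hGx (hR G hG0)
      hrisk2 h6
    have e : E = D + (κ - Real.log n) + (3 - c₁) * U - c₂ * Λ := by rw [hE]; ring
    rw [e]
    convert h7 using 2
  have hs : 1 ≤ √(1 + δ) := Real.one_le_sqrt.2 (by linarith)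
  have hs2 : √(1 + δ) ^ 2 = 1 + δ := Real.sq_sqrt (by linarith)
  have hstep := softRisk_zero_le (l := √(1 + δ) * G) (by positivity)
  have h3 : softRisk 0 (√(1 + δ) * G) ≤ 8 * Cg ^ 3 * Real.exp (-3 * U + (1 + δ) * E) := by
    refine hstep.trans ?_
    have h4 : Real.exp (-(√(1 + δ) * G) ^ 2 / 2) ≤ Real.exp ((1 + δ) * E) := by
      apply Real.exp_le_exp.2
      rw [mul_pow, hs2]
      calc -((1 + δ) * G ^ 2) / 2 = (1 + δ) * (-(G ^ 2) / 2) := by ring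
        _ ≤ _ := mul_le_mul_of_nonneg_left hGE (by positivity)
    have h5 : Real.exp (3 * U) ≤ Cg ^ 3 * (1 + √(1 + δ) * G) ^ 3 := by
      rw [show (3 : ℝ) * U = ((3 : ℕ) : ℝ) * U by norm_num, Real.exp_nat_mul, hexpU, ← mul_pow]
      gcongr
      refine hGlow.trans ?_
      gcongr
      exact le_mul_of_one_le_left hG0 hs
    rw [div_le_iff₀ (by positivity), Real.exp_add, neg_mul, Real.exp_neg]
    calc 8 * Real.exp (-(√(1 + δ) * G) ^ 2 / 2) ≤ 8 * Real.exp ((1 + δ) * E) := by gcongr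
      _ = 8 * ((Real.exp (3 * U))⁻¹ * Real.exp ((1 + δ) * E)) * Real.exp (3 * U) := by
          field_simp
      _ ≤ 8 * ((Real.exp (3 * U))⁻¹ * Real.exp ((1 + δ) * E)) *
          (Cg ^ 3 * (1 + √(1 + δ) * G) ^ 3) := by gcongr
      _ = _ := by ring
  have h4 := exp_le_tau2 (c₁ := c₁) (c₂ := c₂) hδ hn
  have h5 : -3 * U + (1 + δ) * E ≤ Z + B * κ + (-3 * Y + (1 + δ) * ((3 - c₁) * Y - c₂ * P)
      - (1 + δ) * Real.log n) := by
    exact exponent_le hA hM (by positivity) hδ hδA hg.c₁_pos hg.c₁_le hg.abs_c₂_le hκ0 hUYk hΛP hB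
  have hkB : (k : ℝ) ^ B = Real.exp (B * κ) := by
    rw [Real.exp_nat_mul, hκ, Real.exp_log (by linarith)]
  calc softRisk 0 (√(1 + δ) * G) ≤ 8 * Cg ^ 3 * Real.exp (-3 * U + (1 + δ) * E) := h3
    _ ≤ 8 * Cg ^ 3 * Real.exp (Z + B * κ + (-3 * Y + (1 + δ) * ((3 - c₁) * Y - c₂ * P)
      - (1 + δ) * Real.log n)) := by gcongr
    _ = 8 * Cg ^ 3 * Real.exp Z * Real.exp (-3 * Y + (1 + δ) * ((3 - c₁) * Y - c₂ * P)
      - (1 + δ) * Real.log n) * k ^ B := by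
        rw [Real.exp_add, Real.exp_add Z, hkB]
        ring
    _ ≤ _ := by gcongr

lemma tau2_pos {δ c₁ c₂ : ℝ} (hδ : 0 ≤ δ) {n : ℕ} (hn : 2 ≤ n) : 0 < tau2 δ c₁ c₂ n :=
  (Real.exp_pos _).trans_le (exp_le_tau2 hδ hn)

/-! ### Logarithmic rates, the cutoff index and the bound for a level that is too low -/

lemma one_div_one_add_sq_le {C y T : ℝ} (hC : 1 ≤ C) (hy : 0 ≤ y) (h : T ≤ C * (1 + y) ^ 2) :
    1 / (1 + y) ^ 2 ≤ C * (1 / max 1 T) := by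
  have h1 : (1 : ℝ) ≤ (1 + y) ^ 2 := one_le_pow₀ (by linarith)
  rw [mul_one_div, div_le_div_iff₀ (by positivity) (by positivity), one_mul]
  exact max_le (by nlinarith) h

/-- The rate `1 / log (n / S)`, up to a constant, where `S` is a total risk. -/
def logRate (n : ℕ) (S : ℝ) : ℝ := 1 / max 1 (Real.log (8 / (S / n)))

lemma logRate_pos (n : ℕ) (S : ℝ) : 0 < logRate n S := by
  unfold logRate
  positivity

lemma exists_one_div_le_logRate_of_risk : ∃ C : ℝ, 1 ≤ C ∧ ∀ (n : ℕ) (θ : Fin n → ℝ) (l : ℝ),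
    1 ≤ n → 0 ≤ l → 1 / (1 + l) ^ 2 ≤ C * logRate n (∑ i, refRisk (θ i) l) := by
  obtain ⟨c, hc, h⟩ := exists_exp_sq_le_softRisk
  refine ⟨1 + |Real.log (8 / c)|, by linarith [abs_nonneg (Real.log (8 / c))], ?_⟩
  intro n θ l hn hl
  have hn' : (0 : ℝ) < n := by exact_mod_cast hn
  have h1 : softRisk 0 l ≤ (∑ i, refRisk (θ i) l) / n := by
    rw [le_div_iff₀ hn']
    calc softRisk 0 l * n = ∑ _i : Fin n, softRisk 0 l := by simp [mul_comm]
      _ ≤ _ := Finset.sum_le_sum fun i _ => by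
        unfold refRisk
        linarith [min_sq_nonneg (θ i) l]
  exact one_div_one_add_sq_le (by linarith [abs_nonneg (Real.log (8 / c))]) hl
    (log_le_of_exp_sq_le hc ((softRisk_zero_pos hl).trans_le h1) hl ((h l hl).trans h1))

lemma exists_one_div_le_logRate_of_Phi {D : ℝ} (hD : 0 < D) : ∃ C : ℝ, 1 ≤ C ∧
    ∀ (n : ℕ) (S y : ℝ), 1 ≤ n → 0 < S → 0 ≤ y → Phi (-y) ≤ D * (S / n) →
    1 / (1 + y) ^ 2 ≤ C * logRate n S := by
  obtain ⟨c, hc, h⟩ := exists_exp_sq_le_Phi_neg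
  refine ⟨1 + |Real.log (8 / (c / D))|, by linarith [abs_nonneg (Real.log (8 / (c / D)))], ?_⟩
  intro n S y hn hS hy hP
  have hn' : (0 : ℝ) < n := by exact_mod_cast hn
  refine one_div_one_add_sq_le (by linarith [abs_nonneg (Real.log (8 / (c / D)))]) hy
    (log_le_of_exp_sq_le (by positivity) (by positivity) hy ?_)
  rw [div_mul_eq_mul_div, div_le_iff₀ hD, mul_comm _ D]
  exact (h y hy).trans hP

lemma exists_one_div_xi_one_le : ∃ C : ℝ, 1 ≤ C ∧ ∀ (α : ℝ) (n : ℕ), 0 < α → α < 1 → 1 ≤ n →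
    1 / (1 + xi α n 1) ^ 2 ≤ C * (1 / max 1 (Real.log n)) := by
  obtain ⟨C, hC, h⟩ := exists_log_le_one_add_xi
  exact ⟨C, hC, fun α n h0 h1 hn =>
    one_div_one_add_sq_le hC (xi_pos h0 h1 hn le_rfl hn).le (h α n h0 h1 hn)⟩

lemma exists_last_or_forall (p : ℕ → Prop) (n : ℕ) :
    (∀ k, 1 ≤ k → k ≤ n → p k) ∨
      ∃ j, 1 ≤ j ∧ j ≤ n ∧ ¬ p j ∧ ∀ k, j < k → k ≤ n → p k := by
  classical
  by_cases h : ∀ k, 1 ≤ k → k ≤ n → p k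
  · exact Or.inl h
  · right
    push Not at h
    obtain ⟨k₀, hk1, hkn, hk⟩ := h
    have hex : ∃ k, k ≤ n ∧ (1 ≤ k ∧ ¬ p k) := ⟨k₀, hkn, hk1, hk⟩
    set j := Nat.findGreatest (fun k => 1 ≤ k ∧ ¬ p k) n with hj
    have hjs : 1 ≤ j ∧ ¬ p j := Nat.findGreatest_spec (P := fun k => 1 ≤ k ∧ ¬ p k) hkn ⟨hk1, hk⟩
    refine ⟨j, hjs.1, Nat.findGreatest_le n, hjs.2, fun k hjk hkn => ?_⟩
    by_contra hp
    exact Nat.findGreatest_is_greatest hjk hkn ⟨by omega, hp⟩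

/-- Either every index has few expected exceedances, and then `K = 1` with `ρ` of order `τ*` and `v`
of order `1/log n`. Or there is a last bad index `j`, and then `K ≤ 2j` and `ρ = 2K/n` follows from
the crude bound `4Φ(-x)` on the risk. In that case `nρ` is at most `4j ≲ S/(1+ξ_j)²`, and `j ≲ S`
makes `1/(1+ξ_j)²` at most of order `logRate`. -/
lemma exists_cutoff {α₁' α₂' A M₀ : ℝ} (h2 : 0 < α₂') (h21 : α₂' < α₁')
    (h1 : α₁' < 1) (hA : 0 < A) (hM : 0 < M₀) : ∃ (C : ℝ) (B : ℕ), 0 < C ∧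
    ∀ (α δ c₁ c₂ : ℝ) (g : ℝ → ℝ) (n : ℕ) (θ : Fin n → ℝ) (l : ℝ), α₂' ≤ α → α ≤ α₁' →
    0 ≤ δ → δ ≤ A → LevelCond M₀ c₁ c₂ g → 2 ≤ n → 0 ≤ l →
    ∃ (K : ℕ) (ρ v : ℝ), 1 ≤ K ∧ K ≤ n ∧
    (∀ k, K < k → k ≤ n → ∑ i, pAbove (θ i) (xi α n k) ≤ (1 + α₁') / 2 * k) ∧
    softRisk 0 (√(1 + δ) * g (xi α n K)) ≤ ρ ∧
    (∀ k, K < k → k ≤ n → softRisk 0 (√(1 + δ) * g (xi α n k)) ≤ ρ * k ^ B) ∧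
    1 / (1 + xi α n K) ^ 2 ≤ v ∧
    v * (∑ i, refRisk (θ i) l) + n * ρ ≤
      C * ((logRate n (∑ i, refRisk (θ i) l) + 1 / max 1 (Real.log n)) *
        (∑ i, refRisk (θ i) l) + n * tau2 δ c₁ c₂ n) := by
  obtain ⟨C₁, B, hC₁, hτ⟩ := exists_softRisk_level_le_tau2 h2 h21 h1 hA hM
  obtain ⟨C₂, hC₂, hlog⟩ := exists_one_div_xi_one_le
  obtain ⟨C₃, hC₃, hlev⟩ := exists_level_le_sum_refRisk h2 h21 h1
  obtain ⟨C₄, hC₄, hrate⟩ := exists_one_div_le_logRate_of_Phi hC₃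
  refine ⟨C₁ + C₂ + (1 + 4 * C₃) * C₄, B + 1, by positivity, ?_⟩
  intro α δ c₁ c₂ g n θ l hα2 hα1 hδ hδA hg hn hl
  have hα0 : 0 < α := h2.trans_le hα2
  have hαlt : α < 1 := hα1.trans_lt h1
  have hn' : (2 : ℝ) ≤ n := by exact_mod_cast hn
  have hn1 : 1 ≤ n := by omega
  set S := ∑ i, refRisk (θ i) l with hS
  have hS0 : 0 < S := by
    have : Nonempty (Fin n) := ⟨⟨0, by omega⟩⟩
    exact Finset.sum_pos (fun i _ => refRisk_pos hl _) Finset.univ_nonempty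
  have hτ0 : 0 < tau2 δ c₁ c₂ n := tau2_pos hδ hn
  have hr0 : 0 < logRate n S := logRate_pos n S
  rcases exists_last_or_forall (fun k => ∑ i, pAbove (θ i) (xi α n k) ≤ (1 + α₁') / 2 * k) n with
    hall | ⟨j, hj1, hjn, hj, hjk⟩
  · refine ⟨1, C₁ * tau2 δ c₁ c₂ n, C₂ * (1 / max 1 (Real.log n)), le_rfl, hn1,
      fun k hk hkn => hall k hk.le hkn, ?_, ?_, hlog α n hα0 hαlt hn1, ?_⟩
    · simpa using hτ α δ c₁ c₂ g n 1 hα2 hα1 hδ hδA hg hn le_rfl hn1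
    · intro k hk hkn
      refine (hτ α δ c₁ c₂ g n k hα2 hα1 hδ hδA hg hn hk.le hkn).trans ?_
      have hk' : (1 : ℝ) ≤ k := by exact_mod_cast hk.le
      gcongr
      omega
    · have e0 : (0 : ℝ) < 1 / max 1 (Real.log n) := by positivity
      have e1 : 0 ≤ n * tau2 δ c₁ c₂ n := by positivity
      have e2 : 0 ≤ logRate n S * S := by positivity
      have e3 : 0 ≤ 1 / max 1 (Real.log n) * S := by positivity
      have e4 : 0 ≤ (1 + 4 * C₃) * C₄ := by positivity
      calc C₂ * (1 / max 1 (Real.log n)) * S + n * (C₁ * tau2 δ c₁ c₂ n)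
          = C₂ * (1 / max 1 (Real.log n) * S) + C₁ * (n * tau2 δ c₁ c₂ n) := by ring
        _ ≤ (C₁ + C₂ + (1 + 4 * C₃) * C₄) * (logRate n S * S + 1 / max 1 (Real.log n) * S) +
            (C₁ + C₂ + (1 + 4 * C₃) * C₄) * (n * tau2 δ c₁ c₂ n) := by
          gcongr
          · linarith
          · linarith
          · linarith
        _ = _ := by ring
  · have hjS : (j : ℝ) ≤ C₃ * S / (1 + xi α n j) ^ 2 :=
      hlev α n j θ l hα2 hα1 hn1 hj1 hjn hl (not_le.1 hj)
    have hξj : 0 < xi α n j := xi_pos hα0 hαlt hn1 hj1 hjn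
    have hjS' : (j : ℝ) ≤ C₃ * S := by
      refine hjS.trans (div_le_self (by positivity) (one_le_pow₀ (by linarith)))
    have hj' : (1 : ℝ) ≤ j := by exact_mod_cast hj1
    obtain ⟨K, hK1, hKn, hjK, hK2⟩ : ∃ K : ℕ, 1 ≤ K ∧ K ≤ n ∧ j ≤ K ∧ K ≤ 2 * j ∧
        ∀ k, K < k → k ≤ n → j < k :=
      ⟨min (j + 1) n, by omega, by omega, by omega, by omega, fun k hk hkn => by omega⟩
    have hK' : (1 : ℝ) ≤ K := by exact_mod_cast hK1
    have hK2j : (K : ℝ) ≤ 2 * j := by exact_mod_cast hK2.1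
    have hξK : 0 < xi α n K := xi_pos hα0 hαlt hn1 hK1 hKn
    have hPhi : ∀ k : ℕ, 1 ≤ k → k ≤ n → (k : ℝ) ≤ 2 * j → Phi (-xi α n k) ≤ C₃ * (S / n) := by
      intro k hk hkn hkj
      rw [Phi_neg_xi hα0 hαlt hn1 hk (by omega), ← mul_div_assoc,
        div_le_div_iff₀ (by positivity) (by positivity)]
      have : α * k ≤ 1 * (2 * j) := by gcongr
      nlinarith
    have hrisk : ∀ k, 1 ≤ k → k ≤ n → softRisk 0 (√(1 + δ) * g (xi α n k)) ≤ 2 * k / n := by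
      intro k hk hkn
      have hξ : 0 < xi α n k := xi_pos hα0 hαlt hn1 hk hkn
      have hs : 1 ≤ √(1 + δ) := Real.one_le_sqrt.2 (by linarith)
      have hg0 := hg.nonneg _ hξ
      refine (softRisk_zero_anti hg0 (le_mul_of_one_le_left hg0 hs)).trans
        (((hg.risk_le _ hξ).trans (min_le_left _ _)).trans ?_)
      rw [Phi_neg_xi hα0 hαlt hn1 hk (by omega), ← mul_div_assoc,
        div_le_div_iff₀ (by positivity) (by positivity)]
      have : α * k ≤ 1 * k := by gcongr
      nlinarith
    refine ⟨K, 2 * K / n, C₄ * logRate n S, hK1, hKn, fun k hk hkn => hjk k (hK2.2 k hk hkn) hkn,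
      hrisk K hK1 hKn, ?_, ?_, ?_⟩
    · intro k hk hkn
      have hk' : (1 : ℝ) ≤ k := by exact_mod_cast (hK1.trans hk.le)
      calc softRisk 0 (√(1 + δ) * g (xi α n k)) ≤ 2 * k / n := hrisk k (by omega) hkn
        _ ≤ 2 * K / n * k := by
          rw [div_mul_eq_mul_div]
          gcongr
          nlinarith
        _ ≤ _ := by
          gcongr
          exact le_self_pow₀ hk' (by omega)
    · exact hrate n S _ hn1 hS0 hξK.le (hPhi K hK1 hKn hK2j)
    · have hvj := hrate n S _ hn1 hS0 hξj.le (hPhi j hj1 hjn (by linarith))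
      have e1 : 0 ≤ n * tau2 δ c₁ c₂ n := by positivity
      have e2 : 0 ≤ logRate n S * S := by positivity
      have e3 : 0 ≤ 1 / max 1 (Real.log n) * S := by positivity
      have e5 : (n : ℝ) * (2 * K / n) ≤ 4 * C₃ * C₄ * (logRate n S * S) := by
        calc (n : ℝ) * (2 * K / n) = 2 * K := by field_simp
          _ ≤ 4 * j := by linarith
          _ ≤ 4 * (C₃ * S * (1 / (1 + xi α n j) ^ 2)) := by rw [mul_one_div]; gcongr
          _ ≤ 4 * (C₃ * S * (C₄ * logRate n S)) := by gcongr
          _ = _ := by ring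
      calc C₄ * logRate n S * S + n * (2 * K / n)
          ≤ (1 + 4 * C₃) * C₄ * (logRate n S * S) := by linarith
        _ ≤ (C₁ + C₂ + (1 + 4 * C₃) * C₄) *
            (logRate n S * S + (1 / max 1 (Real.log n) * S + n * tau2 δ c₁ c₂ n)) := by
          gcongr
          · linarith
          · linarith
        _ = _ := by ring

lemma LevelCond.monotoneOn {M₀ c₁ c₂ : ℝ} {g : ℝ → ℝ} (hg : LevelCond M₀ c₁ c₂ g) :
    MonotoneOn g (Set.Ioi 0) := by
  refine monotoneOn_of_deriv_nonneg (convex_Ioi 0)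
    (fun x hx => (hg.differentiable x hx).continuousAt.continuousWithinAt) ?_ ?_
  · rw [interior_Ioi]
    exact fun x hx => (hg.differentiable x hx).differentiableWithinAt
  · rw [interior_Ioi]
    exact fun x hx => hg.deriv_nonneg x hx

lemma exists_majorant_upLoss_level {α₁' α₂' A M₀ : ℝ} (h2 : 0 < α₂') (h21 : α₂' < α₁')
    (h1 : α₁' < 1) (hA : 0 < A) (hM : 0 < M₀) : ∃ C : ℝ, 0 < C ∧
    ∀ (α δ c₁ c₂ : ℝ) (g : ℝ → ℝ) (n : ℕ) (θ : Fin n → ℝ) (l : ℝ), α₂' ≤ α → α ≤ α₁' →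
    0 ≤ δ → δ ≤ A → LevelCond M₀ c₁ c₂ g → 2 ≤ n → 0 ≤ l →
    ∃ H : (Fin n → ℝ) → ℝ, Integrable H (normalMeans θ) ∧
    (∀ x, ∑ i, upLoss (θ i) (√(1 + δ) * g (xiHat1 α x)) (x i) ≤ H x) ∧
    ∫ x, H x ∂(normalMeans θ) ≤
      C * ((logRate n (∑ i, refRisk (θ i) l) + 1 / max 1 (Real.log n)) *
        (∑ i, refRisk (θ i) l) + n * tau2 δ c₁ c₂ n) := by
  obtain ⟨C₁, B, hC₁, hcut⟩ := exists_cutoff h2 h21 h1 hA hM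
  have hα1' : 0 < α₁' := h2.trans h21
  obtain ⟨C₂, hC₂, hup⟩ := exists_majorant_upLoss (β := (1 + α₁') / 2) (by linarith)
    (by linarith) B
  obtain ⟨C₃, hC₃, hg1⟩ := exists_one_add_le_of_risk_le
  obtain ⟨C₄, hC₄, hl1⟩ := exists_one_div_le_logRate_of_risk
  refine ⟨C₂ * (6 * C₃ ^ 2 * C₁ + C₄), by positivity, ?_⟩
  intro α δ c₁ c₂ g n θ l hα2 hα1 hδ hδA hg hn hl
  have hα0 : 0 < α := h2.trans_le hα2
  have hαlt : α < 1 := hα1.trans_lt h1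
  have hn1 : 1 ≤ n := by omega
  have hs : 1 ≤ √(1 + δ) := Real.one_le_sqrt.2 (by linarith)
  obtain ⟨K, ρ, v, hK1, hKn, hβ, hρ, hρk, hv, hbound⟩ :=
    hcut α δ c₁ c₂ g n θ l hα2 hα1 hδ hδA hg hn hl
  set S := ∑ i, refRisk (θ i) l with hS
  have hS0 : 0 ≤ S := Finset.sum_nonneg fun i _ => (refRisk_pos hl _).le
  have hξ : ∀ k, 1 ≤ k → k ≤ n → 0 < xi α n k := fun k hk hkn => xi_pos hα0 hαlt hn1 hk hkn
  have hv0 : 0 ≤ v := le_trans (by positivity) hv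
  have hK := hξ K hK1 hKn
  have hρ0 : 0 ≤ ρ :=
    (softRisk_zero_pos (mul_nonneg (Real.sqrt_nonneg _) (hg.nonneg _ hK))).le.trans hρ
  have hak : ∀ k, 1 ≤ k → k ≤ n →
      1 / (1 + √(1 + δ) * g (xi α n k)) ^ 2 ≤ C₃ ^ 2 * (1 / (1 + xi α n k) ^ 2) := by
    intro k hk hkn
    have hx := hξ k hk hkn
    have hg0 := hg.nonneg _ hx
    have h3 := hg1 _ _ hx.le hg0 ((hg.risk_le _ hx).trans (min_le_left _ _))
    have h4 : g (xi α n k) ≤ √(1 + δ) * g (xi α n k) := le_mul_of_one_le_left hg0 hs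
    rw [mul_one_div, div_le_div_iff₀ (by positivity) (by positivity), one_mul, ← mul_pow]
    gcongr
    exact h3.trans (by gcongr)
  obtain ⟨H, hHi, hH, hHint⟩ := hup n K θ l ρ (6 * C₃ ^ 2 * v) (fun k => xi α n k)
    (fun k => √(1 + δ) * g (xi α n k)) (fun x => √(1 + δ) * g (xiHat1 α x)) hl hK1 hKn
    (fun k hk hkn => mul_nonneg (Real.sqrt_nonneg _) (hg.nonneg _ (hξ k hk hkn)))
    (fun k hk hkK => by
      have := hg.monotoneOn hK (hξ k hk (hkK.trans hKn)) (xi_anti hα0 hαlt hn1 hk hkK (by omega))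
      gcongr)
    (fun x => by
      obtain ⟨k, hk, hkn, hor, heq⟩ := exists_xiHat1_eq α hn1 x
      exact ⟨k, hk, hkn, hor, by rw [heq]⟩)
    hβ hρ hρk
    ((hak K hK1 hKn).trans (by
      have : C₃ ^ 2 * (1 / (1 + xi α n K) ^ 2) ≤ C₃ ^ 2 * v := by gcongr
      have : 0 ≤ C₃ ^ 2 * v := by positivity
      linarith))
    (fun k hk hkn => (hak k (by omega) hkn).trans (by
      have hx := hξ k (by omega) hkn
      have h5 := one_add_xi_sq_le hα0 hαlt hn1 hK1 hk.le hkn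
      have h6 : 1 / (1 + xi α n k) ^ 2 ≤ 6 * k * (1 / (1 + xi α n K) ^ 2) := by
        rw [mul_one_div, div_le_div_iff₀ (by positivity) (by positivity), one_mul]
        exact h5
      calc C₃ ^ 2 * (1 / (1 + xi α n k) ^ 2) ≤ C₃ ^ 2 * (6 * k * (1 / (1 + xi α n K) ^ 2)) := by
            gcongr
        _ ≤ C₃ ^ 2 * (6 * k * v) := by gcongr
        _ = _ := by ring))
  refine ⟨H, hHi, hH, hHint.trans ?_⟩
  have hl2 := hl1 n θ l hn1 hl
  rw [← hS] at hl2
  rw [← hS, mul_assoc C₂]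
  gcongr C₂ * ?_
  have hτ0 := tau2_pos (c₁ := c₁) (c₂ := c₂) hδ hn
  have e0 : (0 : ℝ) < 1 / max 1 (Real.log n) := by positivity
  have hC3 : 1 ≤ 6 * C₃ ^ 2 := by nlinarith
  calc n * ρ + (6 * C₃ ^ 2 * v + 1 / (1 + l) ^ 2) * S
      ≤ (6 * C₃ ^ 2) * (n * ρ) + (6 * C₃ ^ 2 * v + 1 / (1 + l) ^ 2) * S := by
        have := le_mul_of_one_le_left (mul_nonneg n.cast_nonneg hρ0) hC3
        linarith
    _ = 6 * C₃ ^ 2 * (v * S + n * ρ) + 1 / (1 + l) ^ 2 * S := by ring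
    _ ≤ 6 * C₃ ^ 2 * (C₁ * ((logRate n S + 1 / max 1 (Real.log n)) * S + n * tau2 δ c₁ c₂ n)) +
        C₄ * logRate n S * S := by gcongr
    _ = 6 * C₃ ^ 2 * C₁ * ((logRate n S + 1 / max 1 (Real.log n)) * S + n * tau2 δ c₁ c₂ n) +
        C₄ * (logRate n S * S) := by ring
    _ ≤ 6 * C₃ ^ 2 * C₁ * ((logRate n S + 1 / max 1 (Real.log n)) * S + n * tau2 δ c₁ c₂ n) +
        C₄ * ((logRate n S + 1 / max 1 (Real.log n)) * S + n * tau2 δ c₁ c₂ n) := by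
        gcongr
        have : 0 ≤ n * tau2 δ c₁ c₂ n := by positivity
        have : 0 ≤ 1 / max 1 (Real.log n) * S := by positivity
        linarith
    _ = _ := by ring

/-! ### Assembly: the root risk bound and adaptive ratio optimality -/

lemma integrable_sqLoss {κ₀ κ₁ : ℝ} {t : ℝ → ℝ → ℝ} (ht : IsSmoothThreshold κ₀ κ₁ t)
    (hκ : κ₀ < 2) {n : ℕ} (θ : Fin n → ℝ) {lam : (Fin n → ℝ) → ℝ} (hm : Measurable lam)
    (h0 : ∀ x, 0 ≤ lam x) :
    Integrable (fun x => sqLoss θ (thresholdEst t lam x)) (normalMeans θ) := by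
  unfold sqLoss thresholdEst
  refine integrable_finsetSum _ fun i _ => ?_
  have hdom : Integrable (fun x : Fin n → ℝ => 2 * (x i) ^ 2 + 2 * (θ i) ^ 2) (normalMeans θ) :=
    integrable_coord θ i (f := fun y => 2 * y ^ 2 + 2 * (θ i) ^ 2)
      (integrable_of_abs_le_sq (by fun_prop) (A := 2 * (θ i) ^ 2) (B := 2)
        fun y => by rw [abs_of_nonneg (by positivity)]; linarith)
  have hmeas : Measurable fun x : Fin n → ℝ => t (lam x) (x i) := by
    have h1 := ht.continuous_uncurry.measurable.comp (hm.prodMk (measurable_pi_apply i))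
    have h2 : (fun x : Fin n → ℝ => t (lam x) (x i)) =
        (fun p : ℝ × ℝ => t (max p.1 0) p.2) ∘ fun x => (lam x, x i) := by
      funext x
      simp [max_eq_left (h0 x)]
    rwa [h2]
  refine hdom.mono' ((hmeas.sub_const _).pow_const 2).aestronglyMeasurable
    (Eventually.of_forall fun x => ?_)
  rw [Real.norm_of_nonneg (sq_nonneg _)]
  have h1 : (t (lam x) (x i)) ^ 2 ≤ (x i) ^ 2 := sq_le_sq.2 (ht.abs_le hκ (h0 x) (x i))
  nlinarith [sq_nonneg (t (lam x) (x i) + θ i)]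

lemma sqrt_le_sqrt_add_sqrt {m R V : ℝ} (hR : 0 < R) (hV : 0 < V)
    (h : ∀ ε, 0 < ε → m ≤ (1 + ε) * R + (1 + 1 / ε) * V) : √m ≤ √R + √V := by
  have hR' := Real.sqrt_pos.2 hR
  have hV' := Real.sqrt_pos.2 hV
  -- This `ε` minimizes the right side, which becomes the perfect square `(√R + √V)²`.
  refine Real.sqrt_le_iff.2 ⟨by positivity, (h (√V / √R) (by positivity)).trans (le_of_eq ?_)⟩
  have e1 : √V / √R * R = √V * √R := by
    nth_rewrite 2 [← Real.sq_sqrt hR.le]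
    field_simp
  have e2 : 1 / (√V / √R) * V = √V * √R := by
    nth_rewrite 2 [← Real.sq_sqrt hV.le]
    field_simp
  rw [add_mul, add_mul, e1, e2, add_sq, Real.sq_sqrt hR.le, Real.sq_sqrt hV.le]
  ring

lemma logRate_le {n : ℕ} {S η : ℝ} (hn : 0 < n) (hS : 0 < S) (h : η = 0 ∨ S ≤ 8 * n * η) :
    logRate n S ≤ 3 * (1 / L1 η) := by
  have he : Real.exp 1 ≤ 3 := Real.exp_one_lt_three.le
  have hn' : (0 : ℝ) < n := by exact_mod_cast hn
  have hL : 0 < L1 η := (Real.exp_pos 1).trans_le (le_max_left _ _)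
  unfold logRate
  rw [mul_one_div, div_le_div_iff₀ (by positivity) hL, one_mul]
  refine max_le (by nlinarith [le_max_left 1 (Real.log (8 / (S / n)))]) ?_
  rcases h with rfl | h
  · simp only [div_zero, Real.log_zero]
    positivity
  · have hη : 0 < η := by
      by_contra hη
      have : 8 * (n : ℝ) * η ≤ 0 := mul_nonpos_of_nonneg_of_nonpos (by positivity) (not_lt.1 hη)
      linarith
    have h1 : Real.log (1 / η) ≤ Real.log (8 / (S / n)) := by
      refine Real.log_le_log (by positivity) ?_
      rw [div_div_eq_mul_div, div_le_div_iff₀ hη hS]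
      linarith
    have h2 := le_max_right 1 (Real.log (8 / (S / n)))
    have h3 := le_max_left 1 (Real.log (8 / (S / n)))
    linarith

lemma mse_nonneg {n : ℕ} (θ : Fin n → ℝ) (T : (Fin n → ℝ) → Fin n → ℝ) :
    0 ≤ mse θ T :=
  integral_nonneg fun _ => Finset.sum_nonneg fun _ _ => sq_nonneg _

lemma etaOpt_nonneg {n : ℕ} (θ : Fin n → ℝ) : 0 ≤ etaOpt θ :=
  div_nonneg (Real.iInf_nonneg fun _ => mse_nonneg θ _) n.cast_nonneg

lemma exists_lt_of_etaOpt_lt {n : ℕ} (hn : 0 < n) (θ : Fin n → ℝ) {y : ℝ} (h : etaOpt θ < y) :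
    ∃ l, 0 ≤ l ∧ (∑ i, softRisk (θ i) l) / n < y := by
  have hn' : (0 : ℝ) < n := by exact_mod_cast hn
  unfold etaOpt minSoftRisk at h
  rw [div_lt_iff₀ hn'] at h
  obtain ⟨⟨l, hl⟩, h⟩ := exists_lt_of_ciInf_lt h
  refine ⟨l, hl, ?_⟩
  rw [div_lt_iff₀ hn', ← mse_soft_const θ hl]
  exact h

/-- The requirements, for a single sample size, on a data-driven level with bounds of FDR type. -/
structure IsLevelAt (α₁ α₂ M₀ δ₁ δ₂ c₁ c₂ : ℝ) (g : ℝ → ℝ) {n : ℕ}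
    (lam : (Fin n → ℝ) → ℝ) : Prop where
  δ₁_nonneg : 0 ≤ δ₁
  δ₁_le : δ₁ ≤ δ₂
  level : LevelCond M₀ c₁ c₂ g
  measurable : Measurable lam
  lower : ∀ x, √(1 + δ₁) * g (xiHat1 α₁ x) ≤ lam x
  upper : ∀ x, lam x ≤ √(1 + δ₂) * xiHat2 α₂ x

lemma IsFDRLevel.isLevelAt {α₁ α₂ M₀ : ℝ} {δ₁ δ₂ c₁ c₂ : ℕ → ℝ} {g : ℕ → ℝ → ℝ}
    {lam : (n : ℕ) → (Fin n → ℝ) → ℝ} (h : IsFDRLevel α₁ α₂ M₀ δ₁ δ₂ c₁ c₂ g lam) {n : ℕ}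
    (hn : 2 ≤ n) : IsLevelAt α₁ α₂ M₀ (δ₁ n) (δ₂ n) (c₁ n) (c₂ n) (g n) (lam n) :=
  ⟨h.δ₁_nonneg n hn, h.δ₁_le n hn, h.level n hn, h.measurable n hn, h.lower n hn, h.upper n hn⟩

lemma IsLevelAt.lower_nonneg {α₁ α₂ M₀ δ₁ δ₂ c₁ c₂ : ℝ} {g : ℝ → ℝ} {n : ℕ}
    {lam : (Fin n → ℝ) → ℝ} (h : IsLevelAt α₁ α₂ M₀ δ₁ δ₂ c₁ c₂ g lam) (hn : 1 ≤ n)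
    (h0 : 0 < α₁) (h1 : α₁ < 1) (x : Fin n → ℝ) : 0 ≤ √(1 + δ₁) * g (xiHat1 α₁ x) := by
  obtain ⟨k, hk, hkn, -, heq⟩ := exists_xiHat1_eq α₁ hn x
  rw [heq]
  exact mul_nonneg (Real.sqrt_nonneg _) (h.level.nonneg _ (xi_pos h0 h1 hn hk hkn))

/-- The pointwise comparison is integrated against the two majorants. The number `ε` stays free
because its best value depends on the resulting risks. -/
lemma exists_mse_le {α₁' α₂' A M₀ : ℝ} (h2 : 0 < α₂') (h21 : α₂' < α₁')
    (h1 : α₁' < 1) (hA : 0 < A) (hM : 0 < M₀) : ∃ C : ℝ, 0 < C ∧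
    ∀ (α₁ α₂ κ₀ κ₁ : ℝ) (t : ℝ → ℝ → ℝ) (δ₁ δ₂ c₁ c₂ : ℝ) (g : ℝ → ℝ) (n : ℕ)
    (lam : (Fin n → ℝ) → ℝ) (θ : Fin n → ℝ) (l ε : ℝ), α₂' ≤ α₂ → α₂ ≤ α₁ → α₁ ≤ α₁' →
    κ₀ < 2 → IsSmoothThreshold κ₀ κ₁ t → 2 ≤ n → δ₁ ≤ A →
    IsLevelAt α₁ α₂ M₀ δ₁ δ₂ c₁ c₂ g lam → 0 ≤ l → 0 < ε →
    mse θ (thresholdEst t lam) ≤ (1 + ε) * (∑ i, softRisk (θ i) l) + (1 + 1 / ε) *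
      (C * ((δ₂ + logRate n (∑ i, refRisk (θ i) l) + 1 / max 1 (Real.log n)) *
        (∑ i, softRisk (θ i) l) + n * tau2 δ₁ c₁ c₂ n)) := by
  obtain ⟨C₁, hC₁, hup⟩ := exists_majorant_upLoss_level h2 h21 h1 hA hM
  obtain ⟨C₂, hC₂, hdown⟩ := exists_majorant_downLoss h2
  obtain ⟨C₃, hC₃, hl1⟩ := exists_one_div_le_logRate_of_risk
  refine ⟨4 * (C₁ + C₂ * C₃), by positivity, ?_⟩
  intro α₁ α₂ κ₀ κ₁ t δ₁ δ₂ c₁ c₂ g n lam θ l ε hα2 hα21 hα1 hκ ht hn hδA hlev hl hε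
  have hn1 : 1 ≤ n := by omega
  have hα10 : 0 < α₁ := h2.trans_le (hα2.trans hα21)
  have hlow := hlev.lower_nonneg hn1 hα10 (hα1.trans_lt h1)
  obtain ⟨H, hHi, hH, hHint⟩ := hup α₁ δ₁ c₁ c₂ g n θ l (hα2.trans hα21) hα1 hlev.δ₁_nonneg hδA
    hlev.level hn hl
  have hδ2 : 0 ≤ δ₂ := hlev.δ₁_nonneg.trans hlev.δ₁_le
  obtain ⟨G, hGi, hG, hGint⟩ := hdown α₂ n θ l δ₂ hα2 (hα21.trans_lt (hα1.trans_lt h1)) hn1 hl hδ2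
  have hint := integrable_sqLoss ht hκ θ hlev.measurable (fun x => (hlow x).trans (hlev.lower x))
  have hsoft : Integrable (fun x => sqLoss θ (thresholdEst soft (fun _ => l) x)) (normalMeans θ) :=
    integrable_sqLoss isSmoothThreshold_soft (by norm_num) θ measurable_const fun _ => hl
  have hle : mse θ (thresholdEst t lam) ≤ (1 + ε) * (∑ i, softRisk (θ i) l) +
      (1 + 1 / ε) * (∫ x, H x ∂(normalMeans θ) + ∫ x, G x ∂(normalMeans θ)) := by
    rw [← mse_soft_const θ hl, ← integral_add hHi hGi]
    unfold mse
    have hHG : Integrable (fun x => H x + G x) (normalMeans θ) := hHi.add hGi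
    rw [← integral_const_mul, ← integral_const_mul, ← integral_add (hsoft.const_mul _)
      (hHG.const_mul _)]
    refine integral_mono hint ((hsoft.const_mul _).add (hHG.const_mul _)) fun x => ?_
    calc sqLoss θ (thresholdEst t lam x)
        ≤ ∑ i, ((1 + ε) * (soft l (x i) - θ i) ^ 2 + (1 + 1 / ε) *
          (upLoss (θ i) (√(1 + δ₁) * g (xiHat1 α₁ x)) (x i) + min (downLoss (θ i) l (x i))
            ((max (√(1 + δ₂) * xiHat2 α₂ x - l) 0) ^ 2))) :=
          Finset.sum_le_sum fun i _ => ht.sq_loss_le hκ (hlow x) (hlev.lower x) (hlev.upper x) hl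
            hε (θ i) (x i)
      _ = (1 + ε) * sqLoss θ (thresholdEst soft (fun _ => l) x) + (1 + 1 / ε) *
          (∑ i, upLoss (θ i) (√(1 + δ₁) * g (xiHat1 α₁ x)) (x i) +
            ∑ i, min (downLoss (θ i) l (x i)) ((max (√(1 + δ₂) * xiHat2 α₂ x - l) 0) ^ 2)) := by
          rw [Finset.sum_add_distrib, ← Finset.mul_sum, ← Finset.mul_sum, Finset.sum_add_distrib]
          rfl
      _ ≤ _ := by
          have hε' : 0 ≤ 1 + 1 / ε := by positivity
          have := mul_le_mul_of_nonneg_left (add_le_add (hH x) (hG x)) hε'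
          exact add_le_add le_rfl this
  refine hle.trans ?_
  gcongr (1 + ε) * _ + (1 + 1 / ε) * ?_
  set S := ∑ i, refRisk (θ i) l with hS
  set R := ∑ i, softRisk (θ i) l with hR
  have hS0 : 0 ≤ S := Finset.sum_nonneg fun i _ => (refRisk_pos hl _).le
  have hSR : S ≤ 4 * R := by
    rw [hS, hR, Finset.mul_sum]
    exact Finset.sum_le_sum fun i _ => refRisk_le hl _
  have hl2 := hl1 n θ l hn1 hl
  rw [← hS] at hl2
  have hr := (logRate_pos n S).le
  have hτ := (tau2_pos (c₁ := c₁) (c₂ := c₂) hlev.δ₁_nonneg hn).le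
  have e0 : (0 : ℝ) ≤ 1 / max 1 (Real.log n) := by positivity
  set q := 1 / max 1 (Real.log n) with hq
  set r := logRate n S with hrd
  set τ := tau2 δ₁ c₁ c₂ n with hτd
  have a1 : (r + q) * S + n * τ ≤ 4 * ((δ₂ + r + q) * R + n * τ) := by
    have : (r + q) * S ≤ (δ₂ + r + q) * (4 * R) := by
      gcongr
      linarith
    have : 0 ≤ n * τ := by positivity
    linarith
  have a2 : (δ₂ + 1 / (1 + l) ^ 2) * S ≤ C₃ * (4 * ((δ₂ + r + q) * R + n * τ)) := by
    calc (δ₂ + 1 / (1 + l) ^ 2) * S ≤ (C₃ * δ₂ + C₃ * r) * S := by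
          gcongr
          exact le_mul_of_one_le_left hδ2 hC₃
      _ = C₃ * ((δ₂ + r) * S) := by ring
      _ ≤ C₃ * ((δ₂ + r + q) * (4 * R)) := by
          have : (δ₂ + r) * S ≤ (δ₂ + r + q) * (4 * R) :=
            mul_le_mul (by linarith) hSR hS0 (by positivity)
          gcongr
      _ ≤ _ := by
          have : 0 ≤ n * τ := by positivity
          exact mul_le_mul_of_nonneg_left (by linarith) (by linarith)
  calc ∫ x, H x ∂(normalMeans θ) + ∫ x, G x ∂(normalMeans θ)
      ≤ C₁ * (4 * ((δ₂ + r + q) * R + n * τ)) + C₂ * (C₃ * (4 * ((δ₂ + r + q) * R + n * τ))) :=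
        add_le_add (hHint.trans (by gcongr)) (hGint.trans (by gcongr))
    _ = _ := by ring

/-- No level need attain the infimum. The bound is proved with every `y > etaOpt θ` close to it in
place of `etaOpt θ`, using a level of risk below `y`, and passes to the limit by continuity of the
right side. -/
lemma exists_sqrt_mse_le {α₁' α₂' A M₀ : ℝ} (h2 : 0 < α₂') (h21 : α₂' < α₁')
    (h1 : α₁' < 1) (hA : 0 < A) (hM : 0 < M₀) : ∃ C : ℝ, 0 < C ∧
    ∀ (α₁ α₂ κ₀ κ₁ : ℝ) (t : ℝ → ℝ → ℝ) (δ₁ δ₂ c₁ c₂ : ℝ) (g : ℝ → ℝ) (n : ℕ)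
    (lam : (Fin n → ℝ) → ℝ) (θ : Fin n → ℝ) (η : ℝ), α₂' ≤ α₂ → α₂ ≤ α₁ → α₁ ≤ α₁' →
    κ₀ < 2 → IsSmoothThreshold κ₀ κ₁ t → 2 ≤ n → δ₁ ≤ A →
    IsLevelAt α₁ α₂ M₀ δ₁ δ₂ c₁ c₂ g lam → etaOpt θ ≤ η →
    √(mse θ (thresholdEst t lam) / n) ≤ √(etaOpt θ) +
      C * √((δ₂ + 1 / L1 η + 1 / max 1 (Real.log n)) * etaOpt θ + tau2 δ₁ c₁ c₂ n) := by
  obtain ⟨C, hC, hmse⟩ := exists_mse_le h2 h21 h1 hA hM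
  refine ⟨√(3 * C), by positivity, ?_⟩
  intro α₁ α₂ κ₀ κ₁ t δ₁ δ₂ c₁ c₂ g n lam θ η hα2 hα21 hα1 hκ ht hn hδA hlev hη
  have hn0 : 0 < n := by omega
  have hn' : (0 : ℝ) < n := by exact_mod_cast hn0
  have hδ2 : 0 ≤ δ₂ := hlev.δ₁_nonneg.trans hlev.δ₁_le
  have hτ := tau2_pos (c₁ := c₁) (c₂ := c₂) hlev.δ₁_nonneg hn
  have hL : 0 < L1 η := (Real.exp_pos 1).trans_le (le_max_left _ _)
  have hq : (0 : ℝ) ≤ 1 / max 1 (Real.log n) := by positivity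
  set q := 1 / max 1 (Real.log n) with hqd
  set τ := tau2 δ₁ c₁ c₂ n with hτd
  set w := δ₂ + 1 / L1 η + q with hw
  have hw0 : 0 ≤ w := by positivity
  set f : ℝ → ℝ := fun y => √y + √(3 * C) * √(w * y + τ) with hf
  have hfc : Continuous f := by rw [hf]; fun_prop
  have hfm : Monotone f := fun y y' h => by
    simp only [hf]
    gcongr
  have hlim : Tendsto f (𝓝[>] (etaOpt θ)) (𝓝 (f (etaOpt θ))) :=
    hfc.continuousAt.tendsto.mono_left nhdsWithin_le_nhds
  refine ge_of_tendsto hlim ?_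
  have hev : ∀ᶠ y in 𝓝[>] (etaOpt θ), η = 0 ∨ y ≤ 2 * η := by
    rcases eq_or_ne η 0 with h0 | h0
    · exact Eventually.of_forall fun _ => Or.inl h0
    · have hηpos : 0 < η := lt_of_le_of_ne ((etaOpt_nonneg θ).trans hη) (Ne.symm h0)
      have : Set.Iio (2 * η) ∈ 𝓝 (etaOpt θ) := Iio_mem_nhds (by linarith)
      filter_upwards [nhdsWithin_le_nhds this] with y hy
      exact Or.inr (le_of_lt hy)
  filter_upwards [hev, self_mem_nhdsWithin] with y hy hyη
  obtain ⟨l, hl, hly⟩ := exists_lt_of_etaOpt_lt hn0 θ hyη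
  refine le_trans ?_ (hfm hly.le)
  set R := ∑ i, softRisk (θ i) l with hR
  set S := ∑ i, refRisk (θ i) l with hS
  have hSpos : 0 < S := by
    have : Nonempty (Fin n) := ⟨⟨0, hn0⟩⟩
    exact Finset.sum_pos (fun i _ => refRisk_pos hl _) Finset.univ_nonempty
  have hSR : S ≤ 4 * R := by
    rw [hS, hR, Finset.mul_sum]
    exact Finset.sum_le_sum fun i _ => refRisk_le hl _
  have hRpos : 0 < R := by linarith
  have hrate : logRate n S ≤ 3 * (1 / L1 η) := by
    -- The factor 8 in `logRate` is used here: `S ≤ 4R`, and `R < 2ηn` by the choice of `y`.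
    refine logRate_le hn0 hSpos (hy.imp_right fun h => ?_)
    have : R < 2 * η * n := (div_lt_iff₀ hn').1 (hly.trans_le h)
    nlinarith
  have hr0 := logRate_pos n S
  set V := C * ((δ₂ + logRate n S + q) * R + n * τ) with hV
  have hVpos : 0 < V := by positivity
  have hkey := sqrt_le_sqrt_add_sqrt hRpos hVpos fun ε hε =>
    hmse α₁ α₂ κ₀ κ₁ t δ₁ δ₂ c₁ c₂ g n lam θ l ε hα2 hα21 hα1 hκ ht hn hδA hlev hl hε
  have hVle : V / n ≤ 3 * C * (w * (R / n) + τ) := by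
    rw [div_le_iff₀ hn']
    have e1 : 3 * C * (w * (R / n) + τ) * n = C * ((3 * w) * R + 3 * (n * τ)) := by
      field_simp
    rw [e1, hV]
    have : 0 ≤ n * τ := by positivity
    refine mul_le_mul_of_nonneg_left (add_le_add ?_ (by linarith)) hC.le
    exact mul_le_mul_of_nonneg_right (by linarith) hRpos.le
  simp only [hf]
  rw [← Real.sqrt_mul (by positivity), Real.sqrt_div' _ hn'.le]
  calc √(mse θ (thresholdEst t lam)) / √n ≤ (√R + √V) / √n := by gcongr
    _ = √(R / n) + √(V / n) := by
      rw [add_div, Real.sqrt_div' _ hn'.le, Real.sqrt_div' _ hn'.le]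
    _ ≤ _ := by gcongr

lemma one_div_L1_le (η : ℝ) : 1 / L1 η ≤ √(Real.log (L1 η)) / √(L1 η) := by
  have hL : Real.exp 1 ≤ L1 η := le_max_left _ _
  have hL0 : 0 < L1 η := (Real.exp_pos 1).trans_le hL
  have h1 : 1 ≤ L1 η := (Real.one_le_exp zero_le_one).trans hL
  have hlog : 1 ≤ √(Real.log (L1 η)) := Real.one_le_sqrt.2 ((Real.le_log_iff_exp_le hL0).2 hL)
  have hs : √(L1 η) ≤ L1 η := Real.sqrt_le_iff.2 ⟨hL0.le, le_self_pow₀ h1 two_ne_zero⟩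
  rw [div_le_div_iff₀ hL0 (Real.sqrt_pos.2 hL0)]
  exact mul_le_mul hlog hs (Real.sqrt_nonneg _) (Real.sqrt_nonneg _)

lemma rate_le_tau1 (δ₂ c₁ c₂ η : ℝ) (n : ℕ) :
    δ₂ + 1 / L1 η + 1 / max 1 (Real.log n) ≤ 3 * tau1 δ₂ c₁ c₂ η n := by
  have h1 : δ₂ ≤ tau1 δ₂ c₁ c₂ η n := (le_max_left _ _).trans (le_max_left _ _)
  have h2 : 1 / L1 η ≤ tau1 δ₂ c₁ c₂ η n :=
    (one_div_L1_le η).trans ((le_max_right _ _).trans (le_max_right _ _))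
  have h3 : 1 / max 1 (Real.log n) ≤ tau1 δ₂ c₁ c₂ η n := by
    refine le_trans ?_ ((le_max_right _ _).trans (le_max_left _ _))
    gcongr
    exact (Real.le_log_iff_exp_le (lt_max_of_lt_left (Real.exp_pos 1))).2 (le_max_left _ _)
  linarith

/-- The null risk is strictly positive, so its upper bound cannot have a nonpositive constant. The
optimality statement does not assume the sign. -/
lemma LevelCond.M₀_pos {M₀ c₁ c₂ : ℝ} {g : ℝ → ℝ} (hg : LevelCond M₀ c₁ c₂ g) : 0 < M₀ := by
  have h := (softRisk_zero_pos (hg.nonneg 1 one_pos)).trans_le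
    ((hg.risk_le 1 one_pos).trans (min_le_right _ _))
  by_contra hM
  refine absurd h (not_lt.2 (div_nonpos_of_nonpos_of_nonneg ?_ (by positivity)))
  exact mul_nonpos_of_nonpos_of_nonneg (not_lt.1 hM) (Phi_nonneg _)

lemma sq_le_of_sqrt_le {m y τ w s C : ℝ} (hm : 0 ≤ m) (hy : 0 ≤ y) (hC : 0 ≤ C)
    (hτ : τ ≤ s * y) (hws : 0 ≤ w + s) (h : √m ≤ √y + C * √(w * y + τ)) :
    m ≤ (1 + (2 * C * √(w + s) + C ^ 2 * (w + s))) * y := by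
  have h1 : √(w * y + τ) ≤ √(w + s) * √y := by
    rw [← Real.sqrt_mul hws]
    exact Real.sqrt_le_sqrt (by linarith)
  have h2 : √m ≤ (1 + C * √(w + s)) * √y := by
    calc √m ≤ √y + C * (√(w + s) * √y) := h.trans (by gcongr)
      _ = _ := by ring
  calc m = √m ^ 2 := (Real.sq_sqrt hm).symm
    _ ≤ ((1 + C * √(w + s)) * √y) ^ 2 := by gcongr
    _ = (1 + (2 * C * √(w + s) + C ^ 2 * √(w + s) ^ 2)) * √y ^ 2 := by ring
    _ = _ := by rw [Real.sq_sqrt hws, Real.sq_sqrt hy]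

lemma tendsto_one_div_L1 {η : ℕ → ℝ} (h : Tendsto η atTop (𝓝 0)) (hη : ∀ n, 0 < η n) :
    Tendsto (fun n => 1 / L1 (η n)) atTop (𝓝 0) := by
  have h1 : Tendsto η atTop (𝓝[>] 0) :=
    tendsto_nhdsWithin_iff.2 ⟨h, Eventually.of_forall hη⟩
  have h2 : Tendsto (fun n => Real.log (1 / η n)) atTop atTop := by
    simp only [one_div]
    exact Real.tendsto_log_atTop.comp (tendsto_inv_nhdsGT_zero.comp h1)
  have h3 : Tendsto (fun n => L1 (η n)) atTop atTop :=
    tendsto_atTop_mono (fun n => le_max_right _ _) h2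
  simp only [one_div]
  exact h3.inv_tendsto_atTop

lemma tendsto_one_div_max_log :
    Tendsto (fun n : ℕ => 1 / max 1 (Real.log n)) atTop (𝓝 0) := by
  have h2 : Tendsto (fun n : ℕ => Real.log n) atTop atTop :=
    Real.tendsto_log_atTop.comp tendsto_natCast_atTop_atTop
  have h3 : Tendsto (fun n : ℕ => max 1 (Real.log n)) atTop atTop :=
    tendsto_atTop_mono (fun n => le_max_right _ _) h2
  simp only [one_div]
  exact h3.inv_tendsto_atTop

lemma ofReal_div_ofReal_le {a b c : ℝ} (hb : 0 < b) (hc : 0 ≤ c) (h : a ≤ (1 + c) * b) :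
    ENNReal.ofReal a / ENNReal.ofReal b ≤ 1 + ENNReal.ofReal c := by
  rw [← ENNReal.ofReal_div_of_pos hb, ← ENNReal.ofReal_one, ← ENNReal.ofReal_add zero_le_one hc]
  exact ENNReal.ofReal_le_ofReal ((div_le_iff₀ hb).2 h)

lemma adaptiveRatioOptimal {α₁ α₂ M₀ : ℝ} {δ₁ δ₂ c₁ c₂ : ℕ → ℝ} {g : ℕ → ℝ → ℝ}
    {lam : (n : ℕ) → (Fin n → ℝ) → ℝ} (h0 : 0 < α₂) (h21 : α₂ ≤ α₁) (h1 : α₁ < 1)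
    (hlam : IsFDRLevel α₁ α₂ M₀ δ₁ δ₂ c₁ c₂ g lam) {M η : ℕ → ℝ} (hM : Tendsto M atTop atTop)
    (hη : Tendsto η atTop (𝓝 0)) : AdaptiveRatioOptimal lam (riskClass δ₁ c₁ c₂ M η) := by
  have hM₀ : 0 < M₀ := (hlam.level 2 le_rfl).M₀_pos
  obtain ⟨A, hA⟩ := hlam.δ₂_tendsto.bddAbove_range
  have hA' : ∀ n, δ₂ n ≤ max A 1 := fun n => (hA ⟨n, rfl⟩).trans (le_max_left _ _)
  obtain ⟨C, hC, hmain⟩ := exists_sqrt_mse_le (α₁' := (1 + α₁) / 2) (α₂' := α₂ / 2)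
    (A := max A 1) (by linarith) (by linarith) (by linarith) (by positivity) hM₀
  -- The given `η n` may vanish or be negative, where the logarithm in `L1` carries no information.
  -- The enlarged sequence is positive and still tends to zero, so `L1 (η' n)` tends to infinity.
  set η' : ℕ → ℝ := fun n => max (η n) (1 / ((n : ℝ) + 1)) with hη'
  have hη'pos : ∀ n, 0 < η' n := fun n => lt_max_of_lt_right (by positivity)
  have hη'lim : Tendsto η' atTop (𝓝 0) := by
    have := hη.max (tendsto_one_div_add_atTop_nhds_zero_nat (𝕜 := ℝ))
    rwa [max_self] at this
  set w : ℕ → ℝ := fun n => δ₂ n + 1 / L1 (η' n) + 1 / max 1 (Real.log n) + 1 / M n with hw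
  have hwlim : Tendsto w atTop (𝓝 0) := by
    have hM' : Tendsto (fun n => 1 / M n) atTop (𝓝 0) := by
      simp only [one_div]
      exact hM.inv_tendsto_atTop
    have := ((hlam.δ₂_tendsto.add (tendsto_one_div_L1 hη'lim hη'pos)).add
      tendsto_one_div_max_log).add hM'
    simp only [add_zero] at this
    exact this
  set r : ℕ → ℝ := fun n => 2 * C * √(w n) + C ^ 2 * w n with hr
  have hrlim : Tendsto r atTop (𝓝 0) := by
    have h3 : Tendsto (fun n => √(w n)) atTop (𝓝 0) := by
      have := (Real.continuous_sqrt.tendsto 0).comp hwlim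
      rwa [Real.sqrt_zero] at this
    simpa using (h3.const_mul (2 * C)).add (hwlim.const_mul (C ^ 2))
  classical
  -- The error must be given for every `n`; at the finitely many indices with `n < 2` or `M n ≤ 0`
  -- it is infinite, which makes the bound trivial there.
  refine ⟨fun n => if 2 ≤ n ∧ 0 < M n then ENNReal.ofReal (r n) else ⊤, ?_, fun n => ?_⟩
  · have h3 : Tendsto (fun n => ENNReal.ofReal (r n)) atTop (𝓝 0) := by
      have := (ENNReal.continuous_ofReal.tendsto 0).comp hrlim
      rwa [ENNReal.ofReal_zero] at this
    refine h3.congr' ?_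
    filter_upwards [eventually_ge_atTop 2, hM.eventually_gt_atTop 0] with n hn hMn
    rw [if_pos ⟨hn, hMn⟩]
  · beta_reduce
    split_ifs with hn
    swap
    · simp
    obtain ⟨hn, hMn⟩ := hn
    have hn' : (0 : ℝ) < n := by
      have : 0 < n := by omega
      exact_mod_cast this
    refine iSup₂_le fun θ hθ => ?_
    obtain ⟨hlow, hupp⟩ := hθ
    have hτ := tau2_pos (c₁ := c₁ n) (c₂ := c₂ n) (hlam.δ₁_nonneg n hn) hn
    rw [mul_div_assoc] at hlow
    change M n * tau2 (δ₁ n) (c₁ n) (c₂ n) n ≤ etaOpt θ at hlow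
    have hy : 0 < etaOpt θ := (mul_pos hMn hτ).trans_le hlow
    have hδ2 : 0 ≤ δ₂ n := (hlam.δ₁_nonneg n hn).trans (hlam.δ₁_le n hn)
    have hL : 0 < L1 (η' n) := (Real.exp_pos 1).trans_le (le_max_left _ _)
    have hw0 : 0 ≤ w n := by
      simp only [hw]
      positivity
    have hb : minSoftRisk θ = n * etaOpt θ := by
      unfold etaOpt
      field_simp
    have hkey := hmain α₁ α₂ 1 1 soft (δ₁ n) (δ₂ n) (c₁ n) (c₂ n) (g n) n (lam n) θ (η' n)
      (by linarith) h21 (by linarith) (by norm_num) isSmoothThreshold_soft hn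
      ((hlam.δ₁_le n hn).trans (hA' n)) (hlam.isLevelAt hn) (hupp.trans (le_max_left _ _))
    -- The lower bound defining the class makes the additive term `τ*` a vanishing fraction of the
    -- optimal risk.
    have hτ' : tau2 (δ₁ n) (c₁ n) (c₂ n) n ≤ 1 / M n * etaOpt θ := by
      rw [one_div_mul_eq_div, le_div_iff₀ hMn]
      linarith
    have hres := sq_le_of_sqrt_le (div_nonneg (mse_nonneg θ _) hn'.le) hy.le hC.le hτ'
      hw0 hkey
    refine ofReal_div_ofReal_le (by rw [hb]; positivity) ?_ ?_
    · simp only [hr]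
      positivity
    · rw [div_le_iff₀ hn'] at hres
      rw [hb]
      refine hres.trans (le_of_eq ?_)
      simp only [hr, hw]
      ring

end FDRThreshold

end

theorem corollary1 :
    (∀ α₁' α₂' β₀ A M₀ : ℝ, 0 < α₂' → α₂' < α₁' → α₁' < 1 → 0 < β₀ → β₀ ≤ 1 / 2 → 0 < A → 0 < M₀ →
      ∃ Mstar : ℝ, 0 < Mstar ∧
        ∀ (α₁ α₂ κ₀ κ₁ : ℝ) (t : ℝ → ℝ → ℝ) (δ₁ δ₂ c₁ c₂ : ℕ → ℝ) (g : ℕ → ℝ → ℝ)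
          (lam : (n : ℕ) → (Fin n → ℝ) → ℝ),
          α₂' < α₂ → α₂ ≤ α₁ → α₁ < α₁' → 1 ≤ κ₀ → κ₀ < 2 →
          IsSmoothThreshold κ₀ κ₁ t →
          IsFDRLevel α₁ α₂ M₀ δ₁ δ₂ c₁ c₂ g lam →
          (∀ n, 2 ≤ n → δ₁ n ≤ A) →
          (∀ n, 2 ≤ n → BelowNStar α₁' β₀ n → 1 + δ₂ n ≤ A) →
          ∀ (n : ℕ), 2 ≤ n → ∀ (θ : Fin n → ℝ) (η : ℝ), etaOpt θ ≤ η →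
            MeasureTheory.Integrable (fun x => sqLoss θ (thresholdEst t (lam n) x))
              (normalMeans θ) ∧
            √(mse θ (thresholdEst t (lam n)) / n) ≤
              √(etaOpt θ) +
                Mstar * √(tau1 (δ₂ n) (c₁ n) (c₂ n) η n * etaOpt θ
                  + tau2 (δ₁ n) (c₁ n) (c₂ n) n)) ∧
    (∀ (α₁ α₂ M₀ : ℝ) (δ₁ δ₂ c₁ c₂ : ℕ → ℝ) (g : ℕ → ℝ → ℝ)
      (lam : (n : ℕ) → (Fin n → ℝ) → ℝ),
      0 < α₂ → α₂ ≤ α₁ → α₁ < 1 →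
      IsFDRLevel α₁ α₂ M₀ δ₁ δ₂ c₁ c₂ g lam →
      ∀ M η : ℕ → ℝ, Filter.Tendsto M Filter.atTop Filter.atTop →
        Filter.Tendsto η Filter.atTop (nhds 0) →
        AdaptiveRatioOptimal lam (riskClass δ₁ c₁ c₂ M η)) := by
  refine ⟨?_, fun α₁ α₂ M₀ δ₁ δ₂ c₁ c₂ g lam h0 h21 h1 hlam M η hM hη =>
    adaptiveRatioOptimal h0 h21 h1 hlam hM hη⟩
  intro α₁' α₂' β₀ A M₀ h2 h21 h1 _ _ hA hM
  obtain ⟨C, hC, hmain⟩ := exists_sqrt_mse_le h2 h21 h1 hA hM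
  -- The three rates together are at most three times `tau1` (`rate_le_tau1`), and `√3 ≤ 2`.
  refine ⟨2 * C, by positivity, ?_⟩
  intro α₁ α₂ κ₀ κ₁ t δ₁ δ₂ c₁ c₂ g lam hα2 hα21 hα1 _ hκ ht hlam hδA _ n hn θ η hη
  have hlev := hlam.isLevelAt hn
  have hlow := hlev.lower_nonneg (by omega) (by linarith) (by linarith)
  refine ⟨integrable_sqLoss ht hκ θ hlev.measurable fun x => (hlow x).trans (hlev.lower x),
    (hmain α₁ α₂ κ₀ κ₁ t (δ₁ n) (δ₂ n) (c₁ n) (c₂ n) (g n) n (lam n) θ η hα2.le hα21 hα1.le hκ ht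
      hn (hδA n hn) hlev hη).trans ?_⟩
  have hy := etaOpt_nonneg θ
  have hτ := (tau2_pos (c₁ := c₁ n) (c₂ := c₂ n) hlev.δ₁_nonneg hn).le
  have hrate := mul_le_mul_of_nonneg_right (rate_le_tau1 (δ₂ n) (c₁ n) (c₂ n) η n) hy
  have hδ2 : δ₂ n ≤ tau1 (δ₂ n) (c₁ n) (c₂ n) η n := (le_max_left _ _).trans (le_max_left _ _)
  have h4 : √((δ₂ n + 1 / L1 η + 1 / max 1 (Real.log n)) * etaOpt θ
      + tau2 (δ₁ n) (c₁ n) (c₂ n) n) ≤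
      2 * √(tau1 (δ₂ n) (c₁ n) (c₂ n) η n * etaOpt θ + tau2 (δ₁ n) (c₁ n) (c₂ n) n) := by
    have hnn : 0 ≤ tau1 (δ₂ n) (c₁ n) (c₂ n) η n * etaOpt θ :=
      mul_nonneg ((hlev.δ₁_nonneg.trans hlev.δ₁_le).trans hδ2) hy
    refine Real.sqrt_le_iff.2 ⟨by positivity, ?_⟩
    rw [mul_pow, Real.sq_sqrt (by positivity)]
    linarith
  have h5 := mul_le_mul_of_nonneg_left h4 hC.le
  linarith
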